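/- Let $W=(W^1,\dots,W^m)$ be an $m$-dimensional Brownian motion (independent standard real Brownian motions with continuous paths) on a probability space $(\Omega,\mathcal F,\mathbf P)$, and let $\mathcal F_t=\sigma(\mathcal N\cup\{W_s:0\le s\le t\})$, $t\ge 0$, be the filtration it generates, augmented with the family $\mathcal N$ of all subsets of $\Omega$ contained in an event of probability zero. Fix $T>0$. Let $M^{2,1\times m}[0,T]$ be the set of processes $X=(X_s)_{s\ge 0}$ with values in the row vectors $\mathbb R^{1\times m}$ (with Euclidean norm $|\cdot|$) that are adapted to $(\mathcal F_t)$, jointly measurable in $(s,\omega)$ on $[0,T]\times\Omega$, and satisfy $E\int_0^T|X^j_s|^2\,ds<\infty$ for each entry $X^j$. A step process on $[0,t]$ is a process $\sum_{i=0}^{n-1}e_i\mathbf 1_{[t_i,t_{i+1})}$ with $0=t_0<\dots<t_n=t$ and $e_i$ a real $\mathcal F_{t_i}$-measurable random variable; its integral against $W^j$ is $\sum_{i=0}^{n-1} e_i(W^j_{t_{i+1}}-W^j_{t_i})$. The Itô integral $\int_0^tX^j_s\,dW^j_s$ is the limit in probability of the integrals of step processes $X^{j,n}$ on $[0,t]$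 with $\int_0^t|X^{j,n}_s-X^j_s|^2\,ds\to0$ almost surely (and is $0$ for $t=0$). The Itô integral process of $X$ is $\int_0^tX_s\,dW_s=\sum_{j=1}^m\int_0^tX^j_s\,dW^j_s$, $0\le t\le T$, where for each summand a version with almost surely continuous paths is taken. Let $p\ge1$ be a real number and let $X\in M^{2,1\times m}[0,T]$ satisfy $E\int_0^T|X_s|^{2p}\,ds<\infty$. Then the Itô integral process of $X$ exists, and (every such continuous version of it) satisfies $$E\Bigl[\sup_{t\in[0,T]}\Bigl|\int_0^tX_s\,dW_s\Bigr|^{2p}\Bigr]\le C_p\,T^{p-1}\,E\int_0^T|X_s|^{2p}\,ds,\qquad C_p=\Bigl[\frac{4p^3}{2p-1}\Bigr]^p .$$ -/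

import Mathlib

open MeasureTheory ProbabilityTheory Filter Topology
open scoped NNReal ENNReal

namespace ItoCalculus

/-- Lebesgue measure on the time axis `[0,∞)`. -/
noncomputable def lebesgueTime : Measure ℝ≥0 :=
  Measure.comap (fun t : ℝ≥0 => (t : ℝ)) volume

/-- `W = (W¹, …, Wᵐ)` is an `m`-dimensional Brownian motion: its components are independent
standard real Brownian motions (with almost surely continuous paths). -/
structure IsBrownianMotion {Ω : Type*} [MeasurableSpace Ω] {m : ℕ}
    (W : Fin m → ℝ≥0 → Ω → ℝ) (P : Measure Ω) : Prop where
  measurable : ∀ j t, Measurable (W j t)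
  isBrownianReal : ∀ j, IsBrownianReal (W j) P
  iIndepFun : iIndepFun (fun (j : Fin m) (ω : Ω) (t : ℝ≥0) => W j t ω) P

/-- The filtration `ℱ_t = σ(𝒩 ∪ {W_s : s ≤ t})` generated by `W` and augmented with the family
`𝒩` of all `P`-null subsets of `Ω` (`P E = 0` says that `E` lies in a measurable set of
probability zero). The underlying probability space is not assumed to be complete, so `ℱ_t` is
given as a family of σ-algebras on `Ω`. -/
@[reducible] def augmentedFiltration {Ω : Type*} [MeasurableSpace Ω] {m : ℕ}
    (W : Fin m → ℝ≥0 → Ω → ℝ) (P : Measure Ω) (t : ℝ≥0) : MeasurableSpace Ω :=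
  MeasurableSpace.generateFrom {E : Set Ω | P E = 0} ⊔
    ⨆ (j : Fin m) (s : ℝ≥0) (_ : s ≤ t), MeasurableSpace.comap (W j s) inferInstance

/-- The class `M^p[t₀,t]` of real processes adapted to `ℱ`, jointly measurable (up to
`ds ⊗ P`-null sets) on `[t₀,t] × Ω`, with `E ∫_{t₀}^t |X_s|^p ds < ∞`. -/
structure MemM {Ω : Type*} [MeasurableSpace Ω] (ℱ : ℝ≥0 → MeasurableSpace Ω) (P : Measure Ω)
    (p : ℝ) (t₀ t : ℝ≥0) (X : ℝ≥0 → Ω → ℝ) : Prop where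
  adapted : ∀ s, Measurable[ℱ s] (X s)
  aemeasurable : AEMeasurable (Function.uncurry X) ((lebesgueTime.restrict (Set.Icc t₀ t)).prod P)
  lintegral_lt_top : ∫⁻ ω, ∫⁻ s in Set.Icc t₀ t, ‖X s ω‖ₑ ^ p ∂lebesgueTime ∂P < ∞

/-- The class `M^{p,1×m}[t₀,t]`: row-vector valued processes all of whose entries lie in
`M^p[t₀,t]`. Row vectors carry the Euclidean norm. -/
def MemMRow {Ω : Type*} [MeasurableSpace Ω] {m : ℕ} (ℱ : ℝ≥0 → MeasurableSpace Ω) (P : Measure Ω)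
    (p : ℝ) (t₀ t : ℝ≥0) (X : ℝ≥0 → Ω → EuclideanSpace ℝ (Fin m)) : Prop :=
  ∀ j, MemM ℱ P p t₀ t (fun s ω => X s ω j)

/-- A step (simple) process `∑_{i<n} e_i 1_{[t_i, t_{i+1})}` on `[t₀,t]`, where
`t₀ = t_0 < t_1 < ⋯ < t_n = t` and `e_i` is a real `ℱ_{t_i}`-measurable random variable.
(If `t₀ = t`, only the empty sum `n = 0` occurs.) -/
structure StepProc {Ω : Type*} (ℱ : ℝ≥0 → MeasurableSpace Ω) (t₀ t : ℝ≥0) where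
  n : ℕ
  part : Fin (n + 1) → ℝ≥0
  strictMono_part : StrictMono part
  part_zero : part 0 = t₀
  part_last : part (Fin.last n) = t
  coef : Fin n → Ω → ℝ
  measurable_coef : ∀ i : Fin n, Measurable[ℱ (part i.castSucc)] (coef i)

/-- The value at time `s` of a step process. -/
noncomputable def StepProc.eval {Ω : Type*} {ℱ : ℝ≥0 → MeasurableSpace Ω} {t₀ t : ℝ≥0}
    (S : StepProc ℱ t₀ t) (s : ℝ≥0) (ω : Ω) : ℝ :=
  ∑ i : Fin S.n, (Set.Ico (S.part i.castSucc) (S.part i.succ)).indicator (fun _ => S.coef i ω) s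

/-- The stochastic integral `∑_{i<n} e_i (B_{t_{i+1}} - B_{t_i})` of a step process with respect
to the real process `B`. -/
noncomputable def StepProc.integral {Ω : Type*} {ℱ : ℝ≥0 → MeasurableSpace Ω} {t₀ t : ℝ≥0}
    (S : StepProc ℱ t₀ t) (B : ℝ≥0 → Ω → ℝ) (ω : Ω) : ℝ :=
  ∑ i : Fin S.n, S.coef i ω * (B (S.part i.succ) ω - B (S.part i.castSucc) ω)

/-- The random variable `ξ` is (a version of) the Itô integral `∫_{t₀}^t X_s dB_s`: it is the
limit in probability of the integrals of step processes `Xⁿ` such that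
`∫_{t₀}^t |Xⁿ_s - X_s|² ds → 0` almost surely. -/
def IsItoIntegral {Ω : Type*} [MeasurableSpace Ω] (ℱ : ℝ≥0 → MeasurableSpace Ω) (P : Measure Ω)
    (B : ℝ≥0 → Ω → ℝ) (t₀ t : ℝ≥0) (X : ℝ≥0 → Ω → ℝ) (ξ : Ω → ℝ) : Prop :=
  ∃ S : ℕ → StepProc ℱ t₀ t,
    (∀ᵐ ω ∂P, Tendsto
      (fun n => ∫⁻ s in Set.Icc t₀ t, ‖(S n).eval s ω - X s ω‖ₑ ^ (2 : ℝ) ∂lebesgueTime)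
      atTop (𝓝 0)) ∧
    TendstoInMeasure P (fun n => (S n).integral B) atTop ξ

/-- `J` is the Itô integral of the real process `X` on `[0,T]` as a process: for every
`t ∈ [0,T]` the random variable `J_t` is (a version of) `∫_0^t X_s dB_s`, and the paths of `J`
are almost surely continuous on `[0,T]`. -/
structure IsContItoIntegral {Ω : Type*} [MeasurableSpace Ω] (ℱ : ℝ≥0 → MeasurableSpace Ω)
    (P : Measure Ω) (B : ℝ≥0 → Ω → ℝ) (T : ℝ≥0) (X : ℝ≥0 → Ω → ℝ) (J : ℝ≥0 → Ω → ℝ) :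
    Prop where
  isItoIntegral : ∀ t ≤ T, IsItoIntegral ℱ P B 0 t X (J t)
  continuousOn : ∀ᵐ ω ∂P, ContinuousOn (fun t => J t ω) (Set.Icc 0 T)

/-- `I` is the Itô integral process `I_t = ∫_0^t X_s dW_s = ∑_j ∫_0^t X^j_s dW^j_s`,
`t ∈ [0,T]`, of the row-vector valued process `X` with respect to the `m`-dimensional process
`W` (each summand in its continuous version). -/
def IsItoIntegralRow {Ω : Type*} [MeasurableSpace Ω] {m : ℕ} (ℱ : ℝ≥0 → MeasurableSpace Ω)
    (P : Measure Ω) (W : Fin m → ℝ≥0 → Ω → ℝ) (T : ℝ≥0)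
    (X : ℝ≥0 → Ω → EuclideanSpace ℝ (Fin m)) (I : ℝ≥0 → Ω → ℝ) : Prop :=
  ∃ J : Fin m → ℝ≥0 → Ω → ℝ,
    (∀ j, IsContItoIntegral ℱ P (W j) T (fun s ω => X s ω j) (J j)) ∧
    ∀ t ω, I t ω = ∑ j, J j t ω

end ItoCalculus

namespace ItoCalculus

/-! Put `q = 2p`. The estimate is first proved for step processes, with a constant that does not
depend on the partition, and then carried to the limit. Itô's formula is not used. Its role is
played by a Gaussian inequality for a standard normal Z (`gaussian_moment_le`): E|x + sZ|^q ≤ (x² +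
(q-1)s²)^{q/2}. Let M_n be the discrete integral with coefficients ξ_k and time steps Δ_k. A
Brownian increment is independent of the past, so freezing the past gives E|M_{n+1}|^q ≤ E(M_n² +
(q-1)Δ_n|ξ_n|²)^{q/2} (`lintegral_add_increment_le`). Minkowski's inequality in L^{q/2} makes this
additive: ‖M_n‖_q² ≤ (q-1) Σ Δ_k ‖ξ_k‖_q². Jensen's inequality in time then yields E|M_n|^q ≤
(q-1)^{q/2} T^{q/2-1} Σ Δ_k E|ξ_k|^q. Doob's inequality contributes (q/(q-1))^q. The product of the
constants is (4p²/(2p-1))^p T^{p-1}, which is at most C_p T^{p-1} because p ≥ 1.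

Adapted processes in L^q are approximated by sampling them on a well-chosen shift of a fine grid
(`exists_grid`, `exists_stepProc_approx`); sampling keeps adaptedness. Along a rapidly convergent
approximation the maximal inequality forces uniform convergence of the integrals, which produces a
continuous version (`exists_isContItoIntegral`). The bound passes to this version by Fatou's lemma,
with the supremum taken over a countable dense set of times (`lintegral_iSup_limit_le`).

An arbitrary version comes from step processes that converge only almost surely, without moments. A
truncation argument controls discrete integrals in probability (`measure_discreteIntegral_ge_le`)
and shows that any two versions agree almost surely at each time (`IsItoIntegral.ae_eq`). Path
continuity extends the bound from the dense set to the whole interval.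

The augmentation is harmless: each variable measurable for the augmented σ-algebra is almost surely
equal to one measurable for the raw σ-algebra, where independence is available. -/

/-! ### Gaussian moments: Stein's identity and a sharp moment inequality. -/

lemma integrable_affine_abs_rpow_gaussianReal (a b : ℝ) (v : ℝ≥0) {q : ℝ} (hq : 0 ≤ q) :
    Integrable (fun z => |a + b * z| ^ q) (gaussianReal 0 v) := by
  have h : MemLp (fun z : ℝ => a + b * z) (q.toNNReal : ℝ≥0∞) (gaussianReal 0 v) :=
    (memLp_const a).add ((memLp_id_gaussianReal q.toNNReal).const_mul b)
  simpa [hq] using h.integrable_norm_rpow'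

lemma hasDerivAt_abs_rpow_mul_self (x : ℝ) {r : ℝ} (hr : 0 ≤ r) :
    HasDerivAt (fun y : ℝ => |y| ^ r * y) ((r + 1) * |x| ^ r) x := by
  rcases hr.eq_or_lt with rfl | hr
  · simpa using hasDerivAt_id' x
  rcases lt_trichotomy x 0 with hx | rfl | hx
  · have h1 : HasDerivAt (fun y : ℝ => (-y) ^ r * y) ((r + 1) * |x| ^ r) x := by
      have := ((hasDerivAt_neg x).rpow_const (p := r) (Or.inl (by linarith : -x ≠ 0))).mul
        (hasDerivAt_id x)
      convert! this using 1
      have h2 : (-x) ^ r = (-x) ^ (r - 1) * (-x) := by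
        rw [← Real.rpow_add_one (by linarith)]; ring_nf
      rw [abs_of_neg hx]
      simp only [id, mul_one]
      rw [h2]; ring
    refine h1.congr_of_eventuallyEq ?_
    filter_upwards [gt_mem_nhds hx] with y hy
    rw [abs_of_neg hy]
  · simp only [abs_zero, Real.zero_rpow hr.ne', mul_zero]
    rw [hasDerivAt_iff_tendsto_slope]
    have h : Tendsto (fun y : ℝ => |y| ^ r) (𝓝[≠] 0) (𝓝 0) := by
      have : ContinuousAt (fun y : ℝ => |y| ^ r) 0 :=
        continuous_abs.continuousAt.rpow_const (Or.inr hr.le)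
      simpa [ContinuousAt, Real.zero_rpow hr.ne'] using this.tendsto.mono_left nhdsWithin_le_nhds
    refine h.congr' ?_
    filter_upwards [self_mem_nhdsWithin] with y hy
    have : y ≠ 0 := hy
    simp [slope_def_field, Real.zero_rpow hr.ne', this]
  · have h1 : HasDerivAt (fun y : ℝ => y ^ r * y) ((r + 1) * |x| ^ r) x := by
      have := ((hasDerivAt_id x).rpow_const (p := r) (Or.inl hx.ne')).mul
        (hasDerivAt_id x)
      convert! this using 1
      have h2 : x ^ r = x ^ (r - 1) * x := by
        rw [← Real.rpow_add_one hx.ne']; ring_nf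
      rw [abs_of_pos hx]
      simp only [id, mul_one, one_mul]
      rw [h2]; ring
    refine h1.congr_of_eventuallyEq ?_
    filter_upwards [lt_mem_nhds hx] with y hy
    rw [abs_of_pos hy]

lemma hasDerivAt_gaussianPDFReal_std (z : ℝ) :
    HasDerivAt (gaussianPDFReal 0 1) (-z * gaussianPDFReal 0 1 z) z := by
  rw [gaussianPDFReal_def]
  have h : HasDerivAt (fun x : ℝ => -(x - 0) ^ 2 / (2 * ((1 : ℝ≥0) : ℝ))) (-z) z := by
    have := (((hasDerivAt_id z).sub_const 0).pow 2).neg.div_const (2 * ((1 : ℝ≥0) : ℝ))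
    convert! this using 1
    simp only [id, sub_zero, NNReal.coe_one, Nat.cast_ofNat]; ring
  refine (h.exp.const_mul (√(2 * Real.pi * ((1 : ℝ≥0) : ℝ)))⁻¹).congr_deriv ?_
  ring

lemma integrable_gaussianReal_std_iff {f : ℝ → ℝ} :
    Integrable f (gaussianReal 0 1) ↔ Integrable (fun z => gaussianPDFReal 0 1 z * f z) := by
  rw [gaussianReal_of_var_ne_zero _ one_ne_zero,
    integrable_withDensity_iff_integrable_smul' (measurable_gaussianPDF 0 1)
      (ae_of_all _ fun _ => gaussianPDF_lt_top)]
  simp [toReal_gaussianPDF]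

/-- **Stein's identity**. -/
lemma integral_mul_self_gaussianReal_std {f f' : ℝ → ℝ} (hf : ∀ z, HasDerivAt f (f' z) z)
    (h0 : Integrable f (gaussianReal 0 1)) (h1 : Integrable (fun z => z * f z) (gaussianReal 0 1))
    (h2 : Integrable f' (gaussianReal 0 1)) :
    ∫ z, z * f z ∂gaussianReal 0 1 = ∫ z, f' z ∂gaussianReal 0 1 := by
  rw [integrable_gaussianReal_std_iff] at h0 h1 h2
  rw [integral_gaussianReal_eq_integral_smul one_ne_zero,
    integral_gaussianReal_eq_integral_smul one_ne_zero]
  have := integral_mul_deriv_eq_deriv_mul_of_integrable (u := f) (v := gaussianPDFReal 0 1)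
    (u' := f') (v' := fun z => -z * gaussianPDFReal 0 1 z) (fun z _ => hf z)
    (fun z _ => hasDerivAt_gaussianPDFReal_std z)
    (by convert! h1.neg using 1; ext z; simp; ring)
    (by convert! h2 using 1; ext z; simp; ring)
    (by convert! h0 using 1; ext z; simp; ring)
  have e1 : ∫ z, gaussianPDFReal 0 1 z • (z * f z)
      = -∫ z, f z * (-z * gaussianPDFReal 0 1 z) := by
    rw [← integral_neg]; congr 1; ext z; simp; ring
  rw [e1, this, neg_neg]
  congr 1; ext z; simp; ring

section Moments
variable {q : ℝ} (hq : 2 ≤ q) (x : ℝ)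
include hq

/-- Differentiation under the integral gives E[Z f(Z)] with f(z) = q|x+sz|^{q-2}(x+sz). Stein's
identity turns this into E f'(Z), which lowers the exponent to q-2 and produces the factor s. -/
lemma hasDerivAt_gaussian_moment (s : ℝ) :
    HasDerivAt (fun s : ℝ => ∫ z, |x + s * z| ^ q ∂gaussianReal 0 1)
      (q * (q - 1) * s * ∫ z, |x + s * z| ^ (q - 2) ∂gaussianReal 0 1) s := by
  have hA := integrable_affine_abs_rpow_gaussianReal
  -- `c` bounds |y| for y within distance 1 of s. The quantity A = 1 + |x| + (c+1)|z| below
  -- dominates |z| and |x+yz| together, so q·A^q dominates the derivative uniformly in y.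
  set c : ℝ := |s| + 1 with hc
  have hbnd : ∀ z : ℝ, ∀ y ∈ Metric.ball s 1,
      ‖z * (q * (|x + y * z| ^ (q - 2) * (x + y * z)))‖ ≤ q * (1 + |x| + (c + 1) * |z|) ^ q := by
    intro z y hy
    have hy' : |y| ≤ c := by
      have h1 : |y - s| < 1 := by simpa [Real.dist_eq] using hy
      have := abs_sub_abs_le_abs_sub y s
      linarith
    have hc0 : 0 ≤ c := by positivity
    set A := 1 + |x| + (c + 1) * |z| with hAdef
    have hA1 : 1 ≤ A := by
      have := abs_nonneg x
      have : 0 ≤ (c + 1) * |z| := by positivity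
      linarith
    have hz : |z| ≤ A := by nlinarith [abs_nonneg x, abs_nonneg z]
    have hxy : |x + y * z| ≤ A := by
      calc |x + y * z| ≤ |x| + |y| * |z| := by rw [← abs_mul]; exact abs_add_le _ _
        _ ≤ |x| + c * |z| := by gcongr
        _ ≤ A := by nlinarith [abs_nonneg z]
    have e : A ^ q = A * (A ^ (q - 2) * A) := by
      have hA0 : A ≠ 0 := by linarith
      rw [← Real.rpow_add_one hA0, mul_comm, ← Real.rpow_add_one hA0]; ring_nf
    rw [Real.norm_eq_abs, abs_mul, abs_mul, abs_mul, abs_of_pos (by linarith : 0 < q),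
      abs_of_nonneg (Real.rpow_nonneg (abs_nonneg _) _), e]
    calc |z| * (q * (|x + y * z| ^ (q - 2) * |x + y * z|))
        ≤ A * (q * (A ^ (q - 2) * A)) := by
          have : |x + y * z| ^ (q - 2) ≤ A ^ (q - 2) :=
            Real.rpow_le_rpow (abs_nonneg _) hxy (by linarith)
          gcongr
      _ = _ := by ring
  have hbint : Integrable (fun z : ℝ => q * (1 + |x| + (c + 1) * |z|) ^ q) (gaussianReal 0 1) := by
    have h := (memLp_id_gaussianReal (μ := 0) (v := 1) q.toNNReal).norm.const_mul (c + 1)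
    have h1 := (memLp_const (p := (q.toNNReal : ℝ≥0∞)) (μ := gaussianReal 0 1) (1 + |x|)).add h
    have h0 : 0 ≤ q := by linarith
    refine (h1.integrable_norm_rpow'.congr (ae_of_all _ fun z => ?_)).const_mul q
    have : 0 ≤ 1 + |x| + (c + 1) * |z| := by positivity
    simp only [Pi.add_apply, id, Real.norm_eq_abs, ENNReal.coe_toReal, Real.coe_toNNReal _ h0,
      abs_of_nonneg this]
  have hcont : ∀ y : ℝ, Continuous fun z : ℝ => |x + y * z| ^ (q - 2) := fun y =>
    (by fun_prop : Continuous fun z : ℝ => |x + y * z|).rpow_const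
      fun _ => Or.inr (by linarith)
  have hmeas : AEStronglyMeasurable
      (fun z : ℝ => z * (q * (|x + s * z| ^ (q - 2) * (x + s * z)))) (gaussianReal 0 1) :=
    (continuous_id.mul (continuous_const.mul
      ((hcont s).mul (by fun_prop)))).aestronglyMeasurable
  have hdiff : ∀ z : ℝ, ∀ y ∈ Metric.ball s 1, HasDerivAt (fun y : ℝ => |x + y * z| ^ q)
      (z * (q * (|x + y * z| ^ (q - 2) * (x + y * z)))) y := by
    intro z y _
    have h1 : HasDerivAt (fun y : ℝ => x + y * z) z y := by
      simpa using ((hasDerivAt_id y).mul_const z).const_add x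
    have h2 := (hasDerivAt_abs_rpow (x + y * z) (by linarith : 1 < q)).comp y h1
    refine h2.congr_deriv ?_
    ring
  have hder := hasDerivAt_integral_of_dominated_loc_of_deriv_le (𝕜 := ℝ) (E := ℝ)
    (s := Metric.ball s 1)
    (μ := gaussianReal 0 1) (F := fun s z => |x + s * z| ^ q) (x₀ := s)
    (F' := fun y z => z * (q * (|x + y * z| ^ (q - 2) * (x + y * z))))
    (bound := fun z => q * (1 + |x| + (c + 1) * |z|) ^ q)
    (Metric.ball_mem_nhds s one_pos)
    (Eventually.of_forall fun y => (hA x y 1 (by linarith : 0 ≤ q)).aestronglyMeasurable)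
    (hA x s 1 (by linarith)) hmeas (ae_of_all _ hbnd) hbint (ae_of_all _ hdiff)
  refine hder.2.congr_deriv ?_
  have hf : ∀ z : ℝ, HasDerivAt (fun z : ℝ => q * (|x + s * z| ^ (q - 2) * (x + s * z)))
      (q * (q - 1) * s * |x + s * z| ^ (q - 2)) z := by
    intro z
    have h1 : HasDerivAt (fun z : ℝ => x + s * z) s z := by
      simpa using ((hasDerivAt_id z).const_mul s).const_add x
    have h2 := ((hasDerivAt_abs_rpow_mul_self (x + s * z)
      (by linarith : 0 ≤ q - 2)).comp z h1).const_mul q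
    refine h2.congr_deriv ?_
    ring
  rw [integral_mul_self_gaussianReal_std hf ?_ hder.1 ((hA x s 1 (by linarith)).const_mul _),
    integral_const_mul]
  have h1 := (hA x s 1 (by linarith : 0 ≤ q - 1)).const_mul q
  refine h1.mono (by have := hcont s; exact Continuous.aestronglyMeasurable (by fun_prop))
    (ae_of_all _ fun z => ?_)
  rw [norm_mul, norm_mul, norm_mul]
  gcongr
  simp only [Real.norm_eq_abs]
  rw [abs_of_nonneg (Real.rpow_nonneg (abs_nonneg _) _),
    abs_of_nonneg (Real.rpow_nonneg (abs_nonneg _) _)]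
  rcases eq_or_ne (x + s * z) 0 with h | h
  · rw [h]; simp only [abs_zero, mul_zero]; positivity
  · rw [← Real.rpow_add_one (by simpa using h)]
    apply le_of_eq; ring_nf

/-- Write H(s) for the left side. The derivative formula and Jensen's inequality give H' ≤
q(q-1)s·H^{(q-2)/q}, that is (H^{2/q})' ≤ 2(q-1)s. Integrating from H(0) = |x|^q gives the bound. -/
lemma gaussian_moment_le (s : ℝ) (hs : 0 ≤ s) :
    ∫ z, |x + s * z| ^ q ∂gaussianReal 0 1 ≤ (x ^ 2 + (q - 1) * s ^ 2) ^ (q / 2) := by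
  have hA := integrable_affine_abs_rpow_gaussianReal
  set H : ℝ → ℝ := fun s => ∫ z, |x + s * z| ^ q ∂gaussianReal 0 1 with hH
  have hH0 : ∀ s, 0 ≤ H s := fun s => integral_nonneg fun z => by positivity
  have hq0 : 0 < q := by linarith
  have hJ : ∀ s, ∫ z, |x + s * z| ^ (q - 2) ∂gaussianReal 0 1 ≤ H s ^ ((q - 2) / q) := by
    intro s
    have hθ0 : 0 ≤ (q - 2) / q := div_nonneg (by linarith) hq0.le
    have hθ : (q - 2) / q ≤ 1 := (div_le_one hq0).2 (by linarith)
    have e : ∀ z, (|x + s * z| ^ q) ^ ((q - 2) / q) = |x + s * z| ^ (q - 2) := fun z => by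
      rw [← Real.rpow_mul (abs_nonneg _)]; congr 1; field_simp
    have := (Real.concaveOn_rpow hθ0 hθ).le_map_integral
      (μ := gaussianReal 0 1) (f := fun z => |x + s * z| ^ q)
      (Real.continuous_rpow_const hθ0).continuousOn isClosed_Ici
      (ae_of_all _ fun z => by simp only [Set.mem_Ici]; positivity) (hA x s 1 hq0.le)
      (by simp only [Function.comp_def, e]; exact hA x s 1 (by linarith))
    simpa only [e] using this
  -- The shift by ε keeps the base of the power 2/q positive, hence differentiable; H vanishes when
  -- x = s = 0.
  have key : ∀ ε > 0, H s ≤ ((|x| ^ q + ε) ^ (2 / q) + (q - 1) * s ^ 2) ^ (q / 2) := by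
    intro ε hε
    set K : ℝ → ℝ := fun s => (H s + ε) ^ (2 / q) - (q - 1) * s ^ 2 with hK
    have hKd : ∀ s, HasDerivAt K
        (q * (q - 1) * s * (∫ z, |x + s * z| ^ (q - 2) ∂gaussianReal 0 1) * (2 / q) *
          (H s + ε) ^ (2 / q - 1) - (q - 1) * (2 * s)) s := by
      intro s
      have h1 := ((hasDerivAt_gaussian_moment hq x s).add_const ε).rpow_const (p := 2 / q)
        (Or.inl (by have := hH0 s; positivity : H s + ε ≠ 0))
      have h2 := ((hasDerivAt_id s).pow 2).const_mul (q - 1)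
      refine (h1.sub h2).congr_deriv ?_
      simp [hH]
    -- The derivative of K is 2(q-1)s·(E|x+sZ|^{q-2}·(H+ε)^{2/q-1} - 1), and the bracket is
    -- nonpositive by `hJ`.
    have hanti : AntitoneOn K (Set.Ici 0) := by
      apply antitoneOn_of_deriv_nonpos (convex_Ici 0)
        (fun s _ => (hKd s).continuousAt.continuousWithinAt)
        (fun s _ => (hKd s).differentiableAt.differentiableWithinAt)
      intro s hs
      rw [(hKd s).deriv]
      have hs : 0 < s := by simpa using hs
      have hpos : 0 < H s + ε := by have := hH0 s; positivity
      have h3 : (∫ z, |x + s * z| ^ (q - 2) ∂gaussianReal 0 1) * (H s + ε) ^ (2 / q - 1) ≤ 1 := by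
        calc _ ≤ (H s + ε) ^ ((q - 2) / q) * (H s + ε) ^ (2 / q - 1) := by
              refine mul_le_mul_of_nonneg_right ((hJ s).trans ?_) (by positivity)
              exact Real.rpow_le_rpow (hH0 s) (by linarith)
                (div_nonneg (by linarith) hq0.le)
          _ = 1 := by
              rw [← Real.rpow_add hpos]
              have : (q - 2) / q + (2 / q - 1) = 0 := by field_simp; ring
              rw [this, Real.rpow_zero]
      have h4 : 0 ≤ 2 * (q - 1) * s := by have : 0 ≤ q - 1 := by linarith
                                          positivity
      have e : q * (q - 1) * s * (∫ z, |x + s * z| ^ (q - 2) ∂gaussianReal 0 1) * (2 / q) *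
          (H s + ε) ^ (2 / q - 1) = 2 * (q - 1) * s *
          ((∫ z, |x + s * z| ^ (q - 2) ∂gaussianReal 0 1) * (H s + ε) ^ (2 / q - 1)) := by
        field_simp
      rw [e]
      nlinarith [mul_le_mul_of_nonneg_left h3 h4]
    have h5 := hanti (Set.mem_Ici.2 le_rfl) (Set.mem_Ici.2 hs) hs
    have h6 : H 0 = |x| ^ q := by simp [hH]
    simp only [hK, h6] at h5
    have h7 : (H s + ε) ^ (2 / q) ≤ (|x| ^ q + ε) ^ (2 / q) + (q - 1) * s ^ 2 := by
      nlinarith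
    have hpos : 0 < H s + ε := by have := hH0 s; positivity
    calc H s ≤ H s + ε := by linarith
      _ = ((H s + ε) ^ (2 / q)) ^ (q / 2) := by
          rw [← Real.rpow_mul hpos.le]; field_simp; simp
      _ ≤ _ := Real.rpow_le_rpow (by positivity) h7 (by positivity)
  have hlim : Tendsto (fun ε : ℝ => ((|x| ^ q + ε) ^ (2 / q) + (q - 1) * s ^ 2) ^ (q / 2))
      (𝓝[>] 0) (𝓝 (((|x| ^ q + 0) ^ (2 / q) + (q - 1) * s ^ 2) ^ (q / 2))) := by
    have : Continuous fun ε : ℝ => ((|x| ^ q + ε) ^ (2 / q) + (q - 1) * s ^ 2) ^ (q / 2) := by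
      refine Continuous.rpow_const ?_ fun _ => Or.inr (by positivity)
      refine Continuous.add ?_ continuous_const
      exact Continuous.rpow_const (by fun_prop) fun _ => Or.inr (by positivity)
    exact this.continuousAt.tendsto.mono_left nhdsWithin_le_nhds
  have := ge_of_tendsto hlim (by filter_upwards [self_mem_nhdsWithin] with ε hε using key ε hε)
  refine this.trans_eq ?_
  congr 2
  rw [add_zero, ← Real.rpow_mul (abs_nonneg _)]
  have : q * (2 / q) = 2 := by field_simp
  rw [this]; simp

/-- Moments of `x + Y` for a centred Gaussian `Y` of variance `v`. -/
lemma lintegral_gaussian_moment_le (v : ℝ≥0) :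
    ∫⁻ y, ‖x + y‖ₑ ^ q ∂gaussianReal 0 v ≤ ENNReal.ofReal ((x ^ 2 + (q - 1) * v) ^ (q / 2)) := by
  have hv : gaussianReal 0 v = (gaussianReal 0 1).map (fun z => √(v : ℝ) * z) := by
    rw [gaussianReal_map_const_mul]; congr 1
    · simp
    · ext; simp
  rw [hv, lintegral_map (by fun_prop) (by fun_prop)]
  have e : ∀ z : ℝ, ‖x + √(v : ℝ) * z‖ₑ ^ q = ENNReal.ofReal (|x + √(v : ℝ) * z| ^ q) := fun z => by
    rw [← ENNReal.ofReal_rpow_of_nonneg (abs_nonneg _) (by linarith), Real.enorm_eq_ofReal_abs]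
  simp_rw [e]
  rw [← ofReal_integral_eq_lintegral_ofReal
    (integrable_affine_abs_rpow_gaussianReal _ _ _ (by linarith))
    (ae_of_all _ fun z => by positivity)]
  refine ENNReal.ofReal_le_ofReal ((gaussian_moment_le hq x _ (by positivity)).trans_eq ?_)
  simp

end Moments

/-! ### The raw filtration and its augmentation by null sets. -/

lemma measurable_pi_of_forall {α δ : Type*} {X : δ → Type*} {mα : MeasurableSpace α}
    {mX : ∀ d, MeasurableSpace (X d)} {f : α → ∀ d, X d}
    (hf : ∀ d, Measurable[mα] fun a => f a d) : Measurable[mα] f :=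
  measurable_pi_iff.2 hf

/-- The filtration generated by `W`, without the null sets. -/
noncomputable def rawFiltration {Ω : Type*} [mΩ : MeasurableSpace Ω] {m : ℕ}
    (W : Fin m → ℝ≥0 → Ω → ℝ) (hW : ∀ j t, Measurable (W j t)) : Filtration ℝ≥0 mΩ where
  seq t := ⨆ (j : Fin m) (s : ℝ≥0) (_ : s ≤ t), MeasurableSpace.comap (W j s) inferInstance
  mono' _ _ hst := iSup_mono fun _ => iSup_mono fun _ => iSup_mono' fun hu => ⟨hu.trans hst, le_rfl⟩
  le' _ := iSup_le fun j => iSup_le fun s => iSup_le fun _ => (hW j s).comap_le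

section Augmentation
variable {Ω : Type*} [mΩ : MeasurableSpace Ω]

/-- A real function whose level sets are a.e. equal to `m₀`-measurable sets is a.e. equal to an
`m₀`-measurable function. -/
lemma exists_measurable_ae_eq_of_sets {P : Measure Ω} {m₀ m₁ : MeasurableSpace Ω}
    (h : ∀ A, MeasurableSet[m₁] A → ∃ B, MeasurableSet[m₀] B ∧ A =ᵐ[P] B)
    {f : Ω → ℝ} (hf : Measurable[m₁] f) : ∃ g, Measurable[m₀] g ∧ f =ᵐ[P] g := by
  have h' : ∀ q : ℚ, ∃ B, MeasurableSet[m₀] B ∧ f ⁻¹' Set.Iio (q : ℝ) =ᵐ[P] B :=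
    fun q => h _ (hf measurableSet_Iio)
  choose B hB hBe using h'
  classical
  -- A real number is the infimum of the rationals above it, so f is recovered from its level sets.
  -- Values in `EReal` make the infimum legitimate also on the exceptional null set.
  let G : Ω → EReal := fun ω => ⨅ q : ℚ, if ω ∈ B q then ((q : ℝ) : EReal) else ⊤
  have hG : Measurable[m₀] G :=
    Measurable.iInf fun q => Measurable.ite (hB q) measurable_const measurable_const
  refine ⟨fun ω => (G ω).toReal, measurable_ereal_toReal.comp hG, ?_⟩
  have hall : ∀ᵐ ω ∂P, ∀ q : ℚ, (f ω < q ↔ ω ∈ B q) := by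
    rw [ae_all_iff]
    intro q
    filter_upwards [hBe q] with ω hω
    exact iff_of_eq hω
  filter_upwards [hall] with ω hω
  suffices G ω = f ω by simp [this]
  apply le_antisymm
  · refine le_of_forall_gt fun c hc => ?_
    obtain ⟨q, hq1, hq2⟩ := EReal.lt_iff_exists_rat_btwn.1 hc
    refine lt_of_le_of_lt (iInf_le _ q) ?_
    have : ω ∈ B q := (hω q).1 (by exact_mod_cast hq1)
    simpa [this] using hq2
  · refine le_iInf fun q => ?_
    split_ifs with hq
    · exact_mod_cast ((hω q).2 hq).le
    · exact le_top

variable {m : ℕ} {W : Fin m → ℝ≥0 → Ω → ℝ} {P : Measure Ω}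

lemma augmentedFiltration_mono : Monotone (augmentedFiltration W P) := fun _ _ hst =>
  sup_le_sup le_rfl
    (iSup_mono fun _ => iSup_mono fun _ => iSup_mono' fun hu => ⟨hu.trans hst, le_rfl⟩)

/-- Sets almost surely equal to a raw-measurable set form a σ-algebra. It contains the raw one, and
it contains every null set because such a set is almost surely empty. -/
lemma augmentedFiltration_le_eventuallyMeasurableSpace (hW : ∀ j t, Measurable (W j t))
    (t : ℝ≥0) :
    augmentedFiltration W P t ≤ eventuallyMeasurableSpace (rawFiltration W hW t) (ae P) := by
  refine sup_le (MeasurableSpace.generateFrom_le fun E hE => ?_) ?_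
  · refine ⟨∅, @MeasurableSet.empty _ (rawFiltration W hW t), ?_⟩
    exact ae_eq_empty.2 hE
  · exact le_eventuallyMeasurableSpace (m := rawFiltration W hW t) (l := ae P)

lemma exists_rawFiltration_measurable_ae_eq (hW : ∀ j t, Measurable (W j t)) {t : ℝ≥0} {f : Ω → ℝ}
    (hf : Measurable[augmentedFiltration W P t] f) :
    ∃ g, Measurable[rawFiltration W hW t] g ∧ f =ᵐ[P] g :=
  exists_measurable_ae_eq_of_sets
    (fun A hA => augmentedFiltration_le_eventuallyMeasurableSpace hW t A hA) hf

lemma aemeasurable_of_augmentedFiltration (hW : ∀ j t, Measurable (W j t)) {t : ℝ≥0} {f : Ω → ℝ}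
    (hf : Measurable[augmentedFiltration W P t] f) : AEMeasurable f P := by
  obtain ⟨g, hg, hfg⟩ := exists_rawFiltration_measurable_ae_eq hW hf
  exact ⟨g, hg.mono ((rawFiltration W hW).le t) le_rfl, hfg⟩

lemma exists_rawFiltration_measurable_ae_eq_vec (hW : ∀ j t, Measurable (W j t)) {t : ℝ≥0}
    {f : Ω → EuclideanSpace ℝ (Fin m)} (hf : Measurable[augmentedFiltration W P t] f) :
    ∃ g : Ω → EuclideanSpace ℝ (Fin m), Measurable[rawFiltration W hW t] g ∧ f =ᵐ[P] g := by
  have h : ∀ j, ∃ g, Measurable[rawFiltration W hW t] g ∧ (fun ω => f ω j) =ᵐ[P] g := fun j =>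
    exists_rawFiltration_measurable_ae_eq hW
      (((by fun_prop : Measurable fun x : EuclideanSpace ℝ (Fin m) => x j)).comp hf)
  choose g hg hfg using h
  refine ⟨fun ω => WithLp.toLp 2 fun j => g j ω, ?_, ?_⟩
  · exact (WithLp.measurable_toLp 2 (Fin m → ℝ)).comp (measurable_pi_of_forall hg)
  · filter_upwards [ae_all_iff.2 hfg] with ω hω
    ext j
    simpa using hω j

end Augmentation

/-! ### Independence and Gaussian law of the vector increments. -/

section Independence
variable {Ω : Type*} [mΩ : MeasurableSpace Ω]

/-- Independence of a family of pairs, the members of each of which are independent. -/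
lemma iIndep_prod_bool {ι : Type*} [Fintype ι] {P : Measure Ω} [IsProbabilityMeasure P]
    {M : ι → MeasurableSpace Ω} {A B : ι → MeasurableSpace Ω}
    (hA : ∀ i, A i ≤ M i) (hB : ∀ i, B i ≤ M i) (hM : iIndep M P) (hAB : ∀ i, Indep (A i) (B i) P) :
    iIndep (fun p : ι × Bool => if p.2 then B p.1 else A p.1) P := by
  classical
  rw [iIndep_iff]
  intro S f hf
  -- Padding with the whole space lets the intersection and the product run over all pairs.
  set f' : ι × Bool → Set Ω := fun p => if p ∈ S then f p else Set.univ with hf'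
  have hA' : ∀ i, MeasurableSet[A i] (f' (i, false)) := fun i => by
    simp only [hf']; split_ifs with h
    · simpa using hf _ h
    · exact MeasurableSet.univ
  have hB' : ∀ i, MeasurableSet[B i] (f' (i, true)) := fun i => by
    simp only [hf']; split_ifs with h
    · simpa using hf _ h
    · exact MeasurableSet.univ
  have e1 : ⋂ p ∈ S, f p = ⋂ i ∈ Finset.univ, (f' (i, false) ∩ f' (i, true)) := by
    ext ω
    simp only [Set.mem_iInter, Finset.mem_univ, forall_const, Set.mem_inter_iff, hf']
    constructor
    · intro h i
      constructor <;> split_ifs with hi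
      exacts [h _ hi, trivial, h _ hi, trivial]
    · rintro h ⟨i, b⟩ hi
      have := h i
      cases b <;> simp_all
  have e2 : ∏ p ∈ S, P (f p) = ∏ p, P (f' p) := by
    rw [← Finset.prod_subset (Finset.subset_univ S)]
    · exact Finset.prod_congr rfl fun p hp => by simp [hf', hp]
    · intro p _ hp; simp [hf', hp]
  rw [e1, e2, hM.meas_biInter (fun i _ => ((hA i _ (hA' i)).inter (hB i _ (hB' i)))),
    Fintype.prod_prod_type]
  refine Finset.prod_congr rfl fun i _ => ?_
  rw [(Indep_iff _ _ _).1 (hAB i) _ _ (hA' i) (hB' i)]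
  simp [mul_comm]

variable {m : ℕ} {W : Fin m → ℝ≥0 → Ω → ℝ} {P : Measure Ω} [IsProbabilityMeasure P]

/-- Within one coordinate, the past up to s is independent of the increment. Since the coordinates
are also independent of each other, the 2m σ-algebras (past and increment of each coordinate) are
jointly independent, and they are regrouped into all pasts against all increments. -/
lemma IsBrownianMotion.indep_increment (hW : IsBrownianMotion W P) {s u : ℝ≥0} (hsu : s ≤ u) :
    Indep (rawFiltration W hW.measurable s)
      (MeasurableSpace.comap (fun ω (j : Fin m) => W j u ω - W j s ω) inferInstance) P := by
  set A : Fin m → MeasurableSpace Ω := fun j =>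
    MeasurableSpace.comap (fun ω (t : Set.Iic s) => W j t ω) inferInstance with hA
  set B : Fin m → MeasurableSpace Ω := fun j =>
    MeasurableSpace.comap (fun ω => W j u ω - W j s ω) inferInstance with hB
  set M : Fin m → MeasurableSpace Ω := fun j =>
    MeasurableSpace.comap (fun ω (t : ℝ≥0) => W j t ω) inferInstance with hM
  have hAM : ∀ j, A j ≤ M j := fun j => by
    rw [← measurable_iff_comap_le]
    refine measurable_pi_of_forall fun t => ?_
    have h : Measurable fun w : ℝ≥0 → ℝ => w t := measurable_pi_apply _
    exact h.comp (comap_measurable (fun ω (t : ℝ≥0) => W j t ω))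
  have hBM : ∀ j, B j ≤ M j := fun j => by
    rw [← measurable_iff_comap_le]
    have h : Measurable fun w : ℝ≥0 → ℝ => w u - w s := by fun_prop
    exact h.comp
      (comap_measurable (fun ω (t : ℝ≥0) => W j t ω))
  have hAB : ∀ j, Indep (A j) (B j) P := fun j => by
    have h := (hW.isBrownianReal j).toIsPreBrownianReal.indepFun_shift s
    have h2 := (h.comp (measurable_pi_apply (u - s)) measurable_id).symm
    rw [IndepFun_iff_Indep] at h2
    convert! h2 using 2
    ext ω
    simp [add_tsub_cancel_of_le hsu]
  have hMi : iIndep M P := hW.iIndepFun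
  have hind := iIndep_prod_bool hAM hBM hMi hAB
  have hle : ∀ p : Fin m × Bool, (if p.2 then B p.1 else A p.1) ≤ mΩ := by
    have hMle : ∀ j, M j ≤ mΩ := fun j => by
      rw [← measurable_iff_comap_le]
      exact measurable_pi_of_forall fun t => hW.measurable j t
    rintro ⟨j, b⟩
    cases b
    · simpa using (hAM j).trans (hMle j)
    · simpa using (hBM j).trans (hMle j)
  have hdis : Disjoint {p : Fin m × Bool | p.2 = false} {p | p.2 = true} := by
    rw [Set.disjoint_left]; rintro ⟨j, b⟩ h1 h2; simp_all
  have h := indep_iSup_of_disjoint hle hind hdis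
  refine indep_of_indep_of_le_left (indep_of_indep_of_le_right h ?_) ?_
  · rw [← measurable_iff_comap_le]
    refine measurable_pi_of_forall fun j => ?_
    refine (comap_measurable (fun ω => W j u ω - W j s ω)).mono ?_ le_rfl
    exact le_iSup₂_of_le (j, true) rfl le_rfl
  · refine iSup_le fun j => iSup_le fun t => iSup_le fun ht => ?_
    rw [← measurable_iff_comap_le]
    have h1 : Measurable[A j] (W j t) :=
      (measurable_pi_apply (⟨t, ht⟩ : Set.Iic s)).comp
        (comap_measurable (fun ω (t : Set.Iic s) => W j t ω))
    exact h1.mono (le_iSup₂_of_le (j, false) rfl le_rfl) le_rfl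

/-- Linear combinations of independent centred Gaussians. -/
lemma hasLaw_sum_mul_gaussian {ι : Type*} [Fintype ι] {Z : ι → Ω → ℝ} {v : ℝ≥0}
    (hZm : ∀ i, Measurable (Z i)) (hZ : iIndepFun Z P)
    (hlaw : ∀ i, P.map (Z i) = gaussianReal 0 v) (e : ι → ℝ) :
    P.map (fun ω => ∑ i, e i * Z i ω) = gaussianReal 0 ((∑ i, ‖e i‖₊ ^ 2) * v) := by
  classical
  have hind : iIndepFun (fun i ω => e i * Z i ω) P :=
    hZ.comp (fun i x => e i * x) fun i => by fun_prop
  suffices h : ∀ S : Finset ι,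
      P.map (∑ i ∈ S, fun ω => e i * Z i ω) = gaussianReal 0 ((∑ i ∈ S, ‖e i‖₊ ^ 2) * v) by
    have := h Finset.univ
    convert! this using 2
    ext ω; simp
  intro S
  induction S using Finset.induction_on with
  | empty =>
    simp only [Finset.sum_empty, zero_mul, gaussianReal_zero_var]
    have : (0 : Ω → ℝ) = fun _ => 0 := rfl
    rw [this, Measure.map_const]; simp
  | insert a S ha ih =>
    rw [Finset.sum_insert ha, Finset.sum_insert ha, add_mul]
    have h1 : P.map (fun ω => e a * Z a ω) = gaussianReal 0 (‖e a‖₊ ^ 2 * v) := by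
      have : (fun ω => e a * Z a ω) = (fun x => e a * x) ∘ Z a := rfl
      rw [this, ← Measure.map_map (by fun_prop) (hZm a), hlaw, gaussianReal_map_const_mul]
      congr 1
      · simp
      · ext; simp
    have h2 := (hind.indepFun_finsetSum_of_notMem (fun i => by fun_prop) ha).symm
    simpa using gaussianReal_add_gaussianReal_of_indepFun h2 h1 ih

lemma IsBrownianMotion.map_sum_mul_increment (hW : IsBrownianMotion W P) {s u : ℝ≥0} (hsu : s ≤ u)
    (e : Fin m → ℝ) :
    P.map (fun ω => ∑ j, e j * (W j u ω - W j s ω)) =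
      gaussianReal 0 ((∑ j, ‖e j‖₊ ^ 2) * (u - s)) := by
  refine hasLaw_sum_mul_gaussian (Z := fun j ω => W j u ω - W j s ω)
    (fun j => (hW.measurable j u).sub (hW.measurable j s)) ?_ (fun j => ?_) e
  · exact hW.iIndepFun.comp (fun _ w => w u - w s) fun _ => by fun_prop
  · have := ((hW.isBrownianReal j).toIsPreBrownianReal.hasLaw_sub u s).map_eq
    convert! this using 2
    ext
    simp only [NNReal.coe_sub hsu, coe_nndist, Real.dist_eq]
    have : (s : ℝ) ≤ u := by exact_mod_cast hsu
    rw [abs_of_nonneg]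
    · rfl
    · exact sub_nonneg.2 this

end Independence

/-! ### Doob's maximal inequality in L^q. -/

section Doob
variable {Ω : Type*} [mΩ : MeasurableSpace Ω] {P : Measure Ω}

/-- If `t P(S ≥ t) ≤ E[g; S ≥ t]` for all `t > 0`, then the `q`-th moment of `S` is controlled
by that of `g`. -/
lemma lintegral_rpow_le_of_weak_bound [IsFiniteMeasure P] {S g : Ω → ℝ} (hSm : Measurable S)
    (hgm : Measurable g) (hS0 : 0 ≤ S) {q : ℝ} (hq : 1 < q)
    (hweak : ∀ t : ℝ, 0 < t → ENNReal.ofReal t * P {ω | t ≤ S ω} ≤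
      ∫⁻ ω in {ω | t ≤ S ω}, ENNReal.ofReal (g ω) ∂P)
    (hfin : ∫⁻ ω, ENNReal.ofReal (S ω) ^ q ∂P ≠ ∞) :
    ∫⁻ ω, ENNReal.ofReal (S ω) ^ q ∂P ≤
      ENNReal.ofReal ((q / (q - 1)) ^ q) * ∫⁻ ω, ENNReal.ofReal (g ω) ^ q ∂P := by
  have hq0 : 0 < q := by linarith
  have hq1 : 0 < q - 1 := by linarith
  have e1 : ∀ r : ℝ, 0 < r → ∀ ω, ENNReal.ofReal (S ω ^ r) = ENNReal.ofReal (S ω) ^ r := fun r hr ω =>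
    (ENNReal.ofReal_rpow_of_nonneg (hS0 ω) hr.le).symm
  set Q := P.withDensity fun ω => ENNReal.ofReal (g ω) with hQ
  have hgm' : Measurable fun ω => ENNReal.ofReal (g ω) := hgm.ennreal_ofReal
  -- Layer-cake formula on both sides: the right-hand side of the weak bound is the mass of {S ≥ t}
  -- under the measure with density g, so it integrates to a (q-1)-th moment under that measure.
  have h1 : ∫⁻ ω, ENNReal.ofReal (S ω) ^ q ∂P ≤
      ENNReal.ofReal (q / (q - 1)) * ∫⁻ ω, ENNReal.ofReal (S ω) ^ (q - 1) ∂Q := by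
    simp_rw [← e1 q hq0, ← e1 (q - 1) hq1]
    rw [lintegral_rpow_eq_lintegral_meas_le_mul P (ae_of_all _ hS0) hSm.aemeasurable hq0,
      lintegral_rpow_eq_lintegral_meas_le_mul Q (ae_of_all _ hS0) hSm.aemeasurable hq1,
      ← mul_assoc, ← ENNReal.ofReal_mul (by positivity), div_mul_cancel₀ _ hq1.ne']
    refine mul_le_mul' le_rfl ?_
    refine setLIntegral_mono' (measurableSet_Ioi (a := (0 : ℝ))) fun t ht => ?_
    have ht : 0 < t := ht
    have e : ENNReal.ofReal (t ^ (q - 1)) = ENNReal.ofReal t * ENNReal.ofReal (t ^ (q - 1 - 1)) := by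
      rw [← ENNReal.ofReal_mul ht.le]
      congr 1
      rw [mul_comm, ← Real.rpow_add_one ht.ne']; ring_nf
    rw [e, ← mul_assoc, mul_comm (P _)]
    gcongr
    rw [hQ, withDensity_apply _ (measurableSet_le measurable_const hSm)]
    exact hweak t ht
  have h2 : ∫⁻ ω, ENNReal.ofReal (S ω) ^ (q - 1) ∂Q ≤
      (∫⁻ ω, ENNReal.ofReal (g ω) ^ q ∂P) ^ (1 / q) *
      (∫⁻ ω, ENNReal.ofReal (S ω) ^ q ∂P) ^ (1 / (q / (q - 1))) := by
    rw [hQ, lintegral_withDensity_eq_lintegral_mul _ hgm' (by fun_prop)]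
    refine (ENNReal.lintegral_mul_le_Lp_mul_Lq P (Real.HolderConjugate.conjExponent hq)
      hgm'.aemeasurable (by fun_prop)).trans_eq ?_
    simp only [Real.conjExponent, ← ENNReal.rpow_mul]
    have : (q - 1) * (q / (q - 1)) = q := by field_simp
    rw [this]
  set A := ∫⁻ ω, ENNReal.ofReal (S ω) ^ q ∂P with hA
  set G := ∫⁻ ω, ENNReal.ofReal (g ω) ^ q ∂P with hG
  rcases eq_or_ne A 0 with hA0 | hA0
  · rw [hA0]; exact zero_le
  -- The exponents add to 1, so one power of A can be cancelled. This needs 0 < A < ∞, which is the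
  -- reason for `hfin`.
  have h3 : A ^ (1 / q) * A ^ (1 / (q / (q - 1))) ≤
      (ENNReal.ofReal (q / (q - 1)) * G ^ (1 / q)) * A ^ (1 / (q / (q - 1))) := by
    rw [← ENNReal.rpow_add _ _ hA0 hfin]
    have : 1 / q + 1 / (q / (q - 1)) = 1 := by field_simp; ring
    rw [this, ENNReal.rpow_one, mul_assoc]
    exact h1.trans (by gcongr)
  have hθ : 0 ≤ 1 / (q / (q - 1)) := by positivity
  have h4 : A ^ (1 / q) ≤ ENNReal.ofReal (q / (q - 1)) * G ^ (1 / q) :=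
    (ENNReal.mul_le_mul_iff_left
      (by simp [hA0, hfin]) (by simp [hA0, hfin])).1 h3
  have h5 := ENNReal.rpow_le_rpow h4 hq0.le
  rw [ENNReal.mul_rpow_of_nonneg _ _ hq0.le, ← ENNReal.rpow_mul, ← ENNReal.rpow_mul,
    one_div_mul_cancel hq0.ne', ENNReal.rpow_one, ENNReal.rpow_one,
    ENNReal.ofReal_rpow_of_nonneg (by positivity) hq0.le] at h5
  exact h5

/-- **Doob's `Lᵖ` inequality** in discrete time. -/
lemma doob_Lp [IsFiniteMeasure P] {𝒢 : Filtration ℕ mΩ} {f : ℕ → Ω → ℝ} (hf : Submartingale f 𝒢 P)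
    (hf0 : 0 ≤ f) {q : ℝ} (hq : 1 < q) (n : ℕ)
    (hfin : ∀ k ≤ n, ∫⁻ ω, ENNReal.ofReal (f k ω) ^ q ∂P ≠ ∞) :
    ∫⁻ ω, (⨆ k ∈ Finset.range (n + 1), ENNReal.ofReal (f k ω) ^ q) ∂P ≤
      ENNReal.ofReal ((q / (q - 1)) ^ q) * ∫⁻ ω, ENNReal.ofReal (f n ω) ^ q ∂P := by
  have hq0 : 0 < q := by linarith
  have hfm : ∀ k, Measurable (f k) := fun k => (hf.stronglyMeasurable k).measurable.le (𝒢.le k)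
  set S : Ω → ℝ := fun ω =>
    (Finset.range (n + 1)).sup' Finset.nonempty_range_add_one fun k => f k ω with hS
  have hSm : Measurable S := Finset.measurable_range_sup'' fun k _ => hfm k
  have hS0 : 0 ≤ S := fun ω => (hf0 0 ω).trans
    (Finset.le_sup' (fun k => f k ω) (Finset.mem_range.2 (Nat.succ_pos n)))
  have hle : ∀ ω, (⨆ k ∈ Finset.range (n + 1), ENNReal.ofReal (f k ω) ^ q) ≤
      ENNReal.ofReal (S ω) ^ q := fun ω => iSup₂_le fun k hk => by
    gcongr; exact Finset.le_sup' (fun k => f k ω) hk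
  refine (lintegral_mono hle).trans (lintegral_rpow_le_of_weak_bound hSm (hfm n) hS0 hq ?_ ?_)
  · intro t ht
    have := maximal_ineq hf hf0 (ε := t.toNNReal) n
    rw [Real.coe_toNNReal t ht.le] at this
    refine this.trans_eq ?_
    rw [ofReal_integral_eq_lintegral_ofReal (hf.integrable n).integrableOn
      (ae_of_all _ (hf0 n))]
  · have hSle : ∀ ω, ENNReal.ofReal (S ω) ^ q ≤
        ∑ k ∈ Finset.range (n + 1), ENNReal.ofReal (f k ω) ^ q := fun ω => by
      obtain ⟨k, hk, e⟩ := Finset.exists_mem_eq_sup' (s := Finset.range (n + 1))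
        Finset.nonempty_range_add_one (fun k => f k ω)
      simp only [hS, e]
      exact Finset.single_le_sum (f := fun k => ENNReal.ofReal (f k ω) ^ q)
        (fun _ _ => zero_le) hk
    refine ne_top_of_le_ne_top ?_ (lintegral_mono hSle)
    rw [lintegral_finsetSum _ fun k _ => by have := hfm k; fun_prop]
    refine (ENNReal.sum_lt_top.2 fun k hk => (hfin k ?_).lt_top).ne
    exact Nat.lt_succ_iff.1 (Finset.mem_range.1 hk)

end Doob

/-! ### One time step with the past frozen. -/

section OneStep
variable {Ω : Type*} [mΩ : MeasurableSpace Ω] {P : Measure Ω} [IsProbabilityMeasure P]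
  {m : ℕ} {W : Fin m → ℝ≥0 → Ω → ℝ}

lemma gaussian_increment_moment_le (hW : IsBrownianMotion W P) {s u : ℝ≥0} (hsu : s ≤ u) {q : ℝ}
    (hq : 2 ≤ q) (x : ℝ) (e : EuclideanSpace ℝ (Fin m)) :
    ∫⁻ ω, ‖x + ∑ j, e j * (W j u ω - W j s ω)‖ₑ ^ q ∂P ≤
      (‖x‖ₑ ^ (2 : ℝ) + ENNReal.ofReal (q - 1) * ((u - s : ℝ≥0) : ℝ≥0∞) * ‖e‖ₑ ^ (2 : ℝ)) ^ (q / 2) := by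
  have hm := hW.measurable
  have h1 : ∫⁻ ω, ‖x + ∑ j, e j * (W j u ω - W j s ω)‖ₑ ^ q ∂P =
      ∫⁻ y, ‖x + y‖ₑ ^ q ∂gaussianReal 0 ((∑ j, ‖e j‖₊ ^ 2) * (u - s)) := by
    rw [← hW.map_sum_mul_increment hsu, lintegral_map (by fun_prop) (by fun_prop)]
  rw [h1]
  refine (lintegral_gaussian_moment_le hq x _).trans_eq ?_
  have hq1 : 0 ≤ q - 1 := by linarith
  have e1 : (∑ j, ‖e j‖₊ ^ 2) = ‖e‖₊ ^ 2 := by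
    ext
    push_cast
    simp [EuclideanSpace.real_norm_sq_eq]
  have e2 : ‖x‖ₑ ^ (2 : ℝ) = ENNReal.ofReal (x ^ 2) := by
    rw [Real.enorm_eq_ofReal_abs, ENNReal.ofReal_rpow_of_nonneg (abs_nonneg _) (by norm_num)]
    simp
  have e3 : ‖e‖ₑ ^ (2 : ℝ) = ENNReal.ofReal (‖e‖ ^ 2) := by
    rw [← ofReal_norm, ENNReal.ofReal_rpow_of_nonneg (norm_nonneg _) (by norm_num)]
    simp
  rw [e1, e2, e3, ← ENNReal.ofReal_coe_nnreal, ← ENNReal.ofReal_mul hq1,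
    ← ENNReal.ofReal_mul (by positivity), ← ENNReal.ofReal_add (by positivity) (by positivity),
    ENNReal.ofReal_rpow_of_nonneg (by positivity) (by positivity)]
  congr 2
  push_cast
  ring

/-- The pair (Y, e) is independent of the increment, so their joint law is a product. Integrating
the increment first, with (Y, e) constant, leaves a Gaussian moment. Everything is nonnegative, so
no integrability is needed. -/
lemma lintegral_add_increment_le (hW : IsBrownianMotion W P) {s u : ℝ≥0} (hsu : s ≤ u) {q : ℝ}
    (hq : 2 ≤ q) {Y : Ω → ℝ} {e : Ω → EuclideanSpace ℝ (Fin m)}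
    (hY : Measurable[rawFiltration W hW.measurable s] Y)
    (he : Measurable[rawFiltration W hW.measurable s] e) :
    ∫⁻ ω, ‖Y ω + ∑ j, e ω j * (W j u ω - W j s ω)‖ₑ ^ q ∂P ≤
      ∫⁻ ω, (‖Y ω‖ₑ ^ (2 : ℝ) +
        ENNReal.ofReal (q - 1) * ((u - s : ℝ≥0) : ℝ≥0∞) * ‖e ω‖ₑ ^ (2 : ℝ)) ^ (q / 2) ∂P := by
  have hm := hW.measurable
  set D : Ω → Fin m → ℝ := fun ω j => W j u ω - W j s ω with hD
  have hDm : Measurable D := by fun_prop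
  have hV : Measurable[rawFiltration W hW.measurable s] fun ω => (Y ω, e ω) := hY.prodMk he
  have hVm : Measurable fun ω => (Y ω, e ω) := hV.mono ((rawFiltration W hm).le s) le_rfl
  have hind : IndepFun (fun ω => (Y ω, e ω)) D P := by
    rw [IndepFun_iff_Indep]
    exact indep_of_indep_of_le_left (hW.indep_increment hsu) hV.comap_le
  have hlaw := (indepFun_iff_map_prod_eq_prod_map_map hVm.aemeasurable hDm.aemeasurable).1 hind
  set F : (ℝ × EuclideanSpace ℝ (Fin m)) × (Fin m → ℝ) → ℝ≥0∞ :=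
    fun v => ‖v.1.1 + ∑ j, v.1.2 j * v.2 j‖ₑ ^ q with hF
  have hFm : Measurable F := by fun_prop
  have : IsProbabilityMeasure (P.map D) := Measure.isProbabilityMeasure_map hDm.aemeasurable
  calc ∫⁻ ω, ‖Y ω + ∑ j, e ω j * (W j u ω - W j s ω)‖ₑ ^ q ∂P
      = ∫⁻ v, F v ∂(P.map fun ω => ((Y ω, e ω), D ω)) := by
        rw [lintegral_map hFm (hVm.prodMk hDm)]
    _ = ∫⁻ a, ∫⁻ d, F (a, d) ∂P.map D ∂P.map fun ω => (Y ω, e ω) := by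
        rw [hlaw, lintegral_prod _ hFm.aemeasurable]
    _ ≤ ∫⁻ a, (‖a.1‖ₑ ^ (2 : ℝ) + ENNReal.ofReal (q - 1) * ((u - s : ℝ≥0) : ℝ≥0∞) *
          ‖a.2‖ₑ ^ (2 : ℝ)) ^ (q / 2) ∂P.map fun ω => (Y ω, e ω) := by
        refine lintegral_mono fun a => ?_
        rw [lintegral_map (by fun_prop) hDm]
        exact gaussian_increment_moment_le hW hsu hq a.1 a.2
    _ = _ := by rw [lintegral_map (by fun_prop) hVm]

end OneStep

/-! ### Discrete stochastic integrals: moments, maximal inequality, control in probability. -/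

section Discrete
variable {Ω : Type*} [mΩ : MeasurableSpace Ω] {P : Measure Ω} [IsProbabilityMeasure P]
  {m : ℕ} {W : Fin m → ℝ≥0 → Ω → ℝ}

/-- The discrete stochastic integral `∑_{k<n} ξ_k · (W_{τ_{k+1}} - W_{τ_k})`. -/
noncomputable def discreteIntegral (W : Fin m → ℝ≥0 → Ω → ℝ) (τ : ℕ → ℝ≥0)
    (ξ : ℕ → Ω → EuclideanSpace ℝ (Fin m)) (n : ℕ) (ω : Ω) : ℝ :=
  ∑ k ∈ Finset.range n, ∑ j, ξ k ω j * (W j (τ (k + 1)) ω - W j (τ k) ω)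

/-- The length of a time step as an extended nonnegative real. -/
noncomputable def stepLength (τ : ℕ → ℝ≥0) (k : ℕ) : ℝ≥0∞ := ((τ (k + 1) - τ k : ℝ≥0) : ℝ≥0∞)

lemma sum_stepLength {τ : ℕ → ℝ≥0} (hτ : Monotone τ) (n : ℕ) :
    ∑ k ∈ Finset.range n, stepLength τ k = ((τ n - τ 0 : ℝ≥0) : ℝ≥0∞) := by
  simp only [stepLength]
  rw [← Finset.sum_range_tsub hτ]
  push_cast
  rfl

lemma measurable_rawFiltration (hW : ∀ j t, Measurable (W j t)) {j : Fin m} {s t : ℝ≥0}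
    (hst : s ≤ t) : Measurable[rawFiltration W hW t] (W j s) :=
  (comap_measurable (W j s)).mono
    (le_iSup_of_le j (le_iSup_of_le s (le_iSup_of_le hst le_rfl))) le_rfl

lemma measurable_discreteIntegral (hW : ∀ j t, Measurable (W j t)) {τ : ℕ → ℝ≥0} (hτ : Monotone τ)
    {ξ : ℕ → Ω → EuclideanSpace ℝ (Fin m)}
    (hξ : ∀ k, Measurable[rawFiltration W hW (τ k)] (ξ k)) (n : ℕ) :
    Measurable[rawFiltration W hW (τ n)] (discreteIntegral W τ ξ n) := by
  refine Finset.measurable_fun_sum _ fun k hk => Finset.measurable_fun_sum _ fun j _ => ?_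
  have hk : k < n := Finset.mem_range.1 hk
  refine Measurable.mul ?_ (Measurable.sub ?_ ?_)
  · exact (by fun_prop : Measurable fun x : EuclideanSpace ℝ (Fin m) => x j).comp
      ((hξ k).mono ((rawFiltration W hW).mono (hτ hk.le)) le_rfl)
  · exact measurable_rawFiltration hW (hτ hk)
  · exact measurable_rawFiltration hW (hτ hk.le)

omit mΩ in
lemma discreteIntegral_succ (τ : ℕ → ℝ≥0) (ξ : ℕ → Ω → EuclideanSpace ℝ (Fin m)) (n : ℕ) (ω : Ω) :
    discreteIntegral W τ ξ (n + 1) ω = discreteIntegral W τ ξ n ω +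
      ∑ j, ξ n ω j * (W j (τ (n + 1)) ω - W j (τ n) ω) :=
  Finset.sum_range_succ _ _

omit mΩ in
lemma discreteIntegral_congr {τ : ℕ → ℝ≥0} {ξ ξ' : ℕ → Ω → EuclideanSpace ℝ (Fin m)} {n : ℕ} {ω : Ω}
    (h : ∀ k < n, ξ k ω = ξ' k ω) : discreteIntegral W τ ξ n ω = discreteIntegral W τ ξ' n ω :=
  Finset.sum_congr rfl fun k hk => by rw [h k (Finset.mem_range.1 hk)]

/-- Jensen's inequality for the weights Δ_k/T, which sum to 1. The case T = 0 is separate because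
these weights then make no sense. -/
lemma sum_stepLength_mul_rpow_le {τ : ℕ → ℝ≥0} (hτ : Monotone τ) (n : ℕ) (b : ℕ → ℝ≥0∞) {p : ℝ}
    (hp : 1 ≤ p) :
    (∑ k ∈ Finset.range n, stepLength τ k * b k) ^ p ≤
      ((τ n - τ 0 : ℝ≥0) : ℝ≥0∞) ^ (p - 1) * ∑ k ∈ Finset.range n, stepLength τ k * b k ^ p := by
  have hp0 : 0 < p := by linarith
  have hs := sum_stepLength hτ n
  set T : ℝ≥0∞ := ((τ n - τ 0 : ℝ≥0) : ℝ≥0∞) with hT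
  have hTt : T ≠ ∞ := ENNReal.coe_ne_top
  rcases eq_or_ne T 0 with h0 | h0
  · have hz : ∀ k ∈ Finset.range n, stepLength τ k = 0 := by
      rw [h0] at hs
      exact Finset.sum_eq_zero_iff.1 hs
    have : ∑ k ∈ Finset.range n, stepLength τ k * b k = 0 :=
      Finset.sum_eq_zero fun k hk => by rw [hz k hk, zero_mul]
    rw [this, ENNReal.zero_rpow_of_pos hp0]
    exact zero_le
  · have h := ENNReal.rpow_arith_mean_le_arith_mean_rpow (Finset.range n)
      (fun k => T⁻¹ * stepLength τ k) b
      (by rw [← Finset.mul_sum, hs, ENNReal.inv_mul_cancel h0 hTt]) hp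
    simp only [mul_assoc, ← Finset.mul_sum] at h
    have h2 := mul_le_mul_right h (T ^ p)
    rw [← ENNReal.mul_rpow_of_nonneg _ _ hp0.le, ← mul_assoc, ← mul_assoc,
      ENNReal.mul_inv_cancel h0 hTt, one_mul] at h2
    refine h2.trans_eq ?_
    congr 1
    rw [ENNReal.rpow_sub _ _ h0 hTt, ENNReal.rpow_one, div_eq_mul_inv]

/-- Moment bound for discrete stochastic integrals. -/
lemma lintegral_discreteIntegral_rpow_le (hW : IsBrownianMotion W P) {τ : ℕ → ℝ≥0}
    (hτ : Monotone τ) {ξ : ℕ → Ω → EuclideanSpace ℝ (Fin m)}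
    (hξ : ∀ k, Measurable[rawFiltration W hW.measurable (τ k)] (ξ k)) {q : ℝ} (hq : 2 ≤ q) (n : ℕ) :
    ∫⁻ ω, ‖discreteIntegral W τ ξ n ω‖ₑ ^ q ∂P ≤
      ENNReal.ofReal (q - 1) ^ (q / 2) * ((τ n - τ 0 : ℝ≥0) : ℝ≥0∞) ^ (q / 2 - 1) *
        ∑ k ∈ Finset.range n, stepLength τ k * ∫⁻ ω, ‖ξ k ω‖ₑ ^ q ∂P := by
  have hp : 1 ≤ q / 2 := by linarith
  have hp0 : 0 < q / 2 := by linarith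
  have hMr := measurable_discreteIntegral hW.measurable hτ hξ
  have hM : ∀ n, Measurable (discreteIntegral W τ ξ n) := fun n =>
    (hMr n).mono ((rawFiltration W hW.measurable).le _) le_rfl
  have hξm : ∀ k, Measurable (ξ k) := fun k =>
    (hξ k).mono ((rawFiltration W hW.measurable).le _) le_rfl
  have e : ∀ x : ℝ≥0∞, (x ^ (2 : ℝ)) ^ (q / 2) = x ^ q := fun x => by
    rw [← ENNReal.rpow_mul]; congr 1; ring
  -- The squared L^q norm is the quantity that grows additively: the one-step bound has the form
  -- E(f+g)^{q/2}, and Minkowski's inequality in L^{q/2} separates f from g.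
  have key : ∀ n, (∫⁻ ω, ‖discreteIntegral W τ ξ n ω‖ₑ ^ q ∂P) ^ (1 / (q / 2)) ≤
      ∑ k ∈ Finset.range n, stepLength τ k *
        (ENNReal.ofReal (q - 1) * (∫⁻ ω, ‖ξ k ω‖ₑ ^ q ∂P) ^ (1 / (q / 2))) := by
    intro n
    induction n with
    | zero =>
      have hq0 : 0 < q := by linarith
      simp [discreteIntegral, hq0]
    | succ n ih =>
      rw [Finset.sum_range_succ]
      simp only [discreteIntegral_succ]
      have h1 := lintegral_add_increment_le hW (hτ n.le_succ) hq (hMr n) (hξ n)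
      have h2 := ENNReal.lintegral_Lp_add_le (μ := P) (p := q / 2)
        (f := fun ω => ‖discreteIntegral W τ ξ n ω‖ₑ ^ (2 : ℝ))
        (g := fun ω => ENNReal.ofReal (q - 1) * stepLength τ n * ‖ξ n ω‖ₑ ^ (2 : ℝ))
        (by have := hM n; fun_prop) (by have := hξm n; fun_prop) hp
      refine (ENNReal.rpow_le_rpow h1 (by positivity)).trans (h2.trans ?_)
      simp only [ENNReal.mul_rpow_of_nonneg _ _ hp0.le, e]
      gcongr
      rw [lintegral_const_mul _ (by have := hξm n; fun_prop),
        ENNReal.mul_rpow_of_nonneg _ _ (by positivity),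
        ENNReal.mul_rpow_of_nonneg _ _ (by positivity), ← ENNReal.rpow_mul, ← ENNReal.rpow_mul,
        mul_one_div_cancel hp0.ne', ENNReal.rpow_one, ENNReal.rpow_one]
      apply le_of_eq; ring
  have h := ENNReal.rpow_le_rpow (key n) hp0.le
  rw [← ENNReal.rpow_mul, one_div_mul_cancel hp0.ne', ENNReal.rpow_one] at h
  refine h.trans ((sum_stepLength_mul_rpow_le hτ n _ hp).trans_eq ?_)
  simp only [ENNReal.mul_rpow_of_nonneg _ _ hp0.le, ← ENNReal.rpow_mul,
    one_div_mul_cancel hp0.ne', ENNReal.rpow_one]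
  rw [Finset.mul_sum, Finset.mul_sum]
  refine Finset.sum_congr rfl fun k _ => ?_
  ring

/-- The raw filtration sampled along a sequence of times. -/
noncomputable def sampledFiltration (hW : ∀ j t, Measurable (W j t)) {τ : ℕ → ℝ≥0} (hτ : Monotone τ) :
    Filtration ℕ mΩ where
  seq k := rawFiltration W hW (τ k)
  mono' _ _ h := (rawFiltration W hW).mono (hτ h)
  le' _ := (rawFiltration W hW).le _

omit [IsProbabilityMeasure P] in
lemma IsBrownianMotion.integrable_increment (hW : IsBrownianMotion W P) (j : Fin m) (s t : ℝ≥0) :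
    Integrable (fun ω => W j t ω - W j s ω) P ∧ ∫ ω, (W j t ω - W j s ω) ∂P = 0 := by
  have h := (hW.isBrownianReal j).toIsPreBrownianReal
  refine ⟨(h.integrable_eval t).sub (h.integrable_eval s), ?_⟩
  rw [integral_sub (h.integrable_eval t) (h.integrable_eval s), h.integral_eval, h.integral_eval,
    sub_zero]

/-- Each product of a coefficient and an increment has independent factors. First moments of the
coefficients therefore suffice for integrability, and the centred increment gives mean zero on every
event of the past. -/
lemma martingale_discreteIntegral (hW : IsBrownianMotion W P) {τ : ℕ → ℝ≥0}
    (hτ : Monotone τ) {ξ : ℕ → Ω → EuclideanSpace ℝ (Fin m)}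
    (hξ : ∀ k, Measurable[rawFiltration W hW.measurable (τ k)] (ξ k))
    (hint : ∀ k, Integrable (ξ k) P) :
    Martingale (discreteIntegral W τ ξ) (sampledFiltration hW.measurable hτ) P := by
  have hle := fun t => (rawFiltration W hW.measurable).le t
  have hind : ∀ k j (f : Ω → ℝ), Measurable[rawFiltration W hW.measurable (τ k)] f →
      IndepFun f (fun ω => W j (τ (k + 1)) ω - W j (τ k) ω) P := by
    intro k j f hf
    have h : IndepFun f (fun ω (j : Fin m) => W j (τ (k + 1)) ω - W j (τ k) ω) P := by
      rw [IndepFun_iff_Indep]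
      exact indep_of_indep_of_le_left (hW.indep_increment (hτ k.le_succ)) hf.comap_le
    exact h.comp measurable_id (measurable_pi_apply j)
  have hξj : ∀ k j, Measurable[rawFiltration W hW.measurable (τ k)] fun ω => ξ k ω j := fun k j =>
    (by fun_prop : Measurable fun x : EuclideanSpace ℝ (Fin m) => x j).comp (hξ k)
  have hξi : ∀ k j, Integrable (fun ω => ξ k ω j) P := fun k j =>
    (hint k).mono ((hξj k j).mono (hle _) le_rfl).aestronglyMeasurable
      (ae_of_all _ fun ω => PiLp.norm_apply_le (ξ k ω) j)
  have hterm : ∀ k j, Integrable (fun ω => ξ k ω j * (W j (τ (k + 1)) ω - W j (τ k) ω)) P :=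
    fun k j => (hind k j _ (hξj k j)).integrable_mul (hξi k j) (hW.integrable_increment j _ _).1
  have hMi : ∀ n, Integrable (discreteIntegral W τ ξ n) P := fun n =>
    integrable_finsetSum _ fun k _ => integrable_finsetSum _ fun j _ => hterm k j
  refine martingale_of_setIntegral_eq_succ
    (fun n => (measurable_discreteIntegral hW.measurable hτ hξ n).stronglyMeasurable) hMi ?_
  intro n A hA
  have hA' : MeasurableSet[rawFiltration W hW.measurable (τ n)] A := hA
  have hAm : MeasurableSet A := hle _ _ hA'
  simp only [discreteIntegral_succ]
  rw [integral_add (hMi n).integrableOn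
    (integrable_finsetSum _ fun j _ => (hterm n j)).integrableOn,
    integral_finsetSum _ fun j _ => (hterm n j).integrableOn, Finset.sum_eq_zero, add_zero]
  intro j _
  rw [← integral_indicator hAm]
  have hf : Measurable[rawFiltration W hW.measurable (τ n)] (A.indicator fun ω => ξ n ω j) :=
    (hξj n j).indicator hA'
  have e : (A.indicator fun ω => ξ n ω j * (W j (τ (n + 1)) ω - W j (τ n) ω)) =
      fun ω => (A.indicator fun ω => ξ n ω j) ω * (W j (τ (n + 1)) ω - W j (τ n) ω) := by
    ext ω
    by_cases h : ω ∈ A <;> simp [h]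
  rw [e, (hind n j _ hf).integral_fun_mul_eq_mul_integral
    (hf.mono (hle _) le_rfl).aestronglyMeasurable
    (hW.integrable_increment j _ _).1.aestronglyMeasurable, (hW.integrable_increment j _ _).2, mul_zero]

lemma lintegral_iSup_discreteIntegral_le_raw (hW : IsBrownianMotion W P) {τ : ℕ → ℝ≥0}
    (hτ : StrictMono τ) {ξ : ℕ → Ω → EuclideanSpace ℝ (Fin m)}
    (hξ : ∀ k, Measurable[rawFiltration W hW.measurable (τ k)] (ξ k)) {q : ℝ} (hq : 2 ≤ q) (n : ℕ) :
    ∫⁻ ω, (⨆ k ∈ Finset.range (n + 1), ‖discreteIntegral W τ ξ k ω‖ₑ ^ q) ∂P ≤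
      ENNReal.ofReal ((q / (q - 1)) ^ q) * (ENNReal.ofReal (q - 1) ^ (q / 2) *
        ((τ n - τ 0 : ℝ≥0) : ℝ≥0∞) ^ (q / 2 - 1) *
        ∑ k ∈ Finset.range n, stepLength τ k * ∫⁻ ω, ‖ξ k ω‖ₑ ^ q ∂P) := by
  have hq0 : 0 < q := by linarith
  have hq1 : 1 < q := by linarith
  have hC : ENNReal.ofReal ((q / (q - 1)) ^ q) ≠ 0 := by
    have : 0 < q - 1 := by linarith
    simp only [ne_eq, ENNReal.ofReal_eq_zero, not_le]; positivity
  have hC2 : ENNReal.ofReal (q - 1) ^ (q / 2) ≠ 0 := by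
    simp only [ne_eq, ENNReal.rpow_eq_zero_iff, ENNReal.ofReal_eq_zero, ENNReal.ofReal_ne_top]
    rintro (⟨h, -⟩ | ⟨h, -⟩)
    · linarith
    · exact h
  -- If some coefficient has infinite q-th moment, the right-hand side is infinite; strict
  -- monotonicity of τ keeps the corresponding weight from vanishing.
  by_cases hfin : ∀ k < n, ∫⁻ ω, ‖ξ k ω‖ₑ ^ q ∂P ≠ ∞
  swap
  · push Not at hfin
    obtain ⟨k, hk, hinf⟩ := hfin
    have hΔ : stepLength τ k ≠ 0 := by
      have : τ k < τ (k + 1) := hτ k.lt_succ_self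
      exact (ENNReal.coe_pos.2 (tsub_pos_of_lt this)).ne'
    have hsum : ∑ k ∈ Finset.range n, stepLength τ k * ∫⁻ ω, ‖ξ k ω‖ₑ ^ q ∂P = ∞ := by
      refine ENNReal.sum_eq_top.2 ⟨k, Finset.mem_range.2 hk, ?_⟩
      rw [hinf, ENNReal.mul_top hΔ]
    have hT : ((τ n - τ 0 : ℝ≥0) : ℝ≥0∞) ^ (q / 2 - 1) ≠ 0 := by
      have : τ 0 < τ n := hτ (by omega)
      have h0 : ((τ n - τ 0 : ℝ≥0) : ℝ≥0∞) ≠ 0 :=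
        (ENNReal.coe_pos.2 (tsub_pos_of_lt this)).ne'
      simp only [ne_eq, ENNReal.rpow_eq_zero_iff, h0, ENNReal.coe_ne_top, false_and, or_self,
        not_false_eq_true]
    rw [hsum, ENNReal.mul_top (mul_ne_zero hC2 hT), ENNReal.mul_top hC]
    exact le_top
  -- Coefficients from index n on are set to zero: the martingale lemma wants integrability at all
  -- indices, while nothing is known beyond n.
  set ξ' : ℕ → Ω → EuclideanSpace ℝ (Fin m) := fun k => if k < n then ξ k else 0 with hξ'
  have hξ'm : ∀ k, Measurable[rawFiltration W hW.measurable (τ k)] (ξ' k) := fun k => by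
    simp only [hξ']; split_ifs
    · exact hξ k
    · exact measurable_const
  have hfin' : ∀ k, ∫⁻ ω, ‖ξ' k ω‖ₑ ^ q ∂P ≠ ∞ := fun k => by
    simp only [hξ']; split_ifs with h
    · exact hfin k h
    · simp [hq0]
  have hint : ∀ k, Integrable (ξ' k) P := fun k => by
    have hmem : MemLp (ξ' k) (ENNReal.ofReal q) P := by
      refine ⟨((hξ'm k).mono ((rawFiltration W hW.measurable).le _) le_rfl).aestronglyMeasurable, ?_⟩
      rw [eLpNorm_lt_top_iff_lintegral_rpow_enorm_lt_top (by simpa using hq0) ENNReal.ofReal_ne_top,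
        ENNReal.toReal_ofReal hq0.le]
      exact (hfin' k).lt_top
    refine hmem.integrable ?_
    rw [← ENNReal.ofReal_one]; exact ENNReal.ofReal_le_ofReal hq1.le
  have hM := martingale_discreteIntegral hW hτ.monotone hξ'm hint
  have hsub : Submartingale (discreteIntegral W τ ξ' ⊔ -discreteIntegral W τ ξ')
    (sampledFiltration hW.measurable hτ.monotone) P := hM.submartingale.sup hM.neg.submartingale
  have eabs : ∀ k ω, ENNReal.ofReal ((discreteIntegral W τ ξ' ⊔ -discreteIntegral W τ ξ') k ω) ^ q
      = ‖discreteIntegral W τ ξ' k ω‖ₑ ^ q := fun k ω => by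
    rw [Real.enorm_eq_ofReal_abs]; rfl
  have hmom := lintegral_discreteIntegral_rpow_le hW hτ.monotone hξ'm hq
  have hdoob := doob_Lp hsub (fun k ω => abs_nonneg (discreteIntegral W τ ξ' k ω)) hq1 n
    (fun k _ => by
      simp only [eabs]
      refine ne_top_of_le_ne_top ?_ (hmom k)
      refine ENNReal.mul_ne_top (ENNReal.mul_ne_top ?_ ?_) ?_
      · exact ENNReal.rpow_ne_top_of_nonneg (by linarith) ENNReal.ofReal_ne_top
      · exact ENNReal.rpow_ne_top_of_nonneg (by linarith) ENNReal.coe_ne_top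
      · exact (ENNReal.sum_lt_top.2 fun k _ =>
          ENNReal.mul_lt_top ENNReal.coe_lt_top (hfin' k).lt_top).ne)
  simp only [eabs] at hdoob
  have eM : ∀ k ≤ n, ∀ ω, discreteIntegral W τ ξ k ω = discreteIntegral W τ ξ' k ω :=
    fun k hk ω => discreteIntegral_congr fun l hl => by simp [hξ', hl.trans_le hk]
  calc ∫⁻ ω, (⨆ k ∈ Finset.range (n + 1), ‖discreteIntegral W τ ξ k ω‖ₑ ^ q) ∂P
      = ∫⁻ ω, (⨆ k ∈ Finset.range (n + 1), ‖discreteIntegral W τ ξ' k ω‖ₑ ^ q) ∂P := by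
        refine lintegral_congr fun ω => iSup_congr fun k => iSup_congr fun hk => ?_
        rw [eM k (Nat.lt_succ_iff.1 (Finset.mem_range.1 hk))]
    _ ≤ _ := hdoob.trans (mul_le_mul' le_rfl (hmom n))
    _ = _ := by
        congr 2
        refine Finset.sum_congr rfl fun k hk => ?_
        simp [hξ', Finset.mem_range.1 hk]

omit [IsProbabilityMeasure P] in
/-- Replace coefficients adapted to the augmented filtration by ones adapted to the raw one. -/
lemma exists_raw_coefficients (hW : ∀ j t, Measurable (W j t)) {τ : ℕ → ℝ≥0}
    {ξ : ℕ → Ω → EuclideanSpace ℝ (Fin m)}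
    (hξ : ∀ k, Measurable[augmentedFiltration W P (τ k)] (ξ k)) :
    ∃ ξ' : ℕ → Ω → EuclideanSpace ℝ (Fin m),
      (∀ k, Measurable[rawFiltration W hW (τ k)] (ξ' k)) ∧ ∀ᵐ ω ∂P, ∀ k, ξ k ω = ξ' k ω := by
  choose ξ' h1 h2 using fun k => exists_rawFiltration_measurable_ae_eq_vec hW (hξ k)
  exact ⟨ξ', h1, ae_all_iff.2 h2⟩

/-- Maximal inequality for discrete stochastic integrals. -/
lemma lintegral_iSup_discreteIntegral_le (hW : IsBrownianMotion W P) {τ : ℕ → ℝ≥0}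
    (hτ : StrictMono τ) {ξ : ℕ → Ω → EuclideanSpace ℝ (Fin m)}
    (hξ : ∀ k, Measurable[augmentedFiltration W P (τ k)] (ξ k)) {q : ℝ} (hq : 2 ≤ q) (n : ℕ) :
    ∫⁻ ω, (⨆ k ∈ Finset.range (n + 1), ‖discreteIntegral W τ ξ k ω‖ₑ ^ q) ∂P ≤
      ENNReal.ofReal ((q / (q - 1)) ^ q) * (ENNReal.ofReal (q - 1) ^ (q / 2) *
        ((τ n - τ 0 : ℝ≥0) : ℝ≥0∞) ^ (q / 2 - 1) *
        ∑ k ∈ Finset.range n, stepLength τ k * ∫⁻ ω, ‖ξ k ω‖ₑ ^ q ∂P) := by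
  obtain ⟨ξ', h1, h2⟩ := exists_raw_coefficients hW.measurable hξ
  have h := lintegral_iSup_discreteIntegral_le_raw hW hτ h1 hq n
  have e1 : ∫⁻ ω, (⨆ k ∈ Finset.range (n + 1), ‖discreteIntegral W τ ξ k ω‖ₑ ^ q) ∂P =
      ∫⁻ ω, (⨆ k ∈ Finset.range (n + 1), ‖discreteIntegral W τ ξ' k ω‖ₑ ^ q) ∂P := by
    refine lintegral_congr_ae ?_
    filter_upwards [h2] with ω hω
    refine iSup_congr fun k => iSup_congr fun _ => ?_
    rw [discreteIntegral_congr fun l _ => hω l]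
  have e2 : ∀ k, ∫⁻ ω, ‖ξ k ω‖ₑ ^ q ∂P = ∫⁻ ω, ‖ξ' k ω‖ₑ ^ q ∂P := fun k => by
    refine lintegral_congr_ae ?_
    filter_upwards [h2] with ω hω
    rw [hω k]
  simpa only [e1, e2] using h

/-- Control in probability of a discrete stochastic integral. -/
lemma measure_discreteIntegral_ge_le (hW : IsBrownianMotion W P) {τ : ℕ → ℝ≥0}
    (hτ : Monotone τ) {ξ : ℕ → Ω → EuclideanSpace ℝ (Fin m)}
    (hξ : ∀ k, Measurable[augmentedFiltration W P (τ k)] (ξ k)) (n : ℕ) {ε : ℝ≥0∞} (hε : ε ≠ 0)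
    (hεt : ε ≠ ∞) (N : ℝ≥0∞) :
    P {ω | ε ≤ ‖discreteIntegral W τ ξ n ω‖ₑ} ≤ N / ε ^ (2 : ℝ) +
      P {ω | N < ∑ k ∈ Finset.range n, stepLength τ k * ‖ξ k ω‖ₑ ^ (2 : ℝ)} := by
  obtain ⟨ξ', h1, h2⟩ := exists_raw_coefficients hW.measurable hξ
  have hle := fun t => (rawFiltration W hW.measurable).le t
  set A : ℕ → Ω → ℝ≥0∞ := fun n ω =>
    ∑ k ∈ Finset.range n, stepLength τ k * ‖ξ' k ω‖ₑ ^ (2 : ℝ) with hA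
  have hAm : ∀ n, Measurable[rawFiltration W hW.measurable (τ n)] (A (n + 1)) := fun n =>
    Finset.measurable_fun_sum _ fun k hk => Measurable.const_mul
      (((h1 k).mono ((rawFiltration W hW.measurable).mono
        (hτ (Nat.lt_succ_iff.1 (Finset.mem_range.1 hk)))) le_rfl) |> fun h =>
          (by fun_prop : Measurable fun x : EuclideanSpace ℝ (Fin m) => ‖x‖ₑ ^ (2 : ℝ)).comp h) _
  have hAmono : ∀ ω, Monotone fun n => A n ω := fun ω =>
    monotone_nat_of_le_succ fun n => by
      simp only [hA, Finset.sum_range_succ]; exact le_self_add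
  -- The coefficients are switched off once the accumulated energy exceeds N. Here A(k+1) involves
  -- only the coefficients up to index k, so η_k is still known at time τ_k. The energy of η is at
  -- most N everywhere, and η agrees with ξ' wherever the total energy stays below N.
  set η : ℕ → Ω → EuclideanSpace ℝ (Fin m) := fun k => {ω | A (k + 1) ω ≤ N}.indicator (ξ' k) with hη
  have hηm : ∀ k, Measurable[rawFiltration W hW.measurable (τ k)] (η k) := fun k =>
    (h1 k).indicator (hAm k measurableSet_Iic)
  have hbnd : ∀ n ω, ∑ k ∈ Finset.range n, stepLength τ k * ‖η k ω‖ₑ ^ (2 : ℝ) ≤ N := by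
    intro n ω
    induction n with
    | zero => simp
    | succ n ih =>
      by_cases h : A (n + 1) ω ≤ N
      · refine le_trans (Finset.sum_le_sum fun k _ => ?_) h
        gcongr
        simp only [hη]
        exact enorm_indicator_le_enorm_self _ _
      · have : η n ω = 0 := by simp [hη, h]
        rw [Finset.sum_range_succ, this]
        simpa using ih
  have hL2 := lintegral_discreteIntegral_rpow_le hW hτ hηm (q := 2) le_rfl n
  have hηm' : ∀ k, Measurable (η k) := fun k => (hηm k).mono (hle _) le_rfl
  have hMm : Measurable (discreteIntegral W τ η n) :=
    (measurable_discreteIntegral hW.measurable hτ hηm n).mono (hle _) le_rfl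
  have hL2' : ∫⁻ ω, ‖discreteIntegral W τ η n ω‖ₑ ^ (2 : ℝ) ∂P ≤ N := by
    refine hL2.trans ?_
    have e : ∑ k ∈ Finset.range n, stepLength τ k * ∫⁻ ω, ‖η k ω‖ₑ ^ (2 : ℝ) ∂P =
        ∫⁻ ω, ∑ k ∈ Finset.range n, stepLength τ k * ‖η k ω‖ₑ ^ (2 : ℝ) ∂P := by
      rw [lintegral_finsetSum _ fun k _ => by have := hηm' k; fun_prop]
      exact Finset.sum_congr rfl fun k _ =>
        (lintegral_const_mul _ (by have := hηm' k; fun_prop)).symm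
    rw [e]
    norm_num
    refine (lintegral_mono fun ω => ?_).trans_eq (b := ∫⁻ _, N ∂P) (by simp)
    simpa using hbnd n ω
  have hsub : {ω | ε ≤ ‖discreteIntegral W τ ξ n ω‖ₑ} ≤ᵐ[P]
      ({ω | ε ^ (2 : ℝ) ≤ ‖discreteIntegral W τ η n ω‖ₑ ^ (2 : ℝ)} ∪
        {ω | N < ∑ k ∈ Finset.range n, stepLength τ k * ‖ξ k ω‖ₑ ^ (2 : ℝ)} : Set Ω) := by
    filter_upwards [h2] with ω hω hmem
    by_cases h : N < ∑ k ∈ Finset.range n, stepLength τ k * ‖ξ k ω‖ₑ ^ (2 : ℝ)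
    · exact Or.inr h
    · left
      have hAn : A n ω ≤ N := by
        simp only [hA]
        simpa only [hω, not_lt] using h
      have e : discreteIntegral W τ ξ n ω = discreteIntegral W τ η n ω :=
        discreteIntegral_congr fun k hk => by
          have : A (k + 1) ω ≤ N := (hAmono ω hk).trans hAn
          simp [hη, this, hω k]
      have hmem : ε ≤ ‖discreteIntegral W τ ξ n ω‖ₑ := hmem
      show ε ^ (2 : ℝ) ≤ ‖discreteIntegral W τ η n ω‖ₑ ^ (2 : ℝ)
      rw [← e]; gcongr
  refine (measure_mono_ae hsub).trans ((measure_union_le _ _).trans ?_)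
  gcongr
  refine (meas_ge_le_lintegral_div (by fun_prop) (by simp [hε])
    (ENNReal.rpow_ne_top_of_nonneg (by norm_num) hεt)).trans ?_
  gcongr

end Discrete

/-! ### Lebesgue measure on the half-line and enumerations of finite time sets. -/

section Time

lemma measurableEmbedding_nnreal_coe : MeasurableEmbedding (fun t : ℝ≥0 => (t : ℝ)) :=
  MeasurableEmbedding.subtype_coe measurableSet_Ici

lemma lebesgueTime_apply (s : Set ℝ≥0) : lebesgueTime s = volume ((fun t : ℝ≥0 => (t : ℝ)) '' s) :=
  measurableEmbedding_nnreal_coe.comap_apply _ _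

lemma lebesgueTime_Ico (a b : ℝ≥0) : lebesgueTime (Set.Ico a b) = ((b - a : ℝ≥0) : ℝ≥0∞) := by
  rw [lebesgueTime_apply, NNReal.image_coe_Ico, Real.volume_Ico, ENNReal.ofReal]
  congr 1

instance nullSingletonClass_lebesgueTime : NullSingletonClass lebesgueTime :=
  ⟨fun a => by rw [lebesgueTime_apply, Set.image_singleton, Real.volume_singleton]⟩

lemma lebesgueTime_Icc (a b : ℝ≥0) : lebesgueTime (Set.Icc a b) = ((b - a : ℝ≥0) : ℝ≥0∞) := by
  rw [← lebesgueTime_Ico, measure_congr Ico_ae_eq_Icc.symm]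

instance isFiniteMeasure_restrict_lebesgueTime_Icc (a b : ℝ≥0) :
    IsFiniteMeasure (lebesgueTime.restrict (Set.Icc a b)) :=
  ⟨by rw [Measure.restrict_apply_univ, lebesgueTime_Icc]; exact ENNReal.coe_lt_top⟩

lemma map_restrict_lebesgueTime (s : Set ℝ≥0) :
    (lebesgueTime.restrict s).map (fun t : ℝ≥0 => (t : ℝ)) =
      volume.restrict ((fun t : ℝ≥0 => (t : ℝ)) '' s) := by
  have he := measurableEmbedding_nnreal_coe
  rw [lebesgueTime, he.restrict_comap, he.map_comap,
    Measure.restrict_restrict he.measurableSet_range,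
    Set.inter_eq_right.2 (Set.image_subset_range _ _)]

lemma setLIntegral_lebesgueTime_Icc (a b : ℝ≥0) (f : ℝ → ℝ≥0∞) :
    ∫⁻ t in Set.Icc a b, f t ∂lebesgueTime = ∫⁻ t in Set.Icc (a : ℝ) b, f t := by
  rw [← NNReal.image_coe_Icc, ← map_restrict_lebesgueTime,
    measurableEmbedding_nnreal_coe.lintegral_map]

/-- Integrals of step functions of time. -/
lemma setLIntegral_Icc_eq_sum_stepLength {τ : ℕ → ℝ≥0} (hτ : Monotone τ) (h0 : τ 0 = 0)
    {f : ℝ≥0 → ℝ≥0∞} (hf : ∀ k, ∀ s ∈ Set.Ico (τ k) (τ (k + 1)), f s = f (τ k)) (n : ℕ) :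
    ∫⁻ s in Set.Icc 0 (τ n), f s ∂lebesgueTime =
      ∑ k ∈ Finset.range n, stepLength τ k * f (τ k) := by
  rw [setLIntegral_congr Ico_ae_eq_Icc.symm]
  induction n with
  | zero => simp [h0]
  | succ n ih =>
    rw [Finset.sum_range_succ, ← ih, ← Set.Ico_union_Ico_eq_Ico (zero_le) (hτ n.le_succ),
      lintegral_union measurableSet_Ico Set.Ico_disjoint_Ico_same,
      setLIntegral_congr_fun measurableSet_Ico (hf n), setLIntegral_const, lebesgueTime_Ico,
      mul_comm]
    rfl

/-- Every finite set of times occurs along some strictly increasing sequence started at `0`. -/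
lemma exists_strictMono_enumeration (F : Finset ℝ≥0) :
    ∃ τ : ℕ → ℝ≥0, StrictMono τ ∧ τ 0 = 0 ∧ (F : Set ℝ≥0) ⊆ Set.range τ := by
  classical
  set G := insert 0 F with hG
  have hne : G.Nonempty := ⟨0, Finset.mem_insert_self _ _⟩
  have hc : 0 < G.card := hne.card_pos
  set e := G.orderEmbOfFin rfl with he
  -- After the finite set is exhausted, the sequence continues past its maximum in unit steps, so
  -- that it stays strictly increasing.
  set τ : ℕ → ℝ≥0 := fun k => if h : k < G.card then e ⟨k, h⟩ else G.max' hne + k with hτ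
  refine ⟨τ, strictMono_nat_of_lt_succ fun k => ?_, ?_, fun x hx => ?_⟩
  · simp only [hτ]
    split_ifs with h1 h2 h2
    · exact e.strictMono (Fin.mk_lt_mk.2 k.lt_succ_self)
    · refine lt_of_le_of_lt (G.le_max' _ (G.orderEmbOfFin_mem rfl _)) ?_
      exact lt_add_of_pos_right _ (by positivity)
    · omega
    · push_cast
      rw [← add_assoc]
      exact lt_add_of_pos_right _ one_pos
  · have : τ 0 = e ⟨0, hc⟩ := by simp [hτ, hc]
    rw [this, he, G.orderEmbOfFin_zero rfl hc]
    exact le_antisymm (G.min'_le _ (Finset.mem_insert_self _ _)) zero_le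
  · have hx' : x ∈ Set.range e := by
      rw [he, G.range_orderEmbOfFin rfl]; exact Finset.mem_coe.2 (Finset.mem_insert_of_mem hx)
    obtain ⟨i, rfl⟩ := hx'
    exact ⟨i, by simp [hτ, i.2]⟩

end Time

/-! ### Step processes seen along arbitrary refining partitions. -/

section Elementary
variable {Ω : Type*} [mΩ : MeasurableSpace Ω] {P : Measure Ω}
  {m : ℕ} {W : Fin m → ℝ≥0 → Ω → ℝ}

/-- `Y` is a step process with jumps in `G`, and `J` is its stochastic integral process. -/
structure IsElementary (W : Fin m → ℝ≥0 → Ω → ℝ) (P : Measure Ω) (G : Finset ℝ≥0)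
    (Y : ℝ≥0 → Ω → EuclideanSpace ℝ (Fin m)) (J : ℝ≥0 → Ω → ℝ) : Prop where
  adapted : ∀ s, Measurable[augmentedFiltration W P s] (Y s)
  const : ∀ τ : ℕ → ℝ≥0, StrictMono τ → τ 0 = 0 → (G : Set ℝ≥0) ⊆ Set.range τ →
    ∀ k, ∀ s ∈ Set.Ico (τ k) (τ (k + 1)), Y s = Y (τ k)
  integral : ∀ τ : ℕ → ℝ≥0, StrictMono τ → τ 0 = 0 → (G : Set ℝ≥0) ⊆ Set.range τ →
    ∀ n ω, J (τ n) ω = discreteIntegral W τ (fun k => Y (τ k)) n ω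

/-- `IsElementary` quantifies over every sequence that passes through the jump times. A sequence
through G ∪ G' serves both processes at once, so no common refinement has to be constructed. -/
lemma IsElementary.sub {G G' : Finset ℝ≥0} {Y Y' : ℝ≥0 → Ω → EuclideanSpace ℝ (Fin m)}
    {J J' : ℝ≥0 → Ω → ℝ} (h : IsElementary W P G Y J) (h' : IsElementary W P G' Y' J') :
    ∃ G, IsElementary W P G (fun s ω => Y s ω - Y' s ω) (fun s ω => J s ω - J' s ω) := by
  classical
  refine ⟨G ∪ G', fun s => (h.adapted s).sub (h'.adapted s), fun τ h1 h2 h3 k s hs => ?_,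
    fun τ h1 h2 h3 n ω => ?_⟩
  all_goals
    rw [Finset.coe_union, Set.union_subset_iff] at h3
  · ext1 ω
    rw [h.const τ h1 h2 h3.1 k s hs, h'.const τ h1 h2 h3.2 k s hs]
  · rw [h.integral τ h1 h2 h3.1, h'.integral τ h1 h2 h3.2]
    simp only [discreteIntegral, PiLp.sub_apply, sub_mul, Finset.sum_sub_distrib]

lemma IsElementary.sum {ι : Type*} (S : Finset ι) {G : ι → Finset ℝ≥0}
    {Y : ι → ℝ≥0 → Ω → EuclideanSpace ℝ (Fin m)}
    {J : ι → ℝ≥0 → Ω → ℝ} (h : ∀ i ∈ S, IsElementary W P (G i) (Y i) (J i)) :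
    ∃ G, IsElementary W P G (fun s ω => ∑ i ∈ S, Y i s ω) (fun s ω => ∑ i ∈ S, J i s ω) := by
  classical
  refine ⟨S.biUnion G, fun s => Finset.measurable_fun_sum _ fun i hi => (h i hi).adapted s,
    fun τ h1 h2 h3 k s hs => ?_, fun τ h1 h2 h3 n ω => ?_⟩
  all_goals
    have h3' : ∀ i ∈ S, (G i : Set ℝ≥0) ⊆ Set.range τ := fun i hi =>
      (Finset.coe_subset.2 (Finset.subset_biUnion_of_mem G hi)).trans h3
  · ext1 ω
    exact Finset.sum_congr rfl fun i hi => by rw [(h i hi).const τ h1 h2 (h3' i hi) k s hs]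
  · rw [Finset.sum_congr rfl fun i hi => (h i hi).integral τ h1 h2 (h3' i hi) n ω]
    simp only [discreteIntegral]
    rw [Finset.sum_comm]
    refine Finset.sum_congr rfl fun k _ => ?_
    rw [Finset.sum_comm]
    refine Finset.sum_congr rfl fun j _ => ?_
    simp [Finset.sum_mul]

/-- The stochastic integral of a step process as a process. -/
noncomputable def StepProc.process {ℱ : ℝ≥0 → MeasurableSpace Ω} {t₀ t : ℝ≥0}
    (S : StepProc ℱ t₀ t) (B : ℝ≥0 → Ω → ℝ) (s : ℝ≥0) (ω : Ω) : ℝ :=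
  ∑ i : Fin S.n, S.coef i ω * (B (min (S.part i.succ) s) ω - B (min (S.part i.castSucc) s) ω)

omit mΩ in
lemma StepProc.process_eq_integral {ℱ : ℝ≥0 → MeasurableSpace Ω} {t₀ t : ℝ≥0}
    (S : StepProc ℱ t₀ t) (B : ℝ≥0 → Ω → ℝ) (ω : Ω) : S.process B t ω = S.integral B ω := by
  have h : ∀ i, S.part i ≤ t := fun i => by
    exact (S.strictMono_part.monotone (Fin.le_last i)).trans_eq S.part_last
  simp [StepProc.process, StepProc.integral, h]

lemma StepProc.measurable_eval {t : ℝ≥0} (S : StepProc (augmentedFiltration W P) 0 t) (s : ℝ≥0) :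
    Measurable[augmentedFiltration W P s] (S.eval s) := by
  refine Finset.measurable_fun_sum _ fun i _ => ?_
  by_cases h : s ∈ Set.Ico (S.part i.castSucc) (S.part i.succ)
  · simp only [Set.indicator_of_mem h]
    exact (S.measurable_coef i).mono (augmentedFiltration_mono h.1) le_rfl
  · simp only [Set.indicator_of_notMem h]
    exact measurable_const

/-- Telescoping along τ up to the smaller of a and τ n. Since a is itself a grid point, no cell is
cut. -/
lemma sub_eq_sum_indicator {τ : ℕ → ℝ≥0} (hτ : StrictMono τ) (h0 : τ 0 = 0) {a : ℝ≥0}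
    (ha : a ∈ Set.range τ) (b : ℝ≥0 → ℝ) (n : ℕ) :
    b (min a (τ n)) - b 0 =
      ∑ k ∈ Finset.range n, if τ k < a then b (τ (k + 1)) - b (τ k) else 0 := by
  obtain ⟨l, rfl⟩ := ha
  induction n with
  | zero => simp [h0]
  | succ n ih =>
    rw [Finset.sum_range_succ, ← ih]
    split_ifs with h
    · have h1 : τ (n + 1) ≤ τ l := hτ.monotone (hτ.lt_iff_lt.1 h)
      rw [min_eq_right h1, min_eq_right h.le]; ring
    · have h1 : τ l ≤ τ n := not_lt.1 h
      rw [min_eq_left h1, min_eq_left (h1.trans (hτ.monotone n.le_succ)), add_zero]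

/-- A step process of the `j`-th coordinate is elementary. -/
lemma StepProc.isElementary {t : ℝ≥0} (S : StepProc (augmentedFiltration W P) 0 t) (j : Fin m) :
    ∃ G, IsElementary W P G (fun s ω => EuclideanSpace.single j (S.eval s ω)) (S.process (W j)) := by
  classical
  refine ⟨Finset.univ.image S.part, fun s => ?_, fun τ h1 h2 h3 k s hs => ?_,
    fun τ h1 h2 h3 n ω => ?_⟩
  · have : Measurable fun x : ℝ => EuclideanSpace.single j x := by
      have h : Measurable fun x : ℝ => WithLp.toLp 2 (Pi.single j x : Fin m → ℝ) :=
        (WithLp.measurable_toLp 2 _).comp <| measurable_pi_of_forall fun i => by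
          by_cases h : i = j
          · subst h; simpa using measurable_id'
          · simp [h]
      exact h
    exact this.comp (S.measurable_eval s)
  all_goals
    have h3' : ∀ i, S.part i ∈ Set.range τ := fun i => h3 (by simp)
  -- Every breakpoint of S lies in the range of τ, so none lies strictly inside the cell of s.
  · have hlt : ∀ i, (s < S.part i ↔ τ k < S.part i) := fun i => by
      obtain ⟨l, hl⟩ := h3' i
      rw [← hl]
      refine ⟨fun h => hs.1.trans_lt h, fun h => hs.2.trans_le ?_⟩
      exact h1.monotone (h1.lt_iff_lt.1 h)
    have hmem : ∀ i : Fin S.n, (s ∈ Set.Ico (S.part i.castSucc) (S.part i.succ) ↔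
        τ k ∈ Set.Ico (S.part i.castSucc) (S.part i.succ)) := fun i => by
      simp only [Set.mem_Ico, ← not_lt, hlt]
    ext1 ω
    congr 1
    simp only [StepProc.eval, Set.indicator, hmem]
  · simp only [StepProc.process, discreteIntegral]
    have e1 : ∀ k, ∑ j', (EuclideanSpace.single j (S.eval (τ k) ω)).ofLp j' *
        (W j' (τ (k + 1)) ω - W j' (τ k) ω) =
        S.eval (τ k) ω * (W j (τ (k + 1)) ω - W j (τ k) ω) := fun k => by
      rw [Finset.sum_eq_single j] <;> simp +contextual
    simp only [e1]
    simp only [StepProc.eval, Finset.sum_mul]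
    rw [Finset.sum_comm]
    refine Finset.sum_congr rfl fun i _ => ?_
    have hA := sub_eq_sum_indicator h1 h2 (h3' i.succ) (fun s => W j s ω) n
    have hB := sub_eq_sum_indicator h1 h2 (h3' i.castSucc) (fun s => W j s ω) n
    -- The increment over the stopped interval is a difference of two telescoping sums from time 0;
    -- the surviving cells are those with τ k in the interval.
    have e2 : W j (min (S.part i.succ) (τ n)) ω - W j (min (S.part i.castSucc) (τ n)) ω =
        ∑ k ∈ Finset.range n, ((if τ k < S.part i.succ then W j (τ (k + 1)) ω - W j (τ k) ω else 0) -
          if τ k < S.part i.castSucc then W j (τ (k + 1)) ω - W j (τ k) ω else 0) := by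
      rw [Finset.sum_sub_distrib, ← hA, ← hB]; ring
    rw [e2, Finset.mul_sum]
    refine Finset.sum_congr rfl fun k _ => ?_
    have hle : S.part i.castSucc < S.part i.succ := S.strictMono_part i.castSucc_lt_succ
    simp only [Set.indicator, Set.mem_Ico]
    split_ifs <;> first | ring1 | (exfalso; grind)

end Elementary

lemma sum_fin_castLE {M : Type*} [AddCommMonoid M] {r n : ℕ} (h : r ≤ n) (f : Fin n → M)
    (h0 : ∀ i : Fin n, r ≤ i → f i = 0) : ∑ i : Fin r, f (Fin.castLE h i) = ∑ i, f i := by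
  obtain ⟨k, rfl⟩ := Nat.exists_eq_add_of_le h
  rw [Fin.sum_univ_add, Finset.sum_eq_zero (s := Finset.univ) (f := fun i => f (Fin.natAdd r i)),
    add_zero]
  · rfl
  · exact fun i _ => h0 _ (by simp)

/-- Restriction of a step process to a shorter time interval. -/
lemma StepProc.exists_restrict {Ω : Type*} {ℱ : ℝ≥0 → MeasurableSpace Ω} {T t : ℝ≥0} (htT : t ≤ T)
    (S : StepProc ℱ 0 T) : ∃ S' : StepProc ℱ 0 t, (∀ s < t, S'.eval s = S.eval s) ∧
      ∀ B : ℝ≥0 → Ω → ℝ, S'.integral B = S.process B t := by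
  classical
  have hex : ∃ r : ℕ, ∃ h : r < S.n + 1, t ≤ S.part ⟨r, h⟩ :=
    ⟨S.n, S.n.lt_succ_self, htT.trans_eq S.part_last.symm⟩
  -- r is the least index whose breakpoint reaches t. The first r intervals are kept, the last of
  -- them cut at t; for t = 0 this gives r = 0, the empty sum.
  obtain ⟨r, ⟨hr, htr⟩, hmin⟩ : ∃ r : ℕ, (∃ h : r < S.n + 1, t ≤ S.part ⟨r, h⟩) ∧
      ∀ k (h : k < S.n + 1), k < r → S.part ⟨k, h⟩ < t := by
    refine ⟨Nat.find hex, Nat.find_spec hex, fun k h hk => ?_⟩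
    have := Nat.find_min hex hk
    push Not at this
    exact this h
  have hrn : r ≤ S.n := Nat.lt_succ_iff.1 hr
  have hmono := S.strictMono_part
  have hlarge : ∀ k (h : k < S.n + 1), r ≤ k → t ≤ S.part ⟨k, h⟩ := fun k h hk =>
    htr.trans (hmono.monotone (Fin.mk_le_mk.2 hk))
  refine ⟨{
    n := r
    part := fun i => min (S.part (Fin.castLE (by omega) i)) t
    strictMono_part := fun i j hij => ?_
    part_zero := ?_
    part_last := ?_
    coef := fun i => S.coef (Fin.castLE hrn i)
    measurable_coef := fun i => ?_ }, fun s hs => ?_, fun B => ?_⟩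
  · have h1 : (i : ℕ) < r := by omega
    have h2 := hmin i (by omega) h1
    have h3 : S.part (Fin.castLE (by omega) i) < S.part (Fin.castLE (by omega) j) :=
      hmono (by simpa using hij)
    exact (min_le_left _ _).trans_lt (lt_min h3 h2)
  · have : (Fin.castLE (by omega) (0 : Fin (r + 1)) : Fin (S.n + 1)) = 0 := rfl
    simp only [this, S.part_zero]
    exact min_eq_left zero_le
  · exact min_eq_right htr
  · have h2 := hmin i (by omega) i.2
    have : min (S.part (Fin.castLE (by omega) i.castSucc)) t =
      S.part (Fin.castLE hrn i).castSucc := min_eq_left h2.le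
    rw [this]
    exact S.measurable_coef _
  · ext ω
    simp only [StepProc.eval]
    rw [← sum_fin_castLE hrn]
    · refine Finset.sum_congr rfl fun i _ => ?_
      simp only [Set.indicator, Set.mem_Ico, min_le_iff, lt_min_iff, hs, and_true, hs.not_ge,
        or_false]
      rfl
    · intro i hi
      refine Set.indicator_of_notMem (fun h => ?_) _
      exact (h.1.trans_lt hs).not_ge (hlarge i (by omega) hi)
  · ext ω
    simp only [StepProc.integral, StepProc.process]
    rw [← sum_fin_castLE hrn]
    · rfl
    · intro i hi
      have h1 : min (S.part i.castSucc) t = t := min_eq_right (hlarge i (by omega) hi)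
      have h2 : min (S.part i.succ) t = t := min_eq_right (hlarge (i + 1) (by omega) (by omega))
      rw [h1, h2, sub_self, mul_zero]

/-! ### Maximal inequality and control in probability for step processes. -/

section Bounds
variable {Ω : Type*} [mΩ : MeasurableSpace Ω] {P : Measure Ω} [IsProbabilityMeasure P]
  {m : ℕ} {W : Fin m → ℝ≥0 → Ω → ℝ}
  {G : Finset ℝ≥0} {Y : ℝ≥0 → Ω → EuclideanSpace ℝ (Fin m)} {J : ℝ≥0 → Ω → ℝ}

lemma IsElementary.aemeasurable_integral (hW : IsBrownianMotion W P) (h : IsElementary W P G Y J)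
    (t : ℝ≥0) : AEMeasurable (J t) P := by
  classical
  obtain ⟨τ, hτ, h0, hF⟩ := exists_strictMono_enumeration (insert t G)
  have hG : (G : Set ℝ≥0) ⊆ Set.range τ :=
    (Finset.coe_subset.2 (Finset.subset_insert t G)).trans hF
  obtain ⟨n, rfl⟩ : t ∈ Set.range τ := hF (by simp)
  obtain ⟨ξ', h1, h2⟩ := exists_raw_coefficients hW.measurable
    (ξ := fun k => Y (τ k)) fun k => h.adapted (τ k)
  refine ⟨discreteIntegral W τ ξ' n,
    (measurable_discreteIntegral hW.measurable hτ.monotone h1 n).mono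
      ((rawFiltration W hW.measurable).le _) le_rfl, ?_⟩
  filter_upwards [h2] with ω hω
  rw [h.integral τ hτ h0 hG n ω]
  exact discreteIntegral_congr fun k _ => hω k

/-- The constant in the maximal inequality for step processes. -/
noncomputable def maximalConst (q : ℝ) (T : ℝ≥0) : ℝ≥0∞ :=
  ENNReal.ofReal ((q / (q - 1)) ^ q) * (ENNReal.ofReal (q - 1) ^ (q / 2) * (T : ℝ≥0∞) ^ (q / 2 - 1))

/-- Maximal inequality for stochastic integrals of step processes. -/
lemma IsElementary.lintegral_iSup_le (hW : IsBrownianMotion W P) (h : IsElementary W P G Y J)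
    {q : ℝ} (hq : 2 ≤ q) {T : ℝ≥0} {d : ℕ → ℝ≥0} (hd : ∀ i, d i ≤ T) :
    ∫⁻ ω, (⨆ i, ‖J (d i) ω‖ₑ ^ q) ∂P ≤ maximalConst q T *
      ∫⁻ ω, ∫⁻ s in Set.Icc 0 T, ‖Y s ω‖ₑ ^ q ∂lebesgueTime ∂P := by
  classical
  -- For finitely many times, a single partition contains them together with the jumps and T.
  -- Monotone convergence then handles the whole sequence.
  have hfin : ∀ N : ℕ, ∫⁻ ω, (⨆ i ∈ Finset.range N, ‖J (d i) ω‖ₑ ^ q) ∂P ≤ maximalConst q T *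
      ∫⁻ ω, ∫⁻ s in Set.Icc 0 T, ‖Y s ω‖ₑ ^ q ∂lebesgueTime ∂P := by
    intro N
    obtain ⟨τ, hτ, h0, hF⟩ := exists_strictMono_enumeration
      (insert T (G ∪ (Finset.range N).image d))
    rw [Finset.coe_insert, Set.insert_subset_iff, Finset.coe_union, Set.union_subset_iff] at hF
    obtain ⟨⟨n, hn⟩, hG, hdτ⟩ := hF
    have hY : ∀ k, Measurable[augmentedFiltration W P (τ k)] (Y (τ k)) := fun k => h.adapted _
    have hmain := lintegral_iSup_discreteIntegral_le hW hτ hY hq n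
    have e1 : ∫⁻ ω, ∫⁻ s in Set.Icc 0 T, ‖Y s ω‖ₑ ^ q ∂lebesgueTime ∂P =
        ∑ k ∈ Finset.range n, stepLength τ k * ∫⁻ ω, ‖Y (τ k) ω‖ₑ ^ q ∂P := by
      have e2 : ∀ ω, ∫⁻ s in Set.Icc 0 T, ‖Y s ω‖ₑ ^ q ∂lebesgueTime =
          ∑ k ∈ Finset.range n, stepLength τ k * ‖Y (τ k) ω‖ₑ ^ q := fun ω => by
        rw [← hn]
        exact setLIntegral_Icc_eq_sum_stepLength hτ.monotone h0
          (fun k s hs => by rw [h.const τ hτ h0 hG k s hs]) n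
      have hYm : ∀ k, AEMeasurable (Y (τ k)) P := fun k => by
        obtain ⟨g, hg, hfg⟩ := exists_rawFiltration_measurable_ae_eq_vec hW.measurable (hY k)
        exact ⟨g, hg.mono ((rawFiltration W hW.measurable).le _) le_rfl, hfg⟩
      simp only [e2]
      rw [lintegral_finsetSum' _ fun k _ => by have := hYm k; fun_prop]
      exact Finset.sum_congr rfl fun k _ =>
        lintegral_const_mul'' _ (by have := hYm k; fun_prop)
    rw [e1, maximalConst]
    rw [h0, tsub_zero, hn, ← mul_assoc] at hmain
    refine le_trans (lintegral_mono fun ω => iSup₂_le fun i hi => ?_) hmain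
    obtain ⟨k, hk⟩ : d i ∈ Set.range τ := hdτ (by
      rw [Finset.coe_image]; exact Set.mem_image_of_mem _ hi)
    have hkn : k ≤ n := hτ.le_iff_le.1 (by rw [hk, hn]; exact hd i)
    rw [← hk, h.integral τ hτ h0 hG k ω]
    exact le_iSup₂_of_le k (Finset.mem_range.2 (Nat.lt_succ_iff.2 hkn)) le_rfl
  have e : ∀ ω, (⨆ i, ‖J (d i) ω‖ₑ ^ q) = ⨆ N : ℕ, ⨆ i ∈ Finset.range N, ‖J (d i) ω‖ₑ ^ q :=
    fun ω => by
      apply le_antisymm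
      · exact iSup_le fun i => le_iSup_of_le (i + 1)
          (le_iSup₂_of_le i (Finset.self_mem_range_succ i) le_rfl)
      · exact iSup_le fun N => iSup₂_le fun i _ => le_iSup (fun i => ‖J (d i) ω‖ₑ ^ q) i
  simp only [e]
  have hJ := h.aemeasurable_integral hW
  have hm : ∀ N : ℕ, AEMeasurable (fun ω => ⨆ i ∈ Finset.range N, ‖J (d i) ω‖ₑ ^ q) P := fun N =>
    AEMeasurable.biSup _ (Finset.range N).countable_toSet
      fun i _ => by have := hJ (d i); fun_prop
  rw [lintegral_iSup' hm
    (ae_of_all _ fun ω N N' hNN' => biSup_mono fun i hi =>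
      Finset.range_mono hNN' hi)]
  exact iSup_le hfin

/-- Control in probability of the stochastic integral of a step process. -/
lemma IsElementary.measure_ge_le (hW : IsBrownianMotion W P) (h : IsElementary W P G Y J)
    (t : ℝ≥0) {ε : ℝ≥0∞} (hε : ε ≠ 0) (hεt : ε ≠ ∞) (N : ℝ≥0∞) :
    P {ω | ε ≤ ‖J t ω‖ₑ} ≤ N / ε ^ (2 : ℝ) +
      P {ω | N < ∫⁻ s in Set.Icc 0 t, ‖Y s ω‖ₑ ^ (2 : ℝ) ∂lebesgueTime} := by
  classical
  obtain ⟨τ, hτ, h0, hF⟩ := exists_strictMono_enumeration (insert t G)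
  have hG : (G : Set ℝ≥0) ⊆ Set.range τ :=
    (Finset.coe_subset.2 (Finset.subset_insert t G)).trans hF
  obtain ⟨n, hn⟩ : t ∈ Set.range τ := hF (by simp)
  have hmain := measure_discreteIntegral_ge_le hW hτ.monotone
    (ξ := fun k => Y (τ k)) (fun k => h.adapted (τ k)) n hε hεt N
  have e2 : ∀ ω, ∫⁻ s in Set.Icc 0 t, ‖Y s ω‖ₑ ^ (2 : ℝ) ∂lebesgueTime =
      ∑ k ∈ Finset.range n, stepLength τ k * ‖Y (τ k) ω‖ₑ ^ (2 : ℝ) := fun ω => by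
    rw [← hn]
    exact setLIntegral_Icc_eq_sum_stepLength hτ.monotone h0
      (fun k s hs => by rw [h.const τ hτ h0 hG k s hs]) n
  simp only [e2]
  simpa only [← h.integral τ hτ h0 hG n, hn] using hmain

end Bounds

/-! ### Continuity of translations and the choice of a sampling grid. -/

section Translation

/-- Continuity of translation in L^q, obtained from continuity of composition with
measure-preserving maps. -/
lemma tendsto_lintegral_translate_sub {g : ℝ → ℝ} (hg : Measurable g) {q : ℝ} (hq : 1 ≤ q)
    (hfin : ∫⁻ a, ‖g a‖ₑ ^ q ≠ ∞) :
    Tendsto (fun u : ℝ => ∫⁻ a, ‖g (a + u) - g a‖ₑ ^ q) (𝓝 0) (𝓝 0) := by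
  have hq0 : 0 < q := by linarith
  have hqe : ENNReal.ofReal q ≠ 0 := by simpa using hq0
  have : Fact (1 ≤ ENNReal.ofReal q) := ⟨by
    rw [← ENNReal.ofReal_one]; exact ENNReal.ofReal_le_ofReal hq⟩
  have hmem : MemLp g (ENNReal.ofReal q) volume := by
    refine ⟨hg.aestronglyMeasurable, ?_⟩
    rw [eLpNorm_lt_top_iff_lintegral_rpow_enorm_lt_top hqe ENNReal.ofReal_ne_top,
      ENNReal.toReal_ofReal hq0.le]
    exact hfin.lt_top
  set F : ℝ → C(ℝ, ℝ) := fun u => ⟨fun a => a + u, by fun_prop⟩ with hF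
  have hFmp : ∀ u, MeasurePreserving (F u) volume volume := fun u => measurePreserving_add_right _ u
  have hFc : Continuous F := ContinuousMap.continuous_of_continuous_uncurry _ (by
    simp only [hF, Function.uncurry_def, ContinuousMap.coe_mk]; fun_prop)
  have hlim := Tendsto.compMeasurePreservingLp (μ := volume) (ν := volume) (E := ℝ)
    (p := ENNReal.ofReal q) (f := fun _ : ℝ => hmem.toLp g) (l := 𝓝 0)
    tendsto_const_nhds (hFc.tendsto 0) hFmp (hFmp 0) ENNReal.ofReal_ne_top
  rw [tendsto_iff_edist_tendsto_0] at hlim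
  have e : ∀ u, edist (Lp.compMeasurePreserving (F u) (hFmp u) (hmem.toLp g))
      (Lp.compMeasurePreserving (F 0) (hFmp 0) (hmem.toLp g)) =
      (∫⁻ a, ‖g (a + u) - g a‖ₑ ^ q) ^ (1 / q) := fun u => by
    rw [Lp.edist_def, eLpNorm_eq_lintegral_rpow_enorm_toReal hqe ENNReal.ofReal_ne_top,
      ENNReal.toReal_ofReal hq0.le]
    congr 1
    refine lintegral_congr_ae ?_
    have h1 : ∀ u, Lp.compMeasurePreserving (F u) (hFmp u) (hmem.toLp g) =ᵐ[volume]
        fun a => g (a + u) := fun u => by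
      refine (Lp.coeFn_compMeasurePreserving _ (hFmp u)).trans ?_
      exact (hFmp u).quasiMeasurePreserving.ae_eq_comp hmem.coeFn_toLp
    filter_upwards [h1 u, h1 0] with a h2 h3
    rw [Pi.sub_apply, h2, h3, add_zero]
  simp only [e] at hlim
  have h2 := (ENNReal.continuous_rpow_const (y := q)).tendsto 0 |>.comp hlim
  simpa [Function.comp_def, ← ENNReal.rpow_mul, hq0.ne', hq0] using h2

lemma enorm_sub_rpow_le (x y : ℝ) {q : ℝ} (hq : 1 ≤ q) :
    ‖x - y‖ₑ ^ q ≤ 2 ^ (q - 1) * (‖x‖ₑ ^ q + ‖y‖ₑ ^ q) := by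
  refine le_trans ?_ (ENNReal.rpow_add_le_mul_rpow_add_rpow _ _ hq)
  exact ENNReal.rpow_le_rpow enorm_sub_le (by linarith)

variable {Ω : Type*} [mΩ : MeasurableSpace Ω] {P : Measure Ω} [IsProbabilityMeasure P]

/-- Dominated convergence in ω: by translation invariance the inner integral is at most 2^{q-1}
times twice the q-th power integral of the path. -/
lemma tendsto_lintegral_lintegral_translate_sub {f : ℝ → Ω → ℝ} (hf : Measurable (Function.uncurry f))
    {q : ℝ} (hq : 1 ≤ q) (hfin : ∫⁻ ω, ∫⁻ a, ‖f a ω‖ₑ ^ q ∂volume ∂P ≠ ∞) :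
    Tendsto (fun u : ℝ => ∫⁻ ω, ∫⁻ a, ‖f (a + u) ω - f a ω‖ₑ ^ q ∂volume ∂P) (𝓝 0) (𝓝 0) := by
  have hswap : Measurable fun p : Ω × ℝ => f p.2 p.1 := hf.comp measurable_swap
  have hm1 : Measurable fun ω => ∫⁻ a, ‖f a ω‖ₑ ^ q :=
    Measurable.lintegral_prod_right' (f := fun p : Ω × ℝ => ‖f p.2 p.1‖ₑ ^ q) (by fun_prop)
  have hfω : ∀ ω, Measurable fun a => f a ω := fun ω =>
    hf.comp (f := fun a : ℝ => (a, ω)) (by fun_prop)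
  have := tendsto_lintegral_filter_of_dominated_convergence (μ := P) (l := 𝓝 (0 : ℝ))
    (F := fun u ω => ∫⁻ a, ‖f (a + u) ω - f a ω‖ₑ ^ q) (f := fun _ => 0)
    (fun ω => 2 ^ (q - 1) * ((∫⁻ a, ‖f a ω‖ₑ ^ q) + ∫⁻ a, ‖f a ω‖ₑ ^ q))
    (Eventually.of_forall fun u => by
      refine Measurable.lintegral_prod_right'
        (f := fun p : Ω × ℝ => ‖f (p.2 + u) p.1 - f p.2 p.1‖ₑ ^ q) ?_
      have : Measurable fun p : Ω × ℝ => f (p.2 + u) p.1 :=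
        hf.comp (f := fun p : Ω × ℝ => (p.2 + u, p.1)) (by fun_prop)
      fun_prop)
    (Eventually.of_forall fun u => ae_of_all _ fun ω => by
      have h1 := hfω ω
      have e : ∫⁻ a, ‖f a ω‖ₑ ^ q = ∫⁻ a, ‖f (a + u) ω‖ₑ ^ q :=
        (lintegral_add_right_eq_self (fun a => ‖f a ω‖ₑ ^ q) u).symm
      calc ∫⁻ a, ‖f (a + u) ω - f a ω‖ₑ ^ q
          ≤ ∫⁻ a, 2 ^ (q - 1) * (‖f (a + u) ω‖ₑ ^ q + ‖f a ω‖ₑ ^ q) :=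
            lintegral_mono fun a => enorm_sub_rpow_le _ _ hq
        _ = 2 ^ (q - 1) * ((∫⁻ a, ‖f (a + u) ω‖ₑ ^ q) + ∫⁻ a, ‖f a ω‖ₑ ^ q) := by
            rw [lintegral_const_mul _ (by fun_prop), lintegral_add_right _ (by fun_prop)]
        _ = _ := by rw [← e])
    (by
      rw [lintegral_const_mul _ (by fun_prop), lintegral_add_left (by fun_prop)]
      exact ENNReal.mul_ne_top (ENNReal.rpow_ne_top_of_nonneg (by linarith) (by norm_num))
        (ENNReal.add_ne_top.2 ⟨hfin, hfin⟩))
    (by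
      rw [ae_iff]
      have h := ae_lt_top hm1 hfin
      refine measure_mono_null ?_ (ae_iff.1 h)
      intro ω hω h2
      exact hω (tendsto_lintegral_translate_sub (hfω ω) hq h2.ne))
  simpa using this

lemma tsum_setLIntegral_Ico_add {h : ℝ} (hh : 0 < h) (a : ℝ) (F : ℝ → ℝ≥0∞) :
    ∑' k : ℤ, ∫⁻ u in Set.Ico 0 h, F (a + k * h + u) = ∫⁻ s, F s := by
  have e : ∀ k : ℤ, ∫⁻ u in Set.Ico 0 h, F (a + k * h + u) =
      ∫⁻ s in Set.Ico (a + k • h) (a + (k + 1) • h), F s := fun k => by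
    have := (measurePreserving_add_left volume (a + k * h)).setLIntegral_comp_preimage_emb
      (measurableEmbedding_addLeft _) F (Set.Ico (a + k • h) (a + (k + 1) • h))
    rw [← this]
    congr 2
    ext u
    simp only [Set.mem_Ico, Set.mem_preimage, zsmul_eq_mul, Int.cast_add, Int.cast_one]
    constructor <;> rintro ⟨h1, h2⟩ <;> constructor <;> linarith
  simp only [e]
  rw [← lintegral_iUnion (fun k => measurableSet_Ico) (Set.pairwise_disjoint_Ico_add_zsmul a h),
    iUnion_Ico_add_zsmul hh a, setLIntegral_univ]

/-- Existence of a good grid for the approximation of a measurable process by its values on the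
grid. -/
lemma exists_grid {f : ℝ → Ω → ℝ} (hf : Measurable (Function.uncurry f))
    {q : ℝ} (hq : 1 ≤ q) (hfin : ∫⁻ ω, ∫⁻ a, ‖f a ω‖ₑ ^ q ∂volume ∂P ≠ ∞) {ε : ℝ≥0∞} (hε : ε ≠ 0)
    {good : ℝ → Prop} (hgood : ∀ᵐ s, good s) :
    ∃ h : ℝ, 0 < h ∧ ∃ a : ℝ, 0 < a ∧ a < h ∧ (∀ k : ℤ, good (a + k * h)) ∧
      ∑' k : ℤ, ∫⁻ u in Set.Ico 0 h, ∫⁻ ω, ‖f (a + k * h + u) ω - f (a + k * h) ω‖ₑ ^ q ∂P ≤ ε := by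
  set D : ℝ → ℝ → ℝ≥0∞ := fun x u => ∫⁻ ω, ‖f (x + u) ω - f x ω‖ₑ ^ q ∂P with hD
  have hDm : Measurable (Function.uncurry D) := by
    refine Measurable.lintegral_prod_right'
      (f := fun p : (ℝ × ℝ) × Ω => ‖f (p.1.1 + p.1.2) p.2 - f p.1.1 p.2‖ₑ ^ q) ?_
    have h1 : Measurable fun p : (ℝ × ℝ) × Ω => f (p.1.1 + p.1.2) p.2 :=
      hf.comp (f := fun p : (ℝ × ℝ) × Ω => (p.1.1 + p.1.2, p.2)) (by fun_prop)
    have h2 : Measurable fun p : (ℝ × ℝ) × Ω => f p.1.1 p.2 :=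
      hf.comp (f := fun p : (ℝ × ℝ) × Ω => (p.1.1, p.2)) (by fun_prop)
    fun_prop
  have hw : Tendsto (fun u => ∫⁻ x, D x u) (𝓝 0) (𝓝 0) := by
    refine (tendsto_lintegral_lintegral_translate_sub hf hq hfin).congr fun u => ?_
    refine lintegral_lintegral_swap (Measurable.aemeasurable ?_)
    have h1 : Measurable fun p : Ω × ℝ => f (p.2 + u) p.1 :=
      hf.comp (f := fun p : Ω × ℝ => (p.2 + u, p.1)) (by fun_prop)
    have h2 : Measurable fun p : Ω × ℝ => f p.2 p.1 := hf.comp measurable_swap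
    simp only [Function.uncurry_def]
    fun_prop
  have hev : ∀ᶠ u in 𝓝 (0 : ℝ), ∫⁻ x, D x u ≤ ε :=
    (hw.eventually_lt_const (pos_iff_ne_zero.2 hε)).mono fun u hu => hu.le
  obtain ⟨h, hh, hball⟩ := Metric.eventually_nhds_iff.1 hev
  refine ⟨h, hh, ?_⟩
  -- Φ(a) is the sampling error of the grid with offset a. Tiling the line by cells of length h, its
  -- integral over the offsets in [0, h) becomes an integral of translation errors with shift below
  -- h. Hence the mean of Φ is at most ε, and some offset outside any given null set does no worse
  -- than the mean.
  set Φ : ℝ → ℝ≥0∞ := fun a => ∑' k : ℤ, ∫⁻ u in Set.Ico 0 h, D (a + k * h) u with hΦ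
  have hGm : Measurable fun x => ∫⁻ u in Set.Ico 0 h, D x u :=
    Measurable.lintegral_prod_right' (f := Function.uncurry D) hDm
  have hΦm : ∀ k : ℤ, Measurable fun a : ℝ => ∫⁻ u in Set.Ico 0 h, D (a + k * h) u := fun k =>
    hGm.comp (by fun_prop)
  have hint : ∫⁻ a in Set.Ico 0 h, Φ a ≤ ENNReal.ofReal h * ε := by
    simp only [hΦ]
    rw [lintegral_tsum fun k => (hΦm k).aemeasurable]
    have e := tsum_setLIntegral_Ico_add hh 0 fun x => ∫⁻ u in Set.Ico 0 h, D x u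
    simp only [zero_add] at e
    simp only [add_comm _ ((_ : ℤ) * h : ℝ)]
    rw [e, lintegral_lintegral_swap hDm.aemeasurable]
    calc ∫⁻ u in Set.Ico 0 h, ∫⁻ x, D x u ≤ ∫⁻ u in Set.Ico 0 h, ε := by
          refine setLIntegral_mono' measurableSet_Ico fun u hu => hball ?_
          rw [Real.dist_eq, sub_zero, abs_of_nonneg hu.1]; exact hu.2
      _ = _ := by rw [setLIntegral_const, Real.volume_Ico, sub_zero, mul_comm]
  have hgood' : ∀ᵐ a : ℝ, ∀ k : ℤ, good (a + k * h) := by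
    rw [ae_all_iff]
    intro k
    exact (quasiMeasurePreserving_add_right volume (k * h)).ae hgood
  set μ := (volume : Measure ℝ).restrict (Set.Ico 0 h) with hμ
  have hμ0 : μ ≠ 0 := by
    rw [hμ, Ne, Measure.restrict_eq_zero, Real.volume_Ico]; simpa using hh
  have : IsFiniteMeasure μ := ⟨by rw [hμ, Measure.restrict_apply_univ]; simp⟩
  -- Offset 0 is discarded because the grid step process has a nondegenerate first interval [0, a).
  have hN : μ {a | ¬ (0 < a ∧ a < h ∧ ∀ k : ℤ, good (a + k * h))} = 0 := by
    rw [← ae_iff]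
    have h0 : ∀ᵐ a : ℝ, a ≠ 0 := by simp [ae_iff]
    filter_upwards [ae_restrict_mem measurableSet_Ico, ae_restrict_of_ae h0,
      ae_restrict_of_ae hgood'] with a h1 h2 h3
    exact ⟨lt_of_le_of_ne h1.1 h2.symm, h1.2, h3⟩
  obtain ⟨a, haN, ha⟩ := exists_notMem_null_le_laverage hμ0
    (Measurable.tsum hΦm : Measurable Φ).aemeasurable hN
  have haN : 0 < a ∧ a < h ∧ ∀ k : ℤ, good (a + k * h) := by simpa using haN
  refine ⟨a, haN.1, haN.2.1, haN.2.2, ha.trans ?_⟩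
  rw [laverage_eq, hμ, Measure.restrict_apply_univ, Real.volume_Ico, sub_zero]
  exact ENNReal.div_le_of_le_mul (by rw [mul_comm]; exact hint)

end Translation

/-! ### Step processes on a shifted grid. -/

section Grid
variable {Ω : Type*}

lemma StepProc.eval_of_mem {ℱ : ℝ≥0 → MeasurableSpace Ω} {t₀ t : ℝ≥0} (S : StepProc ℱ t₀ t)
    {i : Fin S.n} {s : ℝ≥0} (hs : s ∈ Set.Ico (S.part i.castSucc) (S.part i.succ)) (ω : Ω) :
    S.eval s ω = S.coef i ω := by
  rw [StepProc.eval, Finset.sum_eq_single i]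
  · exact Set.indicator_of_mem hs _
  · intro j _ hji
    refine Set.indicator_of_notMem (fun hj => ?_) _
    rcases lt_or_gt_of_ne hji with h | h
    · have : S.part j.succ ≤ S.part i.castSucc :=
        S.strictMono_part.monotone (Fin.succ_le_castSucc_iff.2 h)
      exact ((hj.2.trans_le this).trans_le hs.1).false
    · have : S.part i.succ ≤ S.part j.castSucc :=
        S.strictMono_part.monotone (Fin.succ_le_castSucc_iff.2 h)
      exact ((hs.2.trans_le this).trans_le hj.1).false
  · simp

/-- The step process with values `c k` on `[a + k h, a + (k + 1) h)` for `k < K`, and `0` on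
`[0, a)`. -/
noncomputable def gridStepProc (ℱ : ℝ≥0 → MeasurableSpace Ω) {a h : ℝ≥0} (ha : 0 < a) (hh : 0 < h)
    (K : ℕ) (c : ℕ → Ω → ℝ) (hc : ∀ k : ℕ, Measurable[ℱ (a + k * h)] (c k)) :
    StepProc ℱ 0 (a + K * h) where
  n := K + 1
  part i := if (i : ℕ) = 0 then 0 else a + ((i : ℕ) - 1 : ℕ) * h
  strictMono_part i j hij := by
    have hij' : (i : ℕ) < j := hij
    have hj : (j : ℕ) ≠ 0 := by omega
    simp only [hj, if_false]
    split_ifs with hi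
    · exact ha.trans_le le_self_add
    · have : ((i : ℕ) - 1 : ℕ) < ((j : ℕ) - 1 : ℕ) := by omega
      gcongr
  part_zero := by simp
  part_last := by simp
  coef i := if (i : ℕ) = 0 then 0 else c ((i : ℕ) - 1)
  measurable_coef i := by
    by_cases hi : (i : ℕ) = 0
    · simp only [hi, if_true]; exact measurable_const
    · have h1 := hc ((i : ℕ) - 1)
      have h2 : (if (i.castSucc : ℕ) = 0 then 0 else a + ((i.castSucc : ℕ) - 1 : ℕ) * h) =
          a + ((i : ℕ) - 1 : ℕ) * h := if_neg hi
      simp only [hi, if_false]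
      rw [h2]
      exact h1

lemma gridStepProc_eval_of_lt {ℱ : ℝ≥0 → MeasurableSpace Ω} {a h : ℝ≥0} (ha : 0 < a) (hh : 0 < h)
    (K : ℕ) (c : ℕ → Ω → ℝ) (hc : ∀ k : ℕ, Measurable[ℱ (a + k * h)] (c k)) {s : ℝ≥0} (hs : s < a)
    (ω : Ω) : (gridStepProc ℱ ha hh K c hc).eval s ω = 0 :=
  (gridStepProc ℱ ha hh K c hc).eval_of_mem (i := (0 : Fin (K + 1)))
    (by simpa [gridStepProc] using hs) ω

lemma gridStepProc_eval_of_mem {ℱ : ℝ≥0 → MeasurableSpace Ω} {a h : ℝ≥0} (ha : 0 < a) (hh : 0 < h)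
    (K : ℕ) (c : ℕ → Ω → ℝ) (hc : ∀ k : ℕ, Measurable[ℱ (a + k * h)] (c k)) {s : ℝ≥0} {k : ℕ}
    (hk : k < K) (hs : s ∈ Set.Ico (a + k * h) (a + (k + 1 : ℕ) * h))
    (ω : Ω) : (gridStepProc ℱ ha hh K c hc).eval s ω = c k ω :=
  (gridStepProc ℱ ha hh K c hc).eval_of_mem (i := (⟨k + 1, by omega⟩ : Fin (K + 1)))
    (by simpa [gridStepProc] using hs) ω

end Grid

/-! ### Density of step processes among adapted processes. -/

section Approximation
variable {Ω : Type*} [mΩ : MeasurableSpace Ω] {P : Measure Ω} [IsProbabilityMeasure P]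
  {m : ℕ} {W : Fin m → ℝ≥0 → Ω → ℝ}

omit [IsProbabilityMeasure P] in
lemma StepProc.aemeasurable_uncurry_eval (hW : ∀ j t, Measurable (W j t)) {t : ℝ≥0}
    (S : StepProc (augmentedFiltration W P) 0 t) (μ : Measure ℝ≥0) [SFinite μ] :
    AEMeasurable (Function.uncurry S.eval) (μ.prod P) := by
  have h : ∀ i : Fin S.n, AEMeasurable (fun p : ℝ≥0 × Ω =>
      (Set.Ico (S.part i.castSucc) (S.part i.succ)).indicator (fun _ => S.coef i p.2) p.1)
      (μ.prod P) := fun i => by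
    have h1 : AEMeasurable (fun p : ℝ≥0 × Ω => S.coef i p.2) (μ.prod P) :=
      (aemeasurable_of_augmentedFiltration hW (S.measurable_coef i)).comp_snd
    have h2 := h1.indicator (s := Set.Ico (S.part i.castSucc) (S.part i.succ) ×ˢ Set.univ)
      (measurableSet_Ico.prod MeasurableSet.univ)
    convert! h2 using 1
    ext p
    by_cases hp : p.1 ∈ Set.Ico (S.part i.castSucc) (S.part i.succ) <;> simp [Set.indicator, hp]
  exact Finset.aemeasurable_fun_sum Finset.univ fun i _ => h i

/-- Step processes are dense in the adapted processes. -/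
lemma exists_stepProc_approx (hW : ∀ j t, Measurable (W j t)) {T : ℝ≥0}
    {X : ℝ≥0 → Ω → ℝ} (hXa : ∀ s, Measurable[augmentedFiltration W P s] (X s))
    (hXm : AEMeasurable (Function.uncurry X) ((lebesgueTime.restrict (Set.Icc 0 T)).prod P))
    {q : ℝ} (hq : 1 ≤ q)
    (hfin : ∫⁻ ω, ∫⁻ s in Set.Icc 0 T, ‖X s ω‖ₑ ^ q ∂lebesgueTime ∂P ≠ ∞)
    {ε : ℝ≥0∞} (hε : ε ≠ 0) :
    ∃ S : StepProc (augmentedFiltration W P) 0 T,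
      ∫⁻ ω, ∫⁻ s in Set.Icc 0 T, ‖S.eval s ω - X s ω‖ₑ ^ q ∂lebesgueTime ∂P ≤ ε := by
  have hq0 : 0 < q := by linarith
  set X' := hXm.mk with hX'
  have hX'm : Measurable X' := hXm.measurable_mk
  have hXX' : ∀ᵐ s ∂lebesgueTime.restrict (Set.Icc 0 T), ∀ᵐ ω ∂P, X s ω = X' (s, ω) :=
    Measure.ae_ae_of_ae_prod hXm.ae_eq_mk
  -- A jointly measurable modification, extended by zero to the whole line so that translations make
  -- sense.
  set f : ℝ → Ω → ℝ := fun s ω => (Set.Icc (0 : ℝ) T).indicator (fun s => X' (s.toNNReal, ω)) s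
    with hf
  have hfm : Measurable (Function.uncurry f) := by
    have h1 : Measurable fun p : ℝ × Ω => X' (p.1.toNNReal, p.2) := hX'm.comp (by fun_prop)
    have h2 := h1.indicator (s := Set.Icc (0 : ℝ) T ×ˢ (Set.univ : Set Ω))
      (measurableSet_Icc.prod MeasurableSet.univ)
    convert! h2 using 1
    ext p
    simp only [Function.uncurry, hf, Set.indicator, Set.mem_prod, Set.mem_univ, and_true]
  have hf_coe : ∀ s : ℝ≥0, s ≤ T → ∀ ω, f s ω = X' (s, ω) := fun s hs ω => by
    have : (s : ℝ) ∈ Set.Icc (0 : ℝ) T := ⟨s.2, by exact_mod_cast hs⟩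
    simp [hf, Set.indicator_of_mem this]
  have hXf : ∀ᵐ s ∂lebesgueTime.restrict (Set.Icc 0 T), ∀ᵐ ω ∂P, X s ω = f s ω := by
    filter_upwards [hXX', ae_restrict_mem measurableSet_Icc] with s hs hsT
    filter_upwards [hs] with ω hω
    rw [hω, hf_coe s hsT.2]
  have hffin : ∫⁻ ω, ∫⁻ a, ‖f a ω‖ₑ ^ q ∂volume ∂P ≠ ∞ := by
    have hm : AEMeasurable (Function.uncurry fun (ω : Ω) (s : ℝ≥0) => ‖X s ω‖ₑ ^ q)
        (P.prod (lebesgueTime.restrict (Set.Icc 0 T))) := by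
      have := hXm.prod_swap
      exact (this.enorm.pow_const q)
    rw [lintegral_lintegral_swap hm] at hfin
    have e1 : ∀ ω, ∫⁻ a, ‖f a ω‖ₑ ^ q = ∫⁻ s in Set.Icc 0 T, ‖f s ω‖ₑ ^ q ∂lebesgueTime := fun ω => by
      rw [setLIntegral_lebesgueTime_Icc 0 T fun s => ‖f s ω‖ₑ ^ q,
        ← lintegral_indicator measurableSet_Icc]
      refine lintegral_congr fun a => ?_
      by_cases ha : a ∈ Set.Icc (0 : ℝ) T
      · rw [Set.indicator_of_mem (by simpa using ha)]
      · have h0 : f a ω = 0 := Set.indicator_of_notMem ha _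
        rw [h0, Set.indicator_of_notMem (by simpa using ha)]
        simp [hq0]
    simp only [e1]
    rw [lintegral_lintegral_swap (Measurable.aemeasurable (by
      have : Measurable fun p : Ω × ℝ≥0 => f p.2 p.1 :=
        hfm.comp (f := fun p : Ω × ℝ≥0 => ((p.2 : ℝ), p.1)) (by fun_prop)
      simp only [Function.uncurry_def]
      fun_prop))]
    refine ne_of_eq_of_ne (lintegral_congr_ae ?_) hfin
    filter_upwards [hXf] with s hs
    refine lintegral_congr_ae ?_
    filter_upwards [hs] with ω hω
    rw [hω]
  -- The modification f need not be adapted, so the step process must take its values from X. The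
  -- grid therefore has to avoid the null set of times at which X and f differ with positive
  -- probability.
  have hgood : ∀ᵐ s : ℝ, s ∈ Set.Icc (0 : ℝ) T → ∀ᵐ ω ∂P, X s.toNNReal ω = f s ω := by
    rw [← ae_restrict_iff' measurableSet_Icc]
    have himg : Set.Icc (0 : ℝ) T = (fun t : ℝ≥0 => (t : ℝ)) '' Set.Icc 0 T := by
      rw [NNReal.image_coe_Icc]; rfl
    rw [himg, ← map_restrict_lebesgueTime, measurableEmbedding_nnreal_coe.ae_map_iff]
    simpa using hXf
  obtain ⟨h, hh, a, ha, hah, hgrid, hsum⟩ := exists_grid hfm hq hffin hε hgood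
  lift h to ℝ≥0 using hh.le
  lift a to ℝ≥0 using ha.le
  have hh' : 0 < h := by exact_mod_cast hh
  have ha' : 0 < a := by exact_mod_cast ha
  obtain ⟨K, hK⟩ : ∃ K : ℕ, T < K * h := by
    obtain ⟨K, hK⟩ := exists_nat_gt (T / h)
    exact ⟨K, (div_lt_iff₀ hh').1 hK⟩
  set S₀ := gridStepProc (augmentedFiltration W P) ha' hh' K (fun k => X (a + k * h))
    (fun k => hXa _) with hS₀
  have hTK : T ≤ a + K * h := hK.le.trans le_add_self
  obtain ⟨S, hS, -⟩ := S₀.exists_restrict hTK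
  refine ⟨S, ?_⟩
  have hdiff : AEMeasurable (Function.uncurry fun (ω : Ω) (s : ℝ≥0) => ‖S.eval s ω - X s ω‖ₑ ^ q)
      (P.prod (lebesgueTime.restrict (Set.Icc 0 T))) :=
    (((S.aemeasurable_uncurry_eval hW _).sub hXm).prod_swap.enorm.pow_const q)
  rw [lintegral_lintegral_swap hdiff]
  -- The right endpoint is left out because the restricted step process is known to agree with the
  -- grid process only before T.
  set e : ℝ → ℝ≥0∞ := (Set.Ico (0 : ℝ) T).indicator
    fun s => ∫⁻ ω, ‖S.eval s.toNNReal ω - f s ω‖ₑ ^ q ∂P with he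
  calc ∫⁻ s in Set.Icc 0 T, ∫⁻ ω, ‖S.eval s ω - X s ω‖ₑ ^ q ∂P ∂lebesgueTime
      = ∫⁻ s in Set.Icc 0 T, ∫⁻ ω, ‖S.eval (s : ℝ).toNNReal ω - f s ω‖ₑ ^ q ∂P ∂lebesgueTime := by
        refine lintegral_congr_ae ?_
        filter_upwards [hXf] with s hs
        refine lintegral_congr_ae ?_
        filter_upwards [hs] with ω hω
        rw [hω, Real.toNNReal_coe]
    _ = ∫⁻ s, e s := by
        rw [setLIntegral_lebesgueTime_Icc 0 T
          fun s => ∫⁻ ω, ‖S.eval s.toNNReal ω - f s ω‖ₑ ^ q ∂P, he,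
          lintegral_indicator measurableSet_Ico]
        exact (setLIntegral_congr Ico_ae_eq_Icc).symm
    _ = ∑' k : ℤ, ∫⁻ u in Set.Ico 0 (h : ℝ), e (a + k * h + u) :=
        (tsum_setLIntegral_Ico_add hh _ _).symm
    _ ≤ ∑' k : ℤ, ∫⁻ u in Set.Ico 0 (h : ℝ),
          ∫⁻ ω, ‖f (a + k * h + u) ω - f (a + k * h) ω‖ₑ ^ q ∂P := by
        refine ENNReal.tsum_le_tsum fun k => setLIntegral_mono' measurableSet_Ico fun u hu => ?_
        by_cases hmem : (a + k * h + u : ℝ) ∈ Set.Ico (0 : ℝ) T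
        swap
        · rw [he, Set.indicator_of_notMem hmem]; exact zero_le
        rw [he, Set.indicator_of_mem hmem]
        refine lintegral_mono_ae ?_
        set s : ℝ≥0 := (a + k * h + u : ℝ).toNNReal with hs
        have hsc : (s : ℝ) = a + k * h + u := Real.coe_toNNReal _ hmem.1
        have hsT : s < T := by rw [← NNReal.coe_lt_coe, hsc]; exact hmem.2
        -- For k < 0 the cell lies before a, where the step process is 0; since a < h, the grid
        -- point a + kh is negative, so f vanishes there too.
        rcases lt_or_ge k 0 with hk | hk
        · have hk' : (k : ℝ) ≤ -1 := by exact_mod_cast Int.le_sub_one_of_lt hk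
          have hkh : (k : ℝ) * h ≤ -1 * h := mul_le_mul_of_nonneg_right hk' h.2
          have hsa : s < a := by
            rw [← NNReal.coe_lt_coe, hsc]; linarith [hu.2]
          have h0 : ∀ ω, f (a + k * h) ω = 0 := fun ω =>
            Set.indicator_of_notMem (fun hm => by linarith [hm.1]) _
          refine ae_of_all _ fun ω => ?_
          have h1 : S.eval s ω = 0 := by
            rw [hS s hsT, gridStepProc_eval_of_lt ha' hh' K _ _ hsa]
          rw [h0, h1, ← enorm_neg]
          simp
        · lift k to ℕ using hk
          simp only [Int.cast_natCast] at *
          have hkc : ((a + k * h : ℝ≥0) : ℝ) = a + k * h := by push_cast; rfl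
          have hsmem : s ∈ Set.Ico (a + k * h) (a + (k + 1 : ℕ) * h) := by
            constructor
            · rw [← NNReal.coe_le_coe, hsc]; push_cast; linarith [hu.1]
            · rw [← NNReal.coe_lt_coe, hsc]; push_cast; linarith [hu.2]
          have hkK : k < K := by
            by_contra hcon
            have h1 : (K : ℝ≥0) * h ≤ k * h := by
              have : (K : ℝ≥0) ≤ k := by exact_mod_cast not_lt.1 hcon
              gcongr
            exact (hsT.trans hK).not_ge (h1.trans (le_add_self.trans hsmem.1))
          have hkT : (a + k * h : ℝ) ∈ Set.Icc (0 : ℝ) T := by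
            refine ⟨by positivity, ?_⟩
            have := hmem.2
            linarith [hu.1]
          have hg := hgrid k
          simp only [Int.cast_natCast] at hg
          filter_upwards [hg hkT] with ω hω
          have h1 : S.eval s ω = f (a + k * h) ω := by
            rw [hS s hsT, gridStepProc_eval_of_mem ha' hh' K _ _ hkK hsmem, ← hω, ← hkc,
              Real.toNNReal_coe]
          rw [h1, ← enorm_neg, neg_sub]
    _ ≤ ε := hsum

end Approximation

/-! ### Almost sure uniqueness of the Itô integral. -/

section Uniqueness
variable {Ω : Type*} [mΩ : MeasurableSpace Ω] {P : Measure Ω} [IsProbabilityMeasure P]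
  {m : ℕ} {W : Fin m → ℝ≥0 → Ω → ℝ}

lemma tendsto_measure_lt_of_ae_tendsto_zero {Z : ℕ → Ω → ℝ≥0∞} (hZ : ∀ n, AEMeasurable (Z n) P)
    (h : ∀ᵐ ω ∂P, Tendsto (fun n => Z n ω) atTop (𝓝 0)) {N : ℝ≥0∞} (hN : N ≠ 0) :
    Tendsto (fun n => P {ω | N < Z n ω}) atTop (𝓝 0) := by
  have hs : ∀ n, NullMeasurableSet {ω | N < Z n ω} P := fun n =>
    nullMeasurableSet_lt aemeasurable_const (hZ n)
  have key := tendsto_lintegral_of_dominated_convergence' (μ := P)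
    (F := fun n => {ω | N < Z n ω}.indicator 1) (f := fun _ => 0) (fun _ => 1)
    (fun n => (aemeasurable_const (b := (1 : ℝ≥0∞))).indicator₀ (hs n))
    (fun n => ae_of_all _ fun ω => Set.indicator_le (fun _ _ => le_rfl) ω)
    (by simp)
    (by
      filter_upwards [h] with ω hω
      refine tendsto_const_nhds.congr' ?_
      filter_upwards [hω.eventually_lt_const (pos_iff_ne_zero.2 hN)] with n hn
      exact (Set.indicator_of_notMem (s := {ω | N < Z n ω}) (fun h' => lt_asymm hn h') _).symm)
  simpa only [lintegral_indicator_one₀ (hs _), lintegral_zero] using key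

lemma enorm_euclideanSpace_single {j : Fin m} (x : ℝ) :
    ‖(EuclideanSpace.single j x : EuclideanSpace ℝ (Fin m))‖ₑ = ‖x‖ₑ := by
  rw [← ofReal_norm, ← ofReal_norm, PiLp.norm_single]

lemma euclideanSpace_single_sub {j : Fin m} (x y : ℝ) :
    (EuclideanSpace.single j (x - y) : EuclideanSpace ℝ (Fin m)) =
      EuclideanSpace.single j x - EuclideanSpace.single j y := by
  ext i
  by_cases h : i = j <;> simp [h]

/-- The integrals of two step processes are close in probability if the step processes are. -/
lemma tendstoInMeasure_integral_sub (hW : IsBrownianMotion W P) (j : Fin m) {t : ℝ≥0}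
    {S S' : ℕ → StepProc (augmentedFiltration W P) 0 t}
    (h : ∀ᵐ ω ∂P, Tendsto (fun n => ∫⁻ s in Set.Icc 0 t,
      ‖(S n).eval s ω - (S' n).eval s ω‖ₑ ^ (2 : ℝ) ∂lebesgueTime) atTop (𝓝 0)) :
    TendstoInMeasure P (fun n ω => (S n).integral (W j) ω - (S' n).integral (W j) ω) atTop
      (fun _ => 0) := by
  refine tendstoInMeasure_of_ne_top fun ε hε hεt => ?_
  set Z : ℕ → Ω → ℝ≥0∞ := fun n ω => ∫⁻ s in Set.Icc 0 t,
      ‖(S n).eval s ω - (S' n).eval s ω‖ₑ ^ (2 : ℝ) ∂lebesgueTime with hZ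
  have hZm : ∀ n, AEMeasurable (Z n) P := fun n =>
    ((((S n).aemeasurable_uncurry_eval hW.measurable _).sub
      ((S' n).aemeasurable_uncurry_eval hW.measurable _)).prod_swap.enorm.pow_const
        (2 : ℝ)).lintegral_prod_right'
  -- No moments of the step processes are available here; the truncation bound needs only their
  -- energy.
  have hbd : ∀ n (N : ℝ≥0∞), P {ω | ε ≤ edist ((S n).integral (W j) ω - (S' n).integral (W j) ω) 0} ≤
      N / ε ^ (2 : ℝ) + P {ω | N < Z n ω} := fun n N => by
    obtain ⟨G, hG⟩ := (S n).isElementary j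
    obtain ⟨G', hG'⟩ := (S' n).isElementary j
    obtain ⟨G'', hD⟩ := hG.sub hG'
    have := hD.measure_ge_le hW t hε.ne' hεt N
    have e : ∀ s ω, ‖(EuclideanSpace.single j ((S n).eval s ω) : EuclideanSpace ℝ (Fin m)) -
        EuclideanSpace.single j ((S' n).eval s ω)‖ₑ = ‖(S n).eval s ω - (S' n).eval s ω‖ₑ :=
      fun s ω => by rw [← enorm_euclideanSpace_single (j := j), euclideanSpace_single_sub]
    simp only [e, StepProc.process_eq_integral] at this
    simpa only [edist_zero_right] using this
  refine ENNReal.tendsto_atTop_zero.2 fun δ hδ => ?_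
  obtain ⟨N, hN0, hN⟩ : ∃ N : ℝ≥0∞, N ≠ 0 ∧ N / ε ^ (2 : ℝ) ≤ δ / 2 := by
    refine ⟨δ / 2 * ε ^ (2 : ℝ), ?_, ?_⟩
    · exact mul_ne_zero (ENNReal.half_pos hδ.ne').ne' (ENNReal.rpow_pos hε hεt).ne'
    · rw [ENNReal.mul_div_cancel_right (ENNReal.rpow_pos hε hεt).ne'
        (ENNReal.rpow_ne_top_of_nonneg (by norm_num) hεt)]
  obtain ⟨n₀, hn₀⟩ := ENNReal.tendsto_atTop_zero.1
    (tendsto_measure_lt_of_ae_tendsto_zero hZm h hN0) (δ / 2) (ENNReal.half_pos hδ.ne')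
  refine ⟨n₀, fun n hn => (hbd n N).trans ?_⟩
  exact (add_le_add hN (hn₀ n hn)).trans_eq (ENNReal.add_halves δ)

/-- The Itô integral is unique. -/
lemma IsItoIntegral.ae_eq (hW : IsBrownianMotion W P) {j : Fin m} {t : ℝ≥0} {X : ℝ≥0 → Ω → ℝ}
    (hX : ∀ᵐ ω ∂P, AEMeasurable (fun s => X s ω) (lebesgueTime.restrict (Set.Icc 0 t)))
    {ξ ξ' : Ω → ℝ} (h : IsItoIntegral (augmentedFiltration W P) P (W j) 0 t X ξ)
    (h' : IsItoIntegral (augmentedFiltration W P) P (W j) 0 t X ξ') : ξ =ᵐ[P] ξ' := by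
  obtain ⟨S, hS, hξ⟩ := h
  obtain ⟨S', hS', hξ'⟩ := h'
  have hev : ∀ (S : StepProc (augmentedFiltration W P) 0 t) ω, Measurable fun s => S.eval s ω :=
    fun S ω => Finset.measurable_fun_sum _ fun i _ =>
      measurable_const.indicator measurableSet_Ico
  have hD := tendstoInMeasure_integral_sub hW j (S := S) (S' := S') (by
    filter_upwards [hS, hS', hX] with ω h1 h2 hX
    have h3 : Tendsto (fun n => (2 : ℝ≥0∞) ^ ((2 : ℝ) - 1) *
        ((∫⁻ s in Set.Icc 0 t, ‖(S n).eval s ω - X s ω‖ₑ ^ (2 : ℝ) ∂lebesgueTime) +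
        ∫⁻ s in Set.Icc 0 t, ‖(S' n).eval s ω - X s ω‖ₑ ^ (2 : ℝ) ∂lebesgueTime)) atTop
        (𝓝 ((2 : ℝ≥0∞) ^ ((2 : ℝ) - 1) * (0 + 0))) :=
      ENNReal.Tendsto.const_mul (h1.add h2) (Or.inr (by norm_num))
    rw [add_zero, mul_zero] at h3
    refine tendsto_of_tendsto_of_tendsto_of_le_of_le tendsto_const_nhds h3
      (fun n => zero_le) fun n => ?_
    have m1 := (hev (S n) ω).aemeasurable (μ := lebesgueTime.restrict (Set.Icc 0 t))
    have m2 := (hev (S' n) ω).aemeasurable (μ := lebesgueTime.restrict (Set.Icc 0 t))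
    dsimp only
    rw [← lintegral_add_left' (by fun_prop), ← lintegral_const_mul'' _ (by fun_prop)]
    refine lintegral_mono fun s => ?_
    have := enorm_sub_rpow_le ((S n).eval s ω - X s ω) ((S' n).eval s ω - X s ω)
      (q := 2) (by norm_num)
    rwa [sub_sub_sub_cancel_right] at this)
  -- Three nested subsequences give almost sure convergence of the difference and of both integrals
  -- along one common subsequence.
  obtain ⟨φ, hφ, h1⟩ := hD.exists_seq_tendsto_ae
  obtain ⟨ψ, hψ, h2⟩ := (hξ.comp hφ.tendsto_atTop).exists_seq_tendsto_ae
  obtain ⟨χ, hχ, h3⟩ := (hξ'.comp (hφ.comp hψ).tendsto_atTop).exists_seq_tendsto_ae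
  filter_upwards [h1, h2, h3] with ω h1 h2 h3
  have h4 := (h2.comp hχ.tendsto_atTop).sub h3
  have h5 := h1.comp (hψ.comp hχ).tendsto_atTop
  exact sub_eq_zero.1 (tendsto_nhds_unique h4 h5)

end Uniqueness

/-! ### Existence of a continuous Itô integral process. -/

lemma StepProc.continuous_process {Ω : Type*} {ℱ : ℝ≥0 → MeasurableSpace Ω} {t₀ t : ℝ≥0}
    (S : StepProc ℱ t₀ t) {B : ℝ≥0 → Ω → ℝ} {ω : Ω} (hB : Continuous fun s => B s ω) :
    Continuous fun s => S.process B s ω := by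
  have h : ∀ a : ℝ≥0, Continuous fun s => B (min a s) ω := fun a =>
    hB.comp (continuous_const.min continuous_id)
  exact continuous_finsetSum _ fun i _ => continuous_const.mul ((h _).sub (h _))

/-- A sequence dense in `[0, T]`. -/
lemma exists_dense_sequence (T : ℝ≥0) : ∃ d : ℕ → ℝ≥0, (∀ i, d i ≤ T) ∧
    ∀ (f : ℝ≥0 → ℝ), ContinuousOn f (Set.Icc 0 T) → ∀ s : Set ℝ, IsClosed s → (∀ i, f (d i) ∈ s) →
      ∀ t ≤ T, f t ∈ s := by
  have : Nonempty (Set.Icc 0 T) := ⟨⟨0, zero_le, zero_le⟩⟩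
  refine ⟨fun i => TopologicalSpace.denseSeq (Set.Icc 0 T) i,
    fun i => (TopologicalSpace.denseSeq (Set.Icc 0 T) i).2.2, fun f hf s hs h t ht => ?_⟩
  have hc : IsClosed {x : Set.Icc 0 T | f x ∈ s} := hs.preimage hf.domRestrict
  exact (TopologicalSpace.denseRange_denseSeq (Set.Icc 0 T)).induction_on
    (p := fun x : Set.Icc 0 T => f x ∈ s) ⟨t, zero_le, ht⟩ hc h

/-- Hölder's inequality on a finite measure space. It links the L^q approximation to the pathwise L²
convergence demanded by `IsItoIntegral`. -/
lemma tendsto_lintegral_sq_of_tendsto_lintegral_rpow {α : Type*} [MeasurableSpace α]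
    {μ : Measure α} [IsFiniteMeasure μ] {g : ℕ → α → ℝ} (hg : ∀ n, AEMeasurable (g n) μ) {q : ℝ}
    (hq : 2 ≤ q) (h : Tendsto (fun n => ∫⁻ x, ‖g n x‖ₑ ^ q ∂μ) atTop (𝓝 0)) :
    Tendsto (fun n => ∫⁻ x, ‖g n x‖ₑ ^ (2 : ℝ) ∂μ) atTop (𝓝 0) := by
  have hq0 : 0 < q := by linarith
  have h1 : Tendsto (fun n => (eLpNorm' (g n) q μ * μ Set.univ ^ (1 / (2 : ℝ) - 1 / q)) ^ (2 : ℝ))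
      atTop (𝓝 0) := by
    have h2 : Tendsto (fun n => eLpNorm' (g n) q μ) atTop (𝓝 0) := by
      have := (ENNReal.continuous_rpow_const (y := 1 / q)).tendsto 0 |>.comp h
      rwa [ENNReal.zero_rpow_of_pos (by positivity)] at this
    have h3 := ENNReal.Tendsto.mul_const (b := μ Set.univ ^ (1 / (2 : ℝ) - 1 / q)) h2
      (Or.inr (ENNReal.rpow_ne_top_of_nonneg (sub_nonneg.2
        (one_div_le_one_div_of_le (by norm_num) hq)) (measure_ne_top _ _)))
    rw [zero_mul] at h3
    have := (ENNReal.continuous_rpow_const (y := 2)).tendsto 0 |>.comp h3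
    rwa [ENNReal.zero_rpow_of_pos (by norm_num)] at this
  refine tendsto_of_tendsto_of_tendsto_of_le_of_le tendsto_const_nhds h1 (fun _ => zero_le)
    fun n => ?_
  have := ENNReal.rpow_le_rpow (eLpNorm'_le_eLpNorm'_mul_rpow_measure_univ
    (by norm_num : (0 : ℝ) < 2) hq (hg n).aestronglyMeasurable) (by norm_num : (0 : ℝ) ≤ 2)
  refine le_trans (le_of_eq ?_) this
  rw [eLpNorm'_eq_lintegral_enorm, ← ENNReal.rpow_mul]
  simp

section Existence
variable {Ω : Type*} [mΩ : MeasurableSpace Ω] {P : Measure Ω} [IsProbabilityMeasure P]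
  {m : ℕ} {W : Fin m → ℝ≥0 → Ω → ℝ}

lemma maximalConst_ne_top {q : ℝ} (hq : 2 ≤ q) (T : ℝ≥0) : maximalConst q T ≠ ∞ := by
  have h1 : 0 ≤ q / 2 := by linarith
  have h2 : 0 ≤ q / 2 - 1 := by linarith
  exact ENNReal.mul_ne_top ENNReal.ofReal_ne_top (ENNReal.mul_ne_top
    (ENNReal.rpow_ne_top_of_nonneg h1 ENNReal.ofReal_ne_top)
    (ENNReal.rpow_ne_top_of_nonneg h2 ENNReal.coe_ne_top))

/-- Maximal inequality for the difference of two step processes. -/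
lemma lintegral_iSup_process_sub_le (hW : IsBrownianMotion W P) (j : Fin m) {T : ℝ≥0}
    (S S' : StepProc (augmentedFiltration W P) 0 T) {X : ℝ≥0 → Ω → ℝ}
    (hXm : AEMeasurable (Function.uncurry X) ((lebesgueTime.restrict (Set.Icc 0 T)).prod P))
    {q : ℝ} (hq : 2 ≤ q) {d : ℕ → ℝ≥0} (hd : ∀ i, d i ≤ T) :
    ∫⁻ ω, (⨆ i, ‖S.process (W j) (d i) ω - S'.process (W j) (d i) ω‖ₑ ^ q) ∂P ≤
      maximalConst q T * (2 ^ (q - 1) *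
        ((∫⁻ ω, ∫⁻ s in Set.Icc 0 T, ‖S.eval s ω - X s ω‖ₑ ^ q ∂lebesgueTime ∂P) +
          ∫⁻ ω, ∫⁻ s in Set.Icc 0 T, ‖S'.eval s ω - X s ω‖ₑ ^ q ∂lebesgueTime ∂P)) := by
  obtain ⟨G, hG⟩ := S.isElementary j
  obtain ⟨G', hG'⟩ := S'.isElementary j
  obtain ⟨G'', hD⟩ := hG.sub hG'
  refine (hD.lintegral_iSup_le hW hq hd).trans (mul_le_mul' le_rfl ?_)
  have hSm := (S.aemeasurable_uncurry_eval hW.measurable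
    (lebesgueTime.restrict (Set.Icc 0 T))).prod_swap
  have hSm' := (S'.aemeasurable_uncurry_eval hW.measurable
    (lebesgueTime.restrict (Set.Icc 0 T))).prod_swap
  have hXm' := hXm.prod_swap
  have e1 : AEMeasurable (fun z : Ω × ℝ≥0 => ‖S.eval z.2 z.1 - X z.2 z.1‖ₑ ^ q)
      (P.prod (lebesgueTime.restrict (Set.Icc 0 T))) := (hSm.sub hXm').enorm.pow_const q
  have e2 : AEMeasurable (fun z : Ω × ℝ≥0 => ‖S'.eval z.2 z.1 - X z.2 z.1‖ₑ ^ q)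
      (P.prod (lebesgueTime.restrict (Set.Icc 0 T))) := (hSm'.sub hXm').enorm.pow_const q
  have e3 : AEMeasurable (fun z : Ω × ℝ≥0 => ‖S.eval z.2 z.1 - S'.eval z.2 z.1‖ₑ ^ q)
      (P.prod (lebesgueTime.restrict (Set.Icc 0 T))) := (hSm.sub hSm').enorm.pow_const q
  have e : ∀ s ω, ‖(EuclideanSpace.single j (S.eval s ω) : EuclideanSpace ℝ (Fin m)) -
      EuclideanSpace.single j (S'.eval s ω)‖ₑ = ‖S.eval s ω - S'.eval s ω‖ₑ :=
    fun s ω => by rw [← enorm_euclideanSpace_single (j := j), euclideanSpace_single_sub]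
  simp only [e]
  rw [← lintegral_prod _ e3, ← lintegral_prod _ e1, ← lintegral_prod _ e2,
    ← lintegral_add_left' e1, ← lintegral_const_mul'' _ (by fun_prop)]
  refine lintegral_mono fun z => ?_
  have := enorm_sub_rpow_le (S.eval z.2 z.1 - X z.2 z.1) (S'.eval z.2 z.1 - X z.2 z.1)
    (q := q) (by linarith)
  rwa [sub_sub_sub_cancel_right] at this

/-- The choice is ε_n = 2^{-nq-n}. An approximation error of ε_n leaves a summable series even after
multiplication by 2^{nq}, which is what forces uniform gaps of order 2^{-n} between successive
integrals. -/
lemma exists_summable_weights {q : ℝ} (hq : 0 < q) : ∃ w ε : ℕ → ℝ≥0∞,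
    (∀ n, w n = ((2 : ℝ≥0∞) ^ n) ^ q) ∧ (∀ n, ε n ≠ 0) ∧ (∀ n, ε (n + 1) ≤ ε n) ∧
    (∀ n, w n * ε n = 2⁻¹ ^ n) ∧ ∀ n, ε n ≤ 2⁻¹ ^ n := by
  have h1 : ∀ n, (((2 : ℝ≥0∞) ^ n) ^ q) ≠ ∞ := fun n =>
    ENNReal.rpow_ne_top_of_nonneg hq.le (ENNReal.pow_ne_top (by norm_num))
  have h2 : ∀ n, (1 : ℝ≥0∞) ≤ ((2 : ℝ≥0∞) ^ n) ^ q := fun n =>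
    ENNReal.one_le_rpow (one_le_pow₀ (by norm_num)) hq
  have h3 : ∀ n, (((2 : ℝ≥0∞) ^ n) ^ q) ≠ 0 := fun n => (zero_lt_one.trans_le (h2 n)).ne'
  refine ⟨fun n => ((2 : ℝ≥0∞) ^ n) ^ q, fun n => (((2 : ℝ≥0∞) ^ n) ^ q)⁻¹ * 2⁻¹ ^ n,
    fun n => rfl, fun n => ?_, fun n => ?_, fun n => ?_, fun n => ?_⟩
  · exact mul_ne_zero (ENNReal.inv_ne_zero.2 (h1 n)) (pow_ne_zero _ (by simp))
  · refine mul_le_mul' (ENNReal.inv_le_inv.2 (ENNReal.rpow_le_rpow ?_ hq.le)) ?_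
    · exact pow_le_pow_right₀ (by norm_num) n.le_succ
    · exact pow_le_pow_right_of_le_one' (by simp) n.le_succ
  · dsimp only
    rw [← mul_assoc, ENNReal.mul_inv_cancel (h3 n) (h1 n), one_mul]
  · exact (mul_le_mul' (ENNReal.inv_le_one.2 (h2 n)) le_rfl).trans_eq (one_mul _)

lemma tsum_two_inv_pow_ne_top : ∑' n : ℕ, (2⁻¹ : ℝ≥0∞) ^ n ≠ ∞ := by
  rw [ENNReal.tsum_geometric, ENNReal.inv_ne_top]
  simp

/-- Rapidly converging step processes have locally uniformly converging integrals. -/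
lemma exists_limit_of_tsum_ne_top {q : ℝ} (hq : 0 < q) {T : ℝ≥0} {d : ℕ → ℝ≥0}
    (hd : ∀ (f : ℝ≥0 → ℝ), ContinuousOn f (Set.Icc 0 T) → ∀ s : Set ℝ, IsClosed s →
      (∀ i, f (d i) ∈ s) → ∀ t ≤ T, f t ∈ s)
    {f : ℕ → ℝ≥0 → ℝ} (hf : ∀ n, Continuous (f n))
    (h : ∑' n : ℕ, ((2 : ℝ≥0∞) ^ n) ^ q * ⨆ i, ‖f n (d i) - f (n + 1) (d i)‖ₑ ^ q ≠ ∞) :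
    (∀ t ≤ T, Tendsto (fun n => f n t) atTop (𝓝 (limUnder atTop fun n => f n t))) ∧
      ContinuousOn (fun t => limUnder atTop fun n => f n t) (Set.Icc 0 T) := by
  set K := ∑' n : ℕ, ((2 : ℝ≥0∞) ^ n) ^ q * ⨆ i, ‖f n (d i) - f (n + 1) (d i)‖ₑ ^ q with hK
  have hKq : K ^ (1 / q) ≠ ∞ := ENNReal.rpow_ne_top_of_nonneg (by positivity) h
  -- Each single term of the series is at most K, so the gap is at most K^{1/q}·2^{-n} at the times
  -- d i, and at all times by continuity and density.
  have h1 : ∀ n, ∀ t ≤ T, dist (f n t) (f (n + 1) t) ≤ (K ^ (1 / q)).toReal * (1 / 2) ^ n := by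
    intro n t ht
    have hcl : IsClosed {x : ℝ | ‖x‖ ≤ (K ^ (1 / q)).toReal * (1 / 2) ^ n} :=
      isClosed_le continuous_norm continuous_const
    refine hd (fun t => f n t - f (n + 1) t) ((hf n).sub (hf (n + 1))).continuousOn _ hcl
      (fun i => ?_) t ht
    have h2 : ((2 : ℝ≥0∞) ^ n * ‖f n (d i) - f (n + 1) (d i)‖ₑ) ^ q ≤ K := by
      rw [ENNReal.mul_rpow_of_nonneg _ _ hq.le]
      exact (mul_le_mul' le_rfl
        (le_iSup (fun i => ‖f n (d i) - f (n + 1) (d i)‖ₑ ^ q) i)).trans (ENNReal.le_tsum n)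
    have h3 : (2 : ℝ≥0∞) ^ n * ‖f n (d i) - f (n + 1) (d i)‖ₑ ≤ K ^ (1 / q) := by
      rw [one_div]; exact (ENNReal.le_rpow_inv_iff hq).2 h2
    have h4 := ENNReal.toReal_mono hKq h3
    rw [ENNReal.toReal_mul, ENNReal.toReal_pow, ENNReal.toReal_ofNat, toReal_enorm] at h4
    rw [Set.mem_ofPred_eq, one_div (2 : ℝ), inv_pow, ← div_eq_mul_inv, le_div_iff₀ (by positivity)]
    linarith
  have h2 : ∀ t ≤ T, Tendsto (fun n => f n t) atTop (𝓝 (limUnder atTop fun n => f n t)) :=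
    fun t ht => CauchySeq.tendsto_limUnder
      (cauchySeq_of_le_geometric _ _ (by norm_num) fun n => h1 n t ht)
  refine ⟨h2, ?_⟩
  have h3 : TendstoUniformlyOn f (fun t => limUnder atTop fun n => f n t) atTop
      (Set.Icc 0 T) := by
    rw [Metric.tendstoUniformlyOn_iff]
    intro δ hδ
    have h4 : Tendsto (fun n : ℕ => (K ^ (1 / q)).toReal * (1 / 2 : ℝ) ^ n / (1 - 1 / 2)) atTop
        (𝓝 0) := by
      have := ((tendsto_pow_atTop_nhds_zero_of_lt_one (r := (1 / 2 : ℝ)) (by norm_num)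
        (by norm_num)).const_mul (K ^ (1 / q)).toReal).div_const (1 - 1 / 2)
      simpa using this
    filter_upwards [h4.eventually_lt_const hδ] with n hn t ht
    rw [dist_comm]
    exact (dist_le_of_le_geometric_of_tendsto _ _ (by norm_num) (fun n => h1 n t ht.2)
      (h2 t ht.2) n).trans_lt hn
  exact h3.continuousOn (Frequently.of_forall fun n => (hf n).continuousOn)

end Existence

section Existence
variable {Ω : Type*} [mΩ : MeasurableSpace Ω] {P : Measure Ω} [IsProbabilityMeasure P]
  {m : ℕ} {W : Fin m → ℝ≥0 → Ω → ℝ}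

/-- The limit of the integrals of step processes is the Itô integral. -/
lemma isItoIntegral_of_tendsto_process (hW : IsBrownianMotion W P) (j : Fin m) {T t : ℝ≥0}
    (ht : t ≤ T) {X : ℝ≥0 → Ω → ℝ} {S : ℕ → StepProc (augmentedFiltration W P) 0 T} {ξ : Ω → ℝ}
    (h1 : ∀ᵐ ω ∂P, Tendsto (fun n => ∫⁻ s in Set.Icc 0 T, ‖(S n).eval s ω - X s ω‖ₑ ^ (2 : ℝ)
      ∂lebesgueTime) atTop (𝓝 0))
    (h2 : ∀ᵐ ω ∂P, Tendsto (fun n => (S n).process (W j) t ω) atTop (𝓝 (ξ ω))) :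
    IsItoIntegral (augmentedFiltration W P) P (W j) 0 t X ξ := by
  choose S' hS' hS'' using fun n => (S n).exists_restrict ht
  refine ⟨S', ?_, ?_⟩
  · filter_upwards [h1] with ω hω
    refine tendsto_of_tendsto_of_tendsto_of_le_of_le tendsto_const_nhds hω (fun _ => zero_le)
      fun n => ?_
    dsimp only
    -- The restriction agrees with the original step process only on [0, t); the endpoint has
    -- measure zero.
    rw [← setLIntegral_congr (Ico_ae_eq_Icc (a := 0) (b := t))]
    calc ∫⁻ s in Set.Ico 0 t, ‖(S' n).eval s ω - X s ω‖ₑ ^ (2 : ℝ) ∂lebesgueTime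
        = ∫⁻ s in Set.Ico 0 t, ‖(S n).eval s ω - X s ω‖ₑ ^ (2 : ℝ) ∂lebesgueTime :=
          setLIntegral_congr_fun measurableSet_Ico fun s hs => by rw [hS' n s hs.2]
      _ ≤ _ := lintegral_mono_set (Set.Ico_subset_Icc_self.trans (Set.Icc_subset_Icc_right ht))
  · simp only [hS'']
    refine tendstoInMeasure_of_tendsto_ae (fun n => ?_) h2
    obtain ⟨G, hG⟩ := (S n).isElementary j
    exact (hG.aemeasurable_integral hW t).aestronglyMeasurable

/-- Existence of the Itô integral process, as a limit of integrals of step processes. -/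
lemma exists_isContItoIntegral (hW : IsBrownianMotion W P) (j : Fin m) {T : ℝ≥0}
    {X : ℝ≥0 → Ω → ℝ} (hXa : ∀ s, Measurable[augmentedFiltration W P s] (X s))
    (hXm : AEMeasurable (Function.uncurry X) ((lebesgueTime.restrict (Set.Icc 0 T)).prod P))
    {q : ℝ} (hq : 2 ≤ q)
    (hfin : ∫⁻ ω, ∫⁻ s in Set.Icc 0 T, ‖X s ω‖ₑ ^ q ∂lebesgueTime ∂P ≠ ∞) :
    ∃ (S : ℕ → StepProc (augmentedFiltration W P) 0 T) (J : ℝ≥0 → Ω → ℝ),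
      IsContItoIntegral (augmentedFiltration W P) P (W j) T X J ∧
      (∀ᵐ ω ∂P, ∀ t ≤ T, Tendsto (fun n => (S n).process (W j) t ω) atTop (𝓝 (J t ω))) ∧
      Tendsto (fun n => ∫⁻ ω, ∫⁻ s in Set.Icc 0 T, ‖(S n).eval s ω - X s ω‖ₑ ^ q ∂lebesgueTime ∂P)
        atTop (𝓝 0) := by
  have hq0 : 0 < q := by linarith
  obtain ⟨w, ε, hw, hε0, hεa, hwε, hε2⟩ := exists_summable_weights hq0
  choose S hS using fun n => exists_stepProc_approx hW.measurable hXa hXm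
    (by linarith : 1 ≤ q) hfin (hε0 n)
  obtain ⟨d, hdT, hd⟩ := exists_dense_sequence T
  have hSm : ∀ n, AEMeasurable (fun z : Ω × ℝ≥0 => (S n).eval z.2 z.1 - X z.2 z.1)
      (P.prod (lebesgueTime.restrict (Set.Icc 0 T))) := fun n =>
    (((S n).aemeasurable_uncurry_eval hW.measurable _).sub hXm).prod_swap
  have hJm : ∀ n t, AEMeasurable ((S n).process (W j) t) P := fun n t => by
    obtain ⟨G, hG⟩ := (S n).isElementary j
    exact hG.aemeasurable_integral hW t
  -- The expectation of the series is finite by the maximal inequality applied to successive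
  -- differences, so the series is finite almost surely.
  have hsup : ∀ᵐ ω ∂P, ∑' n : ℕ, ((2 : ℝ≥0∞) ^ n) ^ q * (⨆ i,
      ‖(S n).process (W j) (d i) ω - (S (n + 1)).process (W j) (d i) ω‖ₑ ^ q) ≠ ∞ := by
    have hm : ∀ n, AEMeasurable (fun ω => ⨆ i,
        ‖(S n).process (W j) (d i) ω - (S (n + 1)).process (W j) (d i) ω‖ₑ ^ q) P := fun n =>
      AEMeasurable.iSup fun i => ((hJm n _).sub (hJm (n + 1) _)).enorm.pow_const q
    have hm' : ∀ n : ℕ, AEMeasurable (fun ω => ((2 : ℝ≥0∞) ^ n) ^ q * ⨆ i,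
        ‖(S n).process (W j) (d i) ω - (S (n + 1)).process (W j) (d i) ω‖ₑ ^ q) P := fun n =>
      (hm n).const_mul _
    refine (ae_lt_top' (AEMeasurable.tsum hm') ?_).mono fun _ h => h.ne
    rw [lintegral_tsum hm']
    set C : ℝ≥0∞ := maximalConst q T * (2 ^ (q - 1) * 2) with hC
    have hCt : C ≠ ∞ := ENNReal.mul_ne_top (maximalConst_ne_top hq T)
      (ENNReal.mul_ne_top (ENNReal.rpow_ne_top_of_nonneg (by linarith) (by norm_num)) (by norm_num))
    refine ne_top_of_le_ne_top (b := C * ∑' n : ℕ, (2⁻¹ : ℝ≥0∞) ^ n)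
      (ENNReal.mul_ne_top hCt tsum_two_inv_pow_ne_top) ?_
    rw [← ENNReal.tsum_mul_left]
    refine ENNReal.tsum_le_tsum fun n => ?_
    rw [lintegral_const_mul'' _ (hm n)]
    calc ((2 : ℝ≥0∞) ^ n) ^ q * ∫⁻ ω, (⨆ i,
          ‖(S n).process (W j) (d i) ω - (S (n + 1)).process (W j) (d i) ω‖ₑ ^ q) ∂P
        ≤ ((2 : ℝ≥0∞) ^ n) ^ q * (maximalConst q T * (2 ^ (q - 1) * (ε n + ε n))) := by
          gcongr
          refine (lintegral_iSup_process_sub_le hW j (S n) (S (n + 1)) hXm hq hdT).trans ?_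
          gcongr
          · exact hS n
          · exact (hS (n + 1)).trans (hεa n)
      _ = C * (w n * ε n) := by rw [hC, hw]; ring
      _ = C * 2⁻¹ ^ n := by rw [hwε]
  have hpath : ∀ᵐ ω ∂P, (∀ t ≤ T, Tendsto (fun n => (S n).process (W j) t ω) atTop
      (𝓝 (limUnder atTop fun n => (S n).process (W j) t ω))) ∧
      ContinuousOn (fun t => limUnder atTop fun n => (S n).process (W j) t ω) (Set.Icc 0 T) := by
    filter_upwards [hsup, (hW.isBrownianReal j).cont] with ω h1 h2
    exact exists_limit_of_tsum_ne_top hq0 hd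
      (f := fun n t => (S n).process (W j) t ω) (fun n => (S n).continuous_process h2) h1
  have hinner : ∀ n, AEMeasurable (fun ω => ∫⁻ s in Set.Icc 0 T,
      ‖(S n).eval s ω - X s ω‖ₑ ^ q ∂lebesgueTime) P := fun n =>
    ((hSm n).enorm.pow_const q).lintegral_prod_right'
  have hq_tendsto : ∀ᵐ ω ∂P, Tendsto (fun n => ∫⁻ s in Set.Icc 0 T,
      ‖(S n).eval s ω - X s ω‖ₑ ^ q ∂lebesgueTime) atTop (𝓝 0) := by
    have : ∀ᵐ ω ∂P, ∑' n, ∫⁻ s in Set.Icc 0 T,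
        ‖(S n).eval s ω - X s ω‖ₑ ^ q ∂lebesgueTime ≠ ∞ := by
      refine (ae_lt_top' (AEMeasurable.tsum hinner) ?_).mono fun _ h => h.ne
      rw [lintegral_tsum hinner]
      exact ne_top_of_le_ne_top tsum_two_inv_pow_ne_top
        (ENNReal.tsum_le_tsum fun n => (hS n).trans (hε2 n))
    filter_upwards [this] with ω hω
    exact ENNReal.tendsto_atTop_zero_of_tsum_ne_top hω
  have hsec : ∀ᵐ ω ∂P, ∀ n, AEMeasurable (fun s => (S n).eval s ω - X s ω)
      (lebesgueTime.restrict (Set.Icc 0 T)) :=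
    ae_all_iff.2 fun n => by
      filter_upwards [(hSm n).aestronglyMeasurable.prodMk_left] with ω hω
      exact hω.aemeasurable
  have h2_tendsto : ∀ᵐ ω ∂P, Tendsto (fun n => ∫⁻ s in Set.Icc 0 T,
      ‖(S n).eval s ω - X s ω‖ₑ ^ (2 : ℝ) ∂lebesgueTime) atTop (𝓝 0) := by
    filter_upwards [hq_tendsto, hsec] with ω h1 h2
    exact tendsto_lintegral_sq_of_tendsto_lintegral_rpow h2 hq h1
  refine ⟨S, fun t ω => limUnder atTop fun n => (S n).process (W j) t ω,
    ⟨fun t ht => isItoIntegral_of_tendsto_process hW j ht h2_tendsto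
      (hpath.mono fun ω h => h.1 t ht), hpath.mono fun ω h => h.2⟩,
    hpath.mono fun ω h => h.1, ?_⟩
  refine tendsto_of_tendsto_of_tendsto_of_le_of_le tendsto_const_nhds
    (ENNReal.tendsto_atTop_zero_of_tsum_ne_top tsum_two_inv_pow_ne_top) (fun _ => zero_le)
    fun n => (hS n).trans (hε2 n)

end Existence

/-! ### The constant, and the bound for limits of step integrals. -/

/-- Doob's factor times the moment factor is (2p/(2p-1))^{2p}(2p-1)^p = (4p²/(2p-1))^p, and p² ≤ p³
for p ≥ 1. -/
lemma maximalConst_two_mul_le {p : ℝ} (hp : 1 ≤ p) {T : ℝ≥0} (hT : 0 < T) :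
    maximalConst (2 * p) T ≤
      ENNReal.ofReal ((4 * p ^ 3 / (2 * p - 1)) ^ p * (T : ℝ) ^ (p - 1)) := by
  have h1 : 0 < 2 * p - 1 := by linarith
  have hT' : (0 : ℝ) < T := hT
  have e1 : 2 * p / 2 = p := by ring
  have e2 : (T : ℝ≥0∞) ^ (p - 1) = ENNReal.ofReal ((T : ℝ) ^ (p - 1)) := by
    rw [← ENNReal.ofReal_coe_nnreal, ENNReal.ofReal_rpow_of_pos hT']
  rw [maximalConst, e1, e2, ENNReal.ofReal_rpow_of_pos h1,
    ← ENNReal.ofReal_mul (by positivity), ← ENNReal.ofReal_mul (by positivity), ← mul_assoc]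
  refine ENNReal.ofReal_le_ofReal (mul_le_mul_of_nonneg_right ?_ (by positivity))
  rw [Real.rpow_mul (by positivity), ← Real.mul_rpow (by positivity) h1.le]
  refine Real.rpow_le_rpow (by positivity) ?_ (by linarith)
  rw [Real.rpow_two, div_pow, div_mul_eq_mul_div, div_le_div_iff₀ (by positivity) h1]
  have h2 : p ^ 2 ≤ p ^ 3 := pow_le_pow_right₀ hp (by norm_num)
  nlinarith [mul_le_mul_of_nonneg_right h2 (sq_nonneg (2 * p - 1))]

section Bound
variable {Ω : Type*} [mΩ : MeasurableSpace Ω] {P : Measure Ω} [IsProbabilityMeasure P]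
  {m : ℕ} {W : Fin m → ℝ≥0 → Ω → ℝ}

lemma sum_euclideanSpace_single (v : EuclideanSpace ℝ (Fin m)) :
    ∑ j, EuclideanSpace.single j (v j) = v := by
  ext i
  simp [Finset.sum_apply]

/-- The maximal inequality passes to limits of integrals of step processes. -/
lemma lintegral_iSup_limit_le (hW : IsBrownianMotion W P) {T : ℝ≥0}
    {X : ℝ≥0 → Ω → EuclideanSpace ℝ (Fin m)}
    (hXm : ∀ j, AEMeasurable (Function.uncurry fun s ω => X s ω j)
      ((lebesgueTime.restrict (Set.Icc 0 T)).prod P))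
    {q : ℝ} (hq : 2 ≤ q) {S : Fin m → ℕ → StepProc (augmentedFiltration W P) 0 T}
    {J : Fin m → ℝ≥0 → Ω → ℝ}
    (hJ : ∀ᵐ ω ∂P, ∀ j, ∀ t ≤ T, Tendsto (fun n => (S j n).process (W j) t ω) atTop (𝓝 (J j t ω)))
    (hS : ∀ j, Tendsto (fun n => ∫⁻ ω, ∫⁻ s in Set.Icc 0 T,
      ‖(S j n).eval s ω - X s ω j‖ₑ ^ q ∂lebesgueTime ∂P) atTop (𝓝 0))
    {d : ℕ → ℝ≥0} (hd : ∀ i, d i ≤ T) :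
    ∫⁻ ω, (⨆ i, ‖∑ j, J j (d i) ω‖ₑ ^ q) ∂P ≤ maximalConst q T *
      ∫⁻ ω, ∫⁻ s in Set.Icc 0 T, ‖X s ω‖ₑ ^ q ∂lebesgueTime ∂P := by
  have hq0 : 0 < q := by linarith
  set μ := P.prod (lebesgueTime.restrict (Set.Icc 0 T)) with hμ
  -- The approximation error is split by coordinates: the approximating row process is X plus the
  -- sum of the E j, so its L^q norm tends to that of X by the triangle inequality.
  set E : Fin m → ℕ → Ω × ℝ≥0 → EuclideanSpace ℝ (Fin m) := fun j n z =>
    EuclideanSpace.single j ((S j n).eval z.2 z.1 - X z.2 z.1 j) with hE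
  set X' : Ω × ℝ≥0 → EuclideanSpace ℝ (Fin m) := fun z => X z.2 z.1 with hX'
  have hsing : ∀ j, Continuous fun x : ℝ => (EuclideanSpace.single j x : EuclideanSpace ℝ (Fin m)) :=
    fun j => (Isometry.of_dist_eq fun x y => by
      rw [dist_eq_norm, dist_eq_norm, ← euclideanSpace_single_sub, PiLp.norm_single]).continuous
  have hdm : ∀ j n, AEMeasurable (fun z : Ω × ℝ≥0 => (S j n).eval z.2 z.1 - X z.2 z.1 j) μ :=
    fun j n => (((S j n).aemeasurable_uncurry_eval hW.measurable _).sub (hXm j)).prod_swap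
  have hEm : ∀ j n, AEStronglyMeasurable (E j n) μ := fun j n =>
    (hsing j).comp_aestronglyMeasurable (hdm j n).aestronglyMeasurable
  have hX'm : AEStronglyMeasurable X' μ := by
    have : X' = fun z => ∑ j, EuclideanSpace.single j (X z.2 z.1 j) := by
      ext1 z; rw [sum_euclideanSpace_single]
    rw [this]
    exact Finset.aestronglyMeasurable_fun_sum _ fun j _ =>
      (hsing j).comp_aestronglyMeasurable (hXm j).prod_swap.aestronglyMeasurable
  have hYE : ∀ n, (fun z : Ω × ℝ≥0 => ∑ j, EuclideanSpace.single j ((S j n).eval z.2 z.1)) =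
      X' + ∑ j, E j n := fun n => by
    ext1 z
    rw [Pi.add_apply, Finset.sum_apply]
    change _ = X z.2 z.1 + _
    conv_rhs => rw [← sum_euclideanSpace_single (X z.2 z.1)]
    simp only [hE, euclideanSpace_single_sub, Finset.sum_sub_distrib, add_sub_cancel]
  have hpow : ∀ f : Ω × ℝ≥0 → EuclideanSpace ℝ (Fin m), eLpNorm' f q μ ^ q =
      ∫⁻ z, ‖f z‖ₑ ^ q ∂μ := fun f => by
    rw [eLpNorm'_eq_lintegral_enorm, ← ENNReal.rpow_mul, one_div_mul_cancel hq0.ne',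
      ENNReal.rpow_one]
  have hElim : ∀ j, Tendsto (fun n => eLpNorm' (E j n) q μ) atTop (𝓝 0) := fun j => by
    have h1 := (ENNReal.continuous_rpow_const (y := 1 / q)).tendsto 0 |>.comp (hS j)
    rw [ENNReal.zero_rpow_of_pos (by positivity)] at h1
    refine h1.congr fun n => ?_
    rw [eLpNorm'_eq_lintegral_enorm, Function.comp_apply]
    congr 1
    rw [← lintegral_prod (fun z : Ω × ℝ≥0 => ‖(S j n).eval z.2 z.1 - X z.2 z.1 j‖ₑ ^ q)
      ((hdm j n).enorm.pow_const q)]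
    simp only [hE, enorm_euclideanSpace_single]
    rfl
  have hlim : Tendsto (fun n => (eLpNorm' X' q μ + ∑ j, eLpNorm' (E j n) q μ) ^ q) atTop
      (𝓝 (∫⁻ ω, ∫⁻ s in Set.Icc 0 T, ‖X s ω‖ₑ ^ q ∂lebesgueTime ∂P)) := by
    have h1 : Tendsto (fun n => eLpNorm' X' q μ + ∑ j, eLpNorm' (E j n) q μ) atTop
        (𝓝 (eLpNorm' X' q μ)) := by
      have := (tendsto_finsetSum Finset.univ fun j _ => hElim j).const_add (eLpNorm' X' q μ)
      simpa using this
    have h2 := (ENNReal.continuous_rpow_const (y := q)).tendsto (eLpNorm' X' q μ) |>.comp h1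
    rw [hpow, hμ, lintegral_prod _ (hX'm.enorm.pow_const q)] at h2
    exact h2
  have hstep : ∀ n, ∫⁻ ω, (⨆ i, ‖∑ j, (S j n).process (W j) (d i) ω‖ₑ ^ q) ∂P ≤
      maximalConst q T * (eLpNorm' X' q μ + ∑ j, eLpNorm' (E j n) q μ) ^ q := fun n => by
    choose G hG using fun j => (S j n).isElementary j
    obtain ⟨G', hG'⟩ := IsElementary.sum Finset.univ fun j _ => hG j
    refine (hG'.lintegral_iSup_le hW hq hd).trans (mul_le_mul' le_rfl ?_)
    have hYm : AEStronglyMeasurable (fun z : Ω × ℝ≥0 =>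
        ∑ j, (EuclideanSpace.single j ((S j n).eval z.2 z.1) : EuclideanSpace ℝ (Fin m))) μ := by
      rw [hYE n]
      exact hX'm.add (Finset.aestronglyMeasurable_sum _ fun j _ => hEm j n)
    rw [← lintegral_prod (fun z : Ω × ℝ≥0 =>
      ‖∑ j, (EuclideanSpace.single j ((S j n).eval z.2 z.1) : EuclideanSpace ℝ (Fin m))‖ₑ ^ q)
      (hYm.enorm.pow_const q), ← hpow, hYE n]
    refine ENNReal.rpow_le_rpow ?_ hq0.le
    refine (eLpNorm'_add_le hX'm (Finset.aestronglyMeasurable_sum _ fun j _ => hEm j n)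
      (by linarith)).trans (add_le_add le_rfl ?_)
    exact eLpNorm'_sum_le (fun j _ => hEm j n) (by linarith)
  have hm : ∀ n, AEMeasurable (fun ω => ⨆ i, ‖∑ j, (S j n).process (W j) (d i) ω‖ₑ ^ q) P :=
    fun n => AEMeasurable.iSup fun i => by
      have : ∀ j, AEMeasurable ((S j n).process (W j) (d i)) P := fun j => by
        obtain ⟨G, hG⟩ := (S j n).isElementary j
        exact hG.aemeasurable_integral hW _
      exact (Finset.aemeasurable_fun_sum _ fun j _ => this j).enorm.pow_const q
  -- Fatou's lemma. The limit at each time d i is at most the lower limit of the suprema, so no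
  -- uniform convergence is used here.
  calc ∫⁻ ω, (⨆ i, ‖∑ j, J j (d i) ω‖ₑ ^ q) ∂P
      ≤ ∫⁻ ω, liminf (fun n => ⨆ i, ‖∑ j, (S j n).process (W j) (d i) ω‖ₑ ^ q) atTop ∂P := by
        refine lintegral_mono_ae ?_
        filter_upwards [hJ] with ω hω
        refine iSup_le fun i => ?_
        have h1 : Tendsto (fun n => ‖∑ j, (S j n).process (W j) (d i) ω‖ₑ ^ q) atTop
            (𝓝 (‖∑ j, J j (d i) ω‖ₑ ^ q)) :=
          ((ENNReal.continuous_rpow_const (y := q)).comp continuous_enorm).tendsto _ |>.comp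
            (tendsto_finsetSum _ fun j _ => hω j (d i) (hd i))
        rw [← h1.liminf_eq]
        exact liminf_le_liminf (Eventually.of_forall fun n =>
          le_iSup (fun i => ‖∑ j, (S j n).process (W j) (d i) ω‖ₑ ^ q) i)
    _ ≤ liminf (fun n => ∫⁻ ω, (⨆ i, ‖∑ j, (S j n).process (W j) (d i) ω‖ₑ ^ q) ∂P) atTop :=
        lintegral_liminf_le' hm
    _ ≤ liminf (fun n => maximalConst q T *
          (eLpNorm' X' q μ + ∑ j, eLpNorm' (E j n) q μ) ^ q) atTop :=
        liminf_le_liminf (Eventually.of_forall hstep)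
    _ = _ := (ENNReal.Tendsto.const_mul hlim (Or.inr (maximalConst_ne_top hq T))).liminf_eq

end Bound
end ItoCalculus

/-! ### The theorem. -/

open ItoCalculus

theorem mainTheorem8 {Ω : Type*} [MeasurableSpace Ω] (P : Measure Ω) [IsProbabilityMeasure P]
    (m : ℕ) (W : Fin m → ℝ≥0 → Ω → ℝ) (hW : ItoCalculus.IsBrownianMotion W P)
    (T : ℝ≥0) (hT : 0 < T) (p : ℝ) (hp : 1 ≤ p)
    (X : ℝ≥0 → Ω → EuclideanSpace ℝ (Fin m))
    (hX : ItoCalculus.MemMRow (ItoCalculus.augmentedFiltration W P) P 2 0 T X)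
    (hXp : ∫⁻ ω, ∫⁻ s in Set.Icc 0 T, ‖X s ω‖ₑ ^ (2 * p) ∂ItoCalculus.lebesgueTime ∂P < ∞) :
    (∃ I : ℝ≥0 → Ω → ℝ,
      ItoCalculus.IsItoIntegralRow (ItoCalculus.augmentedFiltration W P) P W T X I) ∧
    ∀ I : ℝ≥0 → Ω → ℝ,
      ItoCalculus.IsItoIntegralRow (ItoCalculus.augmentedFiltration W P) P W T X I →
      ∫⁻ ω, (⨆ t ∈ Set.Icc 0 T, ‖I t ω‖ₑ ^ (2 * p)) ∂P ≤
        ENNReal.ofReal ((4 * p ^ 3 / (2 * p - 1)) ^ p * (T : ℝ) ^ (p - 1)) *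
          ∫⁻ ω, ∫⁻ s in Set.Icc 0 T, ‖X s ω‖ₑ ^ (2 * p) ∂ItoCalculus.lebesgueTime ∂P := by
  have hq : 2 ≤ 2 * p := by linarith
  have hfin : ∀ j, ∫⁻ ω, ∫⁻ s in Set.Icc 0 T, ‖X s ω j‖ₑ ^ (2 * p) ∂lebesgueTime ∂P ≠ ∞ :=
    fun j => ne_top_of_le_ne_top hXp.ne (lintegral_mono fun ω => lintegral_mono fun s =>
      ENNReal.rpow_le_rpow (enorm_le_iff_norm_le.2 (PiLp.norm_apply_le (X s ω) j)) (by linarith))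
  choose S J hJ hlim hS using fun j =>
    exists_isContItoIntegral hW j (hX j).adapted (hX j).aemeasurable hq (hfin j)
  refine ⟨⟨fun t ω => ∑ j, J j t ω, J, hJ, fun t ω => rfl⟩, ?_⟩
  rintro I ⟨J', hJ', hI⟩
  obtain ⟨d, hdT, hd⟩ := exists_dense_sequence T
  have hsec : ∀ j, ∀ t ≤ T, ∀ᵐ ω ∂P,
      AEMeasurable (fun s => X s ω j) (lebesgueTime.restrict (Set.Icc 0 t)) := fun j t ht => by
    filter_upwards [(hX j).aemeasurable.prod_swap.aestronglyMeasurable.prodMk_left] with ω hω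
    exact AEMeasurable.mono_measure hω.aemeasurable
      (Measure.restrict_mono (Set.Icc_subset_Icc_right ht) le_rfl)
  -- Uniqueness holds for each time separately; countably many times d i share one null set.
  have heq : ∀ᵐ ω ∂P, ∀ j i, J' j (d i) ω = J j (d i) ω :=
    ae_all_iff.2 fun j => ae_all_iff.2 fun i =>
      ((hJ' j).isItoIntegral _ (hdT i)).ae_eq hW (hsec j _ (hdT i))
        ((hJ j).isItoIntegral _ (hdT i))
  calc ∫⁻ ω, (⨆ t ∈ Set.Icc 0 T, ‖I t ω‖ₑ ^ (2 * p)) ∂P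
      ≤ ∫⁻ ω, (⨆ i, ‖∑ j, J j (d i) ω‖ₑ ^ (2 * p)) ∂P := by
        refine lintegral_mono_ae ?_
        -- The paths of I are almost surely continuous, so a closed bound at the dense times d i
        -- extends to every t in [0, T]. This also disposes of the uncountable supremum, whose
        -- measurability is never needed.
        filter_upwards [heq, ae_all_iff.2 fun j => (hJ' j).continuousOn] with ω h1 h2
        refine iSup₂_le fun t ht => ?_
        have hcl : IsClosed {x : ℝ | ‖x‖ₑ ^ (2 * p) ≤ ⨆ i, ‖∑ j, J j (d i) ω‖ₑ ^ (2 * p)} :=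
          isClosed_le ((ENNReal.continuous_rpow_const (y := 2 * p)).comp continuous_enorm)
            continuous_const
        refine hd (fun t => I t ω) ?_ _ hcl (fun i => ?_) t ht.2
        · simp only [hI]
          exact continuousOn_finsetSum _ fun j _ => h2 j
        · have : I (d i) ω = ∑ j, J j (d i) ω := by
            rw [hI]; exact Finset.sum_congr rfl fun j _ => h1 j i
          rw [this]
          exact le_iSup (fun i => ‖∑ j, J j (d i) ω‖ₑ ^ (2 * p)) i
    _ ≤ maximalConst (2 * p) T *
          ∫⁻ ω, ∫⁻ s in Set.Icc 0 T, ‖X s ω‖ₑ ^ (2 * p) ∂lebesgueTime ∂P :=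
        lintegral_iSup_limit_le hW (fun j => (hX j).aemeasurable) hq (ae_all_iff.2 hlim) hS hdT
    _ ≤ _ := mul_le_mul' (maximalConst_two_mul_le hp hT) le_rfl
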